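/- **Setting.** $S$ is a complex manifold and $\alpha:Z\to S$ a differentiable fiber bundle. An integrable complex structure on the relative tangent bundle is a smooth complex subbundle $T_{rel}\subset T_{Z_{\mathbb C}/S}=\ker(d\alpha)\otimes\mathbb C$ with $T_{Z_{\mathbb C}/S}=T_{rel}\oplus\bar T_{rel}$ and $[T_{rel},T_{rel}]\subset T_{rel}$. A $\bar\partial$-operator (resp. an almost connection) on $(\alpha,T_{rel})$ is a differentiable splitting over $\alpha^*\bar T_S$ (resp. $\alpha^*T_S$) of $T_{Z_{\mathbb C}}/\bar T_{rel}\to\alpha^*T_{S_{\mathbb C}}$. The bundle $\bar T\subset T_{Z_{\mathbb C}}$ of a $\bar\partial$-operator is the inverse image of its image, and the operator is integrable if $[\bar T,\bar T]\subset\bar T$; an integrable $\bar\partial$-operator is the same as a holomorphic fibration with underlying complex fiber bundle $(\alpha,T_{rel})$. An almost connection on $(\alpha,T)$ is one whose image lies in $T\subset T_{Z_{\mathbb C}}/\bar T_{rel}$. A local lift $l$ to $T_{Z_{\mathbb C}}$ of such an operator satisfies the local lifting condition if $[\bar T_{rel},l(\alpha^*a)]\subset\bar T_{rel}$ for all local smooth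 vector fields $a$ of the relevant type on $S$; the operator is holomorphic along the vertical direction if it has such lifts near every point of $Z$. A holomorphic flat bundle on $(\alpha,T_{rel})$ is an integrable $\bar\partial$-operator together with an almost connection $\nabla$ on $(\alpha,T)$ that is a holomorphic map $\alpha^*T_S\to T$ and whose image is closed under the Lie bracket. A holomorphic Higgs field on a holomorphic fibration $g:Y\to S$ is a holomorphic bundle map $\theta:g^*T_S\to T_{Y/S}$ with $[\theta,\theta]=0$. A hermitian metric $\omega$ on $(\alpha,T_{rel})$ is a closed real two-form on $Z$ whose restriction $\omega_s$ to every fiber $Z_s$ is of type $(1,1)$ and positive definite. Its Chern connection with respect to a $\bar\partial$-operator with almost complex structure $T$ is the unique almost connection on $(\alpha,T)$ whose image is orthogonal to $T_{rel}$ for $(u,v)\mapsto\omega(u,\bar v)$. Let $\mathfrak{aut}(Z_s,\omega_s)$ be the Lie algebra of the group of holomorphic isometries of $Z_s$, viewed as a set of holomorphic vector fields on $Z_s$. Call $\omega$ auto-finite if this algebra has a finite dimension independent of $s$, and $\theta$-adapted if $\theta(\xi)\in\mathfrak{aut}(Z_s,\omega_s)+i\,\mathfrak{aut}(Z_s,\omega_s)$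 for all $\xi\in T_{S,s}$, $s\in S$. A complex conjugation $\bar\theta_\omega$ of $\theta$ is a differentiable section of $\bar\Omega_S\otimes g_*T_{Y/S}$ such that for all such $\xi$ one can write $\theta(\xi)=a+ib$, $\bar\theta_\omega(\bar\xi)=-(a-ib)$ with $a,b\in\mathfrak{aut}(Z_s,\omega_s)$ (it is unique when $\mathfrak{aut}(Z_s,\omega_s)\cap i\,\mathfrak{aut}(Z_s,\omega_s)=0$ for all $s$). **Data.** Let $T_A,T_B$ be two integrable complex structures on the relative tangent bundle of $\alpha$, and $\beta$ a real bundle automorphism of $T_Z$ with $\beta(T_A)=T_B$ that induces the identity on $\alpha^*T_S$ and preserves the local lifting condition: a smooth local lift $l:\alpha^*\bar T_S\to T_{Z_{\mathbb C}}$, or $l:\alpha^*T_S\to T_{Z_{\mathbb C}}$, satisfies it for $T_A$ if and only if $\beta\circ l$ satisfies it for $T_B$. Let $g:Y\to S$ be a holomorphic fibration on $(\alpha,T_B)$ with operator $\bar\partial_g$, let $\theta$ be a holomorphic Higgs field on $g$, and let $\omega$ be an allowable hermitian metric on $g$: $\beta$ preserves $\omega$, the Chern connection of $(\bar\partial_g,\omega)$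 is holomorphic along the vertical direction, and $\omega$ is auto-finite and $\theta$-adapted. Let $\bar\theta_\omega$ be a complex conjugation of $\theta$ with respect to $\omega$, and put $$\bar\partial_\omega=\beta^{-1}\circ(\bar\partial_g+\bar\theta_\omega),\qquad \nabla_\omega=\partial_\omega+2\beta^{-1}\circ\theta,\qquad D_\omega=\nabla_\omega+\bar\partial_\omega:\alpha^*T_{S_{\mathbb C}}\to T_{Z_{\mathbb C}}/\bar T_A,$$ where $\partial_\omega$ is the Chern connection associated to $\bar\partial_\omega$ and $\omega$. **Proposition 5.2.** The operator $\bar\partial_\omega$ is a $\bar\partial$-operator on $(\alpha,T_A)$; denote its almost complex structure by $T_\omega$. The Chern connection $\partial_\omega$ exists and is unique, $\nabla_\omega$ is an almost connection on $(\alpha,T_\omega)$, and $D_\omega$ is a differentiable splitting. Moreover: 1. $D_\omega$ is holomorphic along the vertical direction, i.e. $\bar\partial_\omega$ and $\nabla_\omega$ are. 2. $D_\omega$ carries a curvature tensor $F_\omega$: there is exactly one differentiable global section $F_\omega$ of $\Omega^2_{S_{\mathbb C}}\otimes g_*T_{Y/S}$ such that, for all local smooth complex vector fields $a,b$ on $S$,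 $\beta^{-1}F_\omega(a,b)$ is the class of $[\tilde D(a),\tilde D(b)]-\tilde D([a,b])$ modulo $\bar T_A$, where $\tilde D(\cdot)$ are arbitrary smooth local lifts of $D_\omega(\cdot)$ to $T_{Z_{\mathbb C}}$. It decomposes as $F_\omega=F^{0,2}+F^{1,1}+F^{2,0}$ into differentiable sections of $\Omega^2_{S_{\mathbb C}}\otimes g_*T_{Y/S}$ of the indicated types on $S$. 3. $F_\omega=0$ if and only if $(\bar\partial_\omega,\nabla_\omega)$ defines a holomorphic flat bundle with underlying complex fiber bundle $(\alpha,T_A)$. -/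

import Mathlib

open scoped Manifold ContDiff
open Set

set_option linter.unusedSectionVars false

namespace NonlinearHodge

noncomputable section

/-! ## Complexification of a real vector space -/

/-- The complexification `V ⊗ ℂ` of a real vector space, as pairs `x + i y`. -/
def Cx (V : Type*) : Type _ := V × V

namespace Cx

variable {V W : Type*} [AddCommGroup V] [Module ℝ V] [AddCommGroup W] [Module ℝ W]

/-- real part -/
def re (v : Cx V) : V := v.1

/-- imaginary part -/
def im (v : Cx V) : V := v.2

/-- the vector `x + i y` -/
def mk (x y : V) : Cx V := (x, y)

@[ext] theorem ext {u v : Cx V} (h₁ : u.re = v.re) (h₂ : u.im = v.im) : u = v :=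
  Prod.ext h₁ h₂

instance : AddCommGroup (Cx V) := inferInstanceAs (AddCommGroup (V × V))

instance : SMul ℂ (Cx V) := ⟨fun c v => mk (c.re • v.re - c.im • v.im) (c.re • v.im + c.im • v.re)⟩

@[simp] theorem re_mk (x y : V) : (mk x y).re = x := rfl
@[simp] theorem im_mk (x y : V) : (mk x y).im = y := rfl
@[simp] theorem re_add (u v : Cx V) : (u + v).re = u.re + v.re := rfl
@[simp] theorem im_add (u v : Cx V) : (u + v).im = u.im + v.im := rfl
@[simp] theorem re_sub (u v : Cx V) : (u - v).re = u.re - v.re := rfl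
@[simp] theorem im_sub (u v : Cx V) : (u - v).im = u.im - v.im := rfl
@[simp] theorem re_neg (u : Cx V) : (-u).re = -u.re := rfl
@[simp] theorem im_neg (u : Cx V) : (-u).im = -u.im := rfl
@[simp] theorem re_zero : (0 : Cx V).re = 0 := rfl
@[simp] theorem im_zero : (0 : Cx V).im = 0 := rfl
@[simp] theorem re_smul (c : ℂ) (v : Cx V) : (c • v).re = c.re • v.re - c.im • v.im := rfl
@[simp] theorem im_smul (c : ℂ) (v : Cx V) : (c • v).im = c.re • v.im + c.im • v.re := rfl

instance : Module ℂ (Cx V) where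
  one_smul v := by ext <;> simp
  mul_smul c d v := by
    ext <;> simp [smul_sub, smul_add, sub_smul, add_smul, mul_smul] <;> abel
  smul_zero c := by ext <;> simp
  smul_add c u v := by ext <;> simp <;> abel
  add_smul c d v := by ext <;> simp [add_smul] <;> abel
  zero_smul v := by ext <;> simp

/-- The complex linear extension of a real linear map. -/
def map (f : V →ₗ[ℝ] W) : Cx V →ₗ[ℂ] Cx W where
  toFun v := mk (f v.re) (f v.im)
  map_add' u v := by ext <;> simp
  map_smul' c v := by ext <;> simp

@[simp] theorem re_map (f : V →ₗ[ℝ] W) (v : Cx V) : (map f v).re = f v.re := rfl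
@[simp] theorem im_map (f : V →ₗ[ℝ] W) (v : Cx V) : (map f v).im = f v.im := rfl

/-- Complex conjugation. -/
def conj : Cx V →ₛₗ[starRingEnd ℂ] Cx V where
  toFun v := mk v.re (-v.im)
  map_add' u v := by ext <;> simp <;> abel
  map_smul' c v := by ext <;> simp <;> abel

@[simp] theorem re_conj (v : Cx V) : (conj v).re = v.re := rfl
@[simp] theorem im_conj (v : Cx V) : (conj v).im = -v.im := rfl

@[simp] theorem conj_conj (v : Cx V) : conj (conj v) = v := by ext <;> simp

theorem conj_map (f : V →ₗ[ℝ] W) (v : Cx V) : conj (map f v) = map f (conj v) := by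
  ext <;> simp

/-- The complex conjugate `P̄` of a complex subspace `P`. -/
def conjSub (P : Submodule ℂ (Cx V)) : Submodule ℂ (Cx V) := P.comap conj

theorem mem_conjSub {P : Submodule ℂ (Cx V)} {v : Cx V} : v ∈ conjSub P ↔ conj v ∈ P := Iff.rfl

/-- The complex bilinear extension of a real bilinear form. -/
def bilin (Ω : V →ₗ[ℝ] V →ₗ[ℝ] ℝ) (u v : Cx V) : ℂ :=
  ⟨Ω u.re v.re - Ω u.im v.im, Ω u.re v.im + Ω u.im v.re⟩

end Cx

open Cx

/-! ## Complexified tangent bundles and complex vector fields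

Local vector fields on an open set `U` are functions on the whole manifold of which only the
values on `U` matter. -/

section Manifold

variable (E : Type*) [NormedAddCommGroup E] [NormedSpace ℝ E]
  {M : Type*} [TopologicalSpace M] [ChartedSpace E M]

/-- The complexified (real) tangent space at `x`. -/
abbrev CT (x : M) : Type _ := Cx (TangentSpace 𝓘(ℝ, E) x)

variable {E}

/-- The Lie bracket of complex vector fields. -/
def bracket (V W : ∀ x : M, CT E x) (x : M) : CT E x :=
  Cx.mk
    (VectorField.mlieBracket 𝓘(ℝ, E) (fun y => (V y).re) (fun y => (W y).re) x
      - VectorField.mlieBracket 𝓘(ℝ, E) (fun y => (V y).im) (fun y => (W y).im) x)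
    (VectorField.mlieBracket 𝓘(ℝ, E) (fun y => (V y).re) (fun y => (W y).im) x
      + VectorField.mlieBracket 𝓘(ℝ, E) (fun y => (V y).im) (fun y => (W y).re) x)

/-- The derivative of a real function along a real vector field. -/
def dirDeriv (X : ∀ x : M, TangentSpace 𝓘(ℝ, E) x) (f : M → ℝ) (x : M) : ℝ :=
  mfderiv 𝓘(ℝ, E) 𝓘(ℝ, ℝ) f x (X x)

section Smooth

variable [IsManifold 𝓘(ℝ, E) ∞ M]

/-- A real vector field is smooth on `U`. -/
def RealSmoothOn (X : ∀ x : M, TangentSpace 𝓘(ℝ, E) x) (U : Set M) : Prop :=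
  ContMDiffOn 𝓘(ℝ, E) 𝓘(ℝ, E).tangent ∞
    (fun x => (⟨x, X x⟩ : TangentBundle 𝓘(ℝ, E) M)) U

/-- A complex vector field is smooth on `U`. -/
def SmoothOn (V : ∀ x : M, CT E x) (U : Set M) : Prop :=
  RealSmoothOn (fun x => (V x).re) U ∧ RealSmoothOn (fun x => (V x).im) U

/-- The subspaces `P x` form a smooth complex subbundle of the complexified tangent bundle. -/
def IsSmoothSubbundle (P : ∀ x : M, Submodule ℂ (CT E x)) : Prop :=
  ∀ x₀ : M, ∃ U : Set M, IsOpen U ∧ x₀ ∈ U ∧ ∃ (n : ℕ) (e : Fin n → ∀ x : M, CT E x),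
    (∀ i, SmoothOn (e i) U) ∧
    ∀ x ∈ U, LinearIndependent ℂ (fun i => e i x) ∧
      Submodule.span ℂ (range fun i => e i x) = P x

/-- `[P, P] ⊆ P`: local smooth sections of `P` are closed under the Lie bracket. -/
def IsInvolutive (P : ∀ x : M, Submodule ℂ (CT E x)) : Prop :=
  ∀ (U : Set M) (V W : ∀ x : M, CT E x), IsOpen U → SmoothOn V U → SmoothOn W U →
    (∀ x ∈ U, V x ∈ P x) → (∀ x ∈ U, W x ∈ P x) → ∀ x ∈ U, bracket V W x ∈ P x

/-- `[P, V] ⊆ P` on `U`, for local smooth sections of `P`. -/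
def BracketPreserves (P : ∀ x : M, Submodule ℂ (CT E x)) (V : ∀ x : M, CT E x)
    (U : Set M) : Prop :=
  ∀ (U' : Set M) (u : ∀ x : M, CT E x), IsOpen U' → U' ⊆ U → SmoothOn u U' →
    (∀ x ∈ U', u x ∈ P x) → ∀ x ∈ U', bracket u V x ∈ P x

variable (E M) in
/-- A (smooth, real) differential two-form. -/
structure TwoForm where
  toFun : ∀ x : M, TangentSpace 𝓘(ℝ, E) x →ₗ[ℝ] TangentSpace 𝓘(ℝ, E) x →ₗ[ℝ] ℝ
  alternating : ∀ x v, toFun x v v = 0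
  smooth : ∀ (U : Set M) (X Y : ∀ x : M, TangentSpace 𝓘(ℝ, E) x), IsOpen U →
    RealSmoothOn X U → RealSmoothOn Y U →
    ContMDiffOn 𝓘(ℝ, E) 𝓘(ℝ, ℝ) ∞ (fun x => toFun x (X x) (Y x)) U

/-- `dΩ = 0`, through the invariant formula for the exterior derivative. -/
def TwoForm.IsClosed (Ω : TwoForm E M) : Prop :=
  ∀ (U : Set M) (X Y W : ∀ x : M, TangentSpace 𝓘(ℝ, E) x), IsOpen U →
    RealSmoothOn X U → RealSmoothOn Y U → RealSmoothOn W U → ∀ x ∈ U,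
    dirDeriv X (fun y => Ω.toFun y (Y y) (W y)) x
      + dirDeriv Y (fun y => Ω.toFun y (W y) (X y)) x
      + dirDeriv W (fun y => Ω.toFun y (X y) (Y y)) x
      - Ω.toFun x (VectorField.mlieBracket 𝓘(ℝ, E) X Y x) (W x)
      - Ω.toFun x (VectorField.mlieBracket 𝓘(ℝ, E) Y W x) (X x)
      - Ω.toFun x (VectorField.mlieBracket 𝓘(ℝ, E) W X x) (Y x) = 0

end Smooth

end Manifold

/-! ## The complex base manifold -/

section Base

variable {E : Type*} [NormedAddCommGroup E] [NormedSpace ℂ E]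
  {S : Type*} [TopologicalSpace S] [ChartedSpace E S]

/-- A complex manifold is, in the same charts, a real manifold. -/
instance complexToReal_isManifold [h : IsManifold 𝓘(ℂ, E) ω S] : IsManifold 𝓘(ℝ, E) ω S := by
  apply isManifold_of_contDiffOn
  intro e e' he he'
  have h1 := (contDiffGroupoid ω 𝓘(ℂ, E)).compatible he he'
  have h2 : ContDiffOn ℂ ω (𝓘(ℂ, E) ∘ (e.symm ≫ₕ e') ∘ 𝓘(ℂ, E).symm)
      (𝓘(ℂ, E).symm ⁻¹' (e.symm ≫ₕ e').source ∩ range 𝓘(ℂ, E)) :=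
    h1.1
  exact h2.restrict_scalars ℝ

/-- The almost complex structure of the complex manifold `S` on its real tangent spaces. -/
def tangentJ (s : S) : TangentSpace 𝓘(ℝ, E) s →ₗ[ℝ] TangentSpace 𝓘(ℝ, E) s :=
  (show E →ₗ[ℝ] E from (Complex.I • (LinearMap.id : E →ₗ[ℝ] E)))

variable (E) in
/-- `T_S`, the vectors of type `(1,0)`: the `i`-eigenspace of the almost complex structure. -/
def T10 (s : S) : Submodule ℂ (CT E s) :=
  LinearMap.ker (Cx.map (tangentJ (E := E) s) - Complex.I • LinearMap.id)

variable (E) in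
/-- `T̄_S`, the vectors of type `(0,1)`. -/
def T01 (s : S) : Submodule ℂ (CT E s) := conjSub (T10 E s)

/-- Complex conjugation `T_S → T̄_S`. -/
def conj10 {s : S} (ξ : T10 E s) : T01 E s := ⟨Cx.conj ξ.1, by
  rw [T01, mem_conjSub, Cx.conj_conj]; exact ξ.2⟩

/-- A local section of `T_S` is holomorphic on `W`. A `(1,0)`-vector is identified with a vector of
the tangent bundle of the complex manifold `S` through its real part. -/
def HolomorphicOn [IsManifold 𝓘(ℂ, E) ω S] (a : ∀ s : S, T10 E s) (W : Set S) : Prop :=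
  ContMDiffOn 𝓘(ℂ, E) 𝓘(ℂ, E).tangent ω
    (fun s => (⟨s, (show E from (a s).1.re)⟩ : TangentBundle 𝓘(ℂ, E) S)) W

theorem tangentJ_tangentJ (s : S) (v : TangentSpace 𝓘(ℝ, E) s) :
    tangentJ s (tangentJ s v) = -v := by
  change Complex.I • (Complex.I • (show E from v)) = -(show E from v)
  rw [smul_smul, Complex.I_mul_I, neg_one_smul]

theorem mem_T10 {s : S} {v : CT E s} :
    v ∈ T10 E s ↔ tangentJ s v.re = -v.im ∧ tangentJ s v.im = v.re := by
  rw [T10, LinearMap.mem_ker, LinearMap.sub_apply, sub_eq_zero, Cx.ext_iff]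
  simp

/-- The projection `ξ ↦ (ξ - i J ξ) / 2` of the complexified tangent space to `T_S`. -/
def proj10 (s : S) : CT E s →ₗ[ℂ] T10 E s :=
  LinearMap.codRestrict (T10 E s)
    ((1 / 2 : ℂ) • (LinearMap.id - Complex.I • Cx.map (tangentJ (E := E) s))) (fun v => by
      rw [mem_T10]
      constructor <;> simp [tangentJ_tangentJ] <;> module)

/-- The projection `ξ ↦ (ξ + i J ξ) / 2` of the complexified tangent space to `T̄_S`. -/
def proj01 (s : S) : CT E s →ₗ[ℂ] T01 E s :=
  LinearMap.codRestrict (T01 E s)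
    ((1 / 2 : ℂ) • (LinearMap.id + Complex.I • Cx.map (tangentJ (E := E) s))) (fun v => by
      rw [T01, mem_conjSub, mem_T10]
      constructor <;> simp [tangentJ_tangentJ] <;> module)

theorem proj10_add_proj01 (s : S) (v : CT E s) :
    (proj10 s v : CT E s) + (proj01 s v : CT E s) = v := by
  simp only [proj10, proj01, LinearMap.codRestrict_apply]
  ext <;> simp <;> module

end Base

/-! ## Complex fiber bundles -/

section Bundle

variable {E EZ EF : Type*} [NormedAddCommGroup E] [NormedSpace ℂ E]
  [NormedAddCommGroup EZ] [NormedSpace ℝ EZ] [NormedAddCommGroup EF] [NormedSpace ℝ EF]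
  {S Z : Type*} [TopologicalSpace S] [ChartedSpace E S]
  [TopologicalSpace Z] [ChartedSpace EZ Z]

variable (E EZ EF) in
/-- `α : Z → S` is a differentiable fiber bundle with typical fiber `F`. -/
def IsSmoothFiberBundle (F : Type*) [TopologicalSpace F] [ChartedSpace EF F] (α : Z → S) : Prop :=
  ContMDiff 𝓘(ℝ, EZ) 𝓘(ℝ, E) ∞ α ∧
  ∀ s : S, ∃ e : Bundle.Trivialization F α, s ∈ e.baseSet ∧
    ContMDiffOn 𝓘(ℝ, EZ) (𝓘(ℝ, E).prod 𝓘(ℝ, EF)) ∞ e e.source ∧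
    ContMDiffOn (𝓘(ℝ, E).prod 𝓘(ℝ, EF)) 𝓘(ℝ, EZ) ∞ e.toOpenPartialHomeomorph.symm e.target

variable (E EZ) in
/-- The complexified differential of `α`. -/
def dC (α : Z → S) (z : Z) : CT EZ z →ₗ[ℂ] CT E (α z) :=
  Cx.map (mfderiv 𝓘(ℝ, EZ) 𝓘(ℝ, E) α z).toLinearMap

variable [IsManifold 𝓘(ℂ, E) ω S] [IsManifold 𝓘(ℝ, EZ) ∞ Z]

variable (E EZ) in
/-- An integrable complex structure `T` on the relative tangent bundle of `α`. -/
structure RelComplexStructure (α : Z → S) where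
  T : ∀ z : Z, Submodule ℂ (CT EZ z)
  smooth : IsSmoothSubbundle T
  disjoint : ∀ z, T z ⊓ conjSub (T z) = ⊥
  sup_eq : ∀ z, T z ⊔ conjSub (T z) = LinearMap.ker (dC E EZ α z)
  involutive : IsInvolutive T

variable {α : Z → S}

/-- The conjugate bundle `T̄_rel`. -/
def RelComplexStructure.bar (R : RelComplexStructure E EZ α) (z : Z) : Submodule ℂ (CT EZ z) :=
  conjSub (R.T z)

/-- The projection `T_Z / T̄_rel → α^* T_S` (everything complexified). -/
def RelComplexStructure.proj (R : RelComplexStructure E EZ α) (z : Z) :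
    (CT EZ z ⧸ R.bar z) →ₗ[ℂ] CT E (α z) :=
  (R.bar z).liftQ (dC E EZ α z) (by rw [← R.sup_eq z]; exact le_sup_right)

/-! Fix a subbundle `P` of the complexified tangent bundle of `S` (below it is `T_S`, `T̄_S` or
everything). -/

variable (EZ α) in
/-- A family of linear maps `α^* P → T_Z` (complexified). -/
abbrev LiftMap (P : ∀ s : S, Submodule ℂ (CT E s)) : Type _ :=
  ∀ z : Z, P (α z) →ₗ[ℂ] CT EZ z

/-- A family of linear maps `α^* P → T_Z / T̄_rel` (complexified). -/
abbrev BaseMap (R : RelComplexStructure E EZ α) (P : ∀ s : S, Submodule ℂ (CT E s)) : Type _ :=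
  ∀ z : Z, P (α z) →ₗ[ℂ] (CT EZ z ⧸ R.bar z)

variable {P : ∀ s : S, Submodule ℂ (CT E s)}

/-- The bundle morphism `l : α^* P → T_Z` is smooth on `U`: it maps the pullbacks of smooth
local sections of `P` to smooth vector fields. -/
def LiftMap.SmoothOn (l : LiftMap EZ α P) (U : Set Z) : Prop :=
  ∀ (W : Set S) (a : ∀ s : S, P s), IsOpen W → NonlinearHodge.SmoothOn (fun s => (a s).1) W →
    NonlinearHodge.SmoothOn (fun z => l z (a (α z))) (U ∩ α ⁻¹' W)

/-- The local lifting condition `[T̄_rel, im l] ⊆ T̄_rel` on `U`, where `im l` is spanned by the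
images of the pullbacks of local sections of `P` on the base. -/
def LiftMap.VerticallyHolomorphicOn (R : RelComplexStructure E EZ α) (l : LiftMap EZ α P)
    (U : Set Z) : Prop :=
  ∀ (W : Set S) (a : ∀ s : S, P s), IsOpen W → NonlinearHodge.SmoothOn (fun s => (a s).1) W →
    BracketPreserves R.bar (fun z => l z (a (α z))) (U ∩ α ⁻¹' W)

/-- `l` is a smooth lift on `U` of `D : α^* P → T_Z / T̄_rel`. -/
def IsLiftOn (R : RelComplexStructure E EZ α) (D : BaseMap R P) (l : LiftMap EZ α P)
    (U : Set Z) : Prop :=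
  l.SmoothOn U ∧ ∀ z ∈ U, ∀ ξ, (R.bar z).mkQ (l z ξ) = D z ξ

/-- `D : α^* P → T_Z / T̄_rel` is a differentiable bundle morphism which splits the projection
`T_Z / T̄_rel → α^* T_S` over `P`. For `P = T̄_S` these are the `∂̄`-operators on `(α, T_rel)`,
for `P = T_S` the almost connections. -/
structure IsSplitting (R : RelComplexStructure E EZ α) (D : BaseMap R P) : Prop where
  splits : ∀ z ξ, R.proj z (D z ξ) = ξ.1
  smooth : ∀ z₀ : Z, ∃ U : Set Z, IsOpen U ∧ z₀ ∈ U ∧ ∃ l : LiftMap EZ α P, IsLiftOn R D l U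

/-- `D` is holomorphic along the vertical direction: locally it has lifts that satisfy the local
lifting condition. -/
def IsVerticallyHolomorphic (R : RelComplexStructure E EZ α) (D : BaseMap R P) : Prop :=
  ∀ z₀ : Z, ∃ U : Set Z, IsOpen U ∧ z₀ ∈ U ∧
    ∃ l : LiftMap EZ α P, IsLiftOn R D l U ∧ l.VerticallyHolomorphicOn R U

/-- The bundle `T̄` of a `∂̄`-operator: the inverse image in `T_Z` of the image of the operator. -/
def barT (R : RelComplexStructure E EZ α) (dbar : BaseMap R (T01 E)) (z : Z) :
    Submodule ℂ (CT EZ z) :=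
  (LinearMap.range (dbar z)).comap (R.bar z).mkQ

/-- The almost complex structure `T` of a `∂̄`-operator. -/
def acsT (R : RelComplexStructure E EZ α) (dbar : BaseMap R (T01 E)) (z : Z) :
    Submodule ℂ (CT EZ z) :=
  conjSub (barT R dbar z)

/-- A holomorphic fibration with underlying complex fiber bundle `(α, T_rel)`, given by an
integrable `∂̄`-operator. -/
structure IsHolomorphicFibration (R : RelComplexStructure E EZ α) (dbar : BaseMap R (T01 E)) :
    Prop where
  isSplitting : IsSplitting R dbar
  integrable : IsInvolutive (barT R dbar)

/-- An almost connection on `(α, T)`, where `T` is the almost complex structure of `dbar`. -/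
structure IsAlmostConnection (R : RelComplexStructure E EZ α) (dbar : BaseMap R (T01 E))
    (c : BaseMap R (T10 E)) : Prop where
  isSplitting : IsSplitting R c
  mem : ∀ z ξ, ∃ v ∈ acsT R dbar z, (R.bar z).mkQ v = c z ξ

/-- A holomorphic flat bundle `(f, ∇)` with underlying complex fiber bundle `(α, T_rel)`: an
integrable `∂̄`-operator, and a connection `∇ : f^* T_S → T` whose values on holomorphic vector
fields of the base are holomorphic vector fields of the total space, and whose image in `T` is
closed under the Lie bracket. (A section `V` of an integrable `T` is holomorphic iff
`[T̄, V] ⊆ T̄`.) -/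
structure IsHolomorphicFlatBundle (R : RelComplexStructure E EZ α) (dbar : BaseMap R (T01 E))
    (c : BaseMap R (T10 E)) : Prop where
  fibration : IsHolomorphicFibration R dbar
  connection : IsAlmostConnection R dbar c
  holomorphic : ∀ (W : Set S) (a : ∀ s : S, T10 E s), IsOpen W → HolomorphicOn a W →
    ∀ (U : Set Z) (V : ∀ z : Z, CT EZ z), IsOpen U → U ⊆ α ⁻¹' W → SmoothOn V U →
      (∀ z ∈ U, V z ∈ acsT R dbar z ∧ (R.bar z).mkQ (V z) = c z (a (α z))) →
      BracketPreserves (barT R dbar) V U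
  flat : IsInvolutive (fun z => acsT R dbar z ⊓ (LinearMap.range (c z)).comap (R.bar z).mkQ)

/-- A holomorphic Higgs field on a holomorphic fibration, as a bundle morphism
`θ : g^* T_S → T_{Y/S}`: holomorphic vector fields of the base go to holomorphic vertical vector
fields, which commute with each other. -/
structure IsHolomorphicHiggsField (R : RelComplexStructure E EZ α) (dbar : BaseMap R (T01 E))
    (θ : LiftMap EZ α (T10 E)) : Prop where
  mem : ∀ z ξ, θ z ξ ∈ R.T z
  smooth : θ.SmoothOn univ
  holomorphic : ∀ (W : Set S) (a : ∀ s : S, T10 E s), IsOpen W → HolomorphicOn a W →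
    BracketPreserves (barT R dbar) (fun z => θ z (a (α z))) (α ⁻¹' W)
  integrable : ∀ (W : Set S) (a b : ∀ s : S, T10 E s), IsOpen W → HolomorphicOn a W →
    HolomorphicOn b W → ∀ z ∈ α ⁻¹' W,
    bracket (fun z => θ z (a (α z))) (fun z => θ z (b (α z))) z = 0

/-! ## Hermitian metrics, Chern connections, complex conjugation of Higgs fields -/

/-- A hermitian metric on `(α, T_rel)`: a closed two-form on `Z` whose restriction to every
fiber is of type `(1,1)` and positive definite. -/
structure IsHermitianMetric (R : RelComplexStructure E EZ α) (Ω : TwoForm EZ Z) : Prop where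
  closed : Ω.IsClosed
  type11 : ∀ z, ∀ u ∈ R.T z, ∀ v ∈ R.T z, bilin (Ω.toFun z) u v = 0
  pos : ∀ z, ∀ u ∈ R.T z, u ≠ 0 → 0 < (-Complex.I * bilin (Ω.toFun z) u (Cx.conj u)).re

/-- The Chern connection of `dbar` and `Ω`: an almost connection on `(α, T)`, `T` the almost
complex structure of `dbar`, whose image is orthogonal to `T_rel` for `(u, v) ↦ Ω(u, v̄)`. (This
does not depend on the representative `u` in `T_Z` of a class modulo `T̄_rel`.) -/
structure IsChernConnection (R : RelComplexStructure E EZ α) (dbar : BaseMap R (T01 E))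
    (Ω : TwoForm EZ Z) (c : BaseMap R (T10 E)) : Prop where
  almostConnection : IsAlmostConnection R dbar c
  orthogonal : ∀ z ξ u, (R.bar z).mkQ u = c z ξ → ∀ v ∈ R.T z,
    bilin (Ω.toFun z) u (Cx.conj v) = 0

variable (EZ α) in
/-- Families of complex tangent vectors of `Z` along the fiber over `s`. -/
abbrev FiberField (s : S) : Type _ := ∀ z : {z : Z // α z = s}, CT EZ z.1

/-- `v` is a holomorphic vector field (a section of `T_rel`) of the fiber over `s`. -/
def IsHolomorphicOnFiber (R : RelComplexStructure E EZ α) (s : S) (v : FiberField EZ α s) : Prop :=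
  ∀ z₀ : {z : Z // α z = s}, ∃ (U : Set Z) (V : ∀ z : Z, CT EZ z), IsOpen U ∧ z₀.1 ∈ U ∧
    SmoothOn V U ∧ (∀ z ∈ U, V z ∈ R.T z) ∧
    (∀ z : {z : Z // α z = s}, z.1 ∈ U → V z.1 = v z) ∧
    ∀ (U' : Set Z) (u : ∀ z : Z, CT EZ z), IsOpen U' → U' ⊆ U → SmoothOn u U' →
      (∀ z ∈ U', u z ∈ R.bar z) → ∀ z ∈ U', α z = s → bracket u V z ∈ R.bar z

/-- The real vector field `v + v̄` of the fiber over `s` annihilates the restriction of `Ω` to this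
fiber (its Lie derivative vanishes). -/
def IsKillingOnFiber (Ω : TwoForm EZ Z) (s : S) (v : FiberField EZ α s) : Prop :=
  ∀ z₀ : {z : Z // α z = s}, ∃ (U : Set Z) (X : ∀ z : Z, TangentSpace 𝓘(ℝ, EZ) z),
    IsOpen U ∧ z₀.1 ∈ U ∧ RealSmoothOn X U ∧
    (∀ z ∈ U, mfderiv 𝓘(ℝ, EZ) 𝓘(ℝ, E) α z (X z) = 0) ∧
    (∀ z : {z : Z // α z = s}, z.1 ∈ U → X z.1 = (v z + Cx.conj (v z)).re) ∧
    ∀ (U' : Set Z) (Y W : ∀ z : Z, TangentSpace 𝓘(ℝ, EZ) z), IsOpen U' → U' ⊆ U →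
      RealSmoothOn Y U' → RealSmoothOn W U' →
      (∀ z ∈ U', mfderiv 𝓘(ℝ, EZ) 𝓘(ℝ, E) α z (Y z) = 0) →
      (∀ z ∈ U', mfderiv 𝓘(ℝ, EZ) 𝓘(ℝ, E) α z (W z) = 0) →
      ∀ z ∈ U', α z = s →
        dirDeriv X (fun y => Ω.toFun y (Y y) (W y)) z
          = Ω.toFun z (VectorField.mlieBracket 𝓘(ℝ, EZ) X Y z) (W z)
            + Ω.toFun z (Y z) (VectorField.mlieBracket 𝓘(ℝ, EZ) X W z)

/-- The real vector field `v + v̄` of the fiber over `s` is complete. -/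
def IsCompleteOnFiber (s : S) (v : FiberField EZ α s) : Prop :=
  ∀ z₀ : {z : Z // α z = s}, ∃ γ : ℝ → {z : Z // α z = s}, γ 0 = z₀ ∧
    ∀ t : ℝ, HasMFDerivAt 𝓘(ℝ, ℝ) 𝓘(ℝ, EZ) (fun t => (γ t).1) t
      ((1 : ℝ →L[ℝ] ℝ).smulRight ((v (γ t) + Cx.conj (v (γ t))).re))

/-- `𝔞𝔲𝔱(X_s, Ω_s)`, the Lie algebra of the group of holomorphic isometries of the fiber over `s`:
the holomorphic vector fields `v` such that `v + v̄` generates a one-parameter group of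
isometries. -/
def autAlg (R : RelComplexStructure E EZ α) (Ω : TwoForm EZ Z) (s : S) :
    Set (FiberField EZ α s) :=
  {v | IsHolomorphicOnFiber R s v ∧ IsKillingOnFiber (E := E) Ω s v ∧ IsCompleteOnFiber s v}

/-- The group of holomorphic isometries of the fiber over `s` is finite dimensional, of a dimension
independent of `s`. -/
def IsAutoFinite (R : RelComplexStructure E EZ α) (Ω : TwoForm EZ Z) : Prop :=
  ∃ d : ℕ, ∀ s : S, Module.Finite ℝ (Submodule.span ℝ (autAlg R Ω s)) ∧
    Module.finrank ℝ (Submodule.span ℝ (autAlg R Ω s)) = d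

/-- `Ω` is `θ`-adapted: on every fiber, `θ` takes values in the complexification of
`𝔞𝔲𝔱(X_s, Ω_s)`. -/
def IsAdapted (R : RelComplexStructure E EZ α) (Ω : TwoForm EZ Z) (θ : LiftMap EZ α (T10 E)) :
    Prop :=
  ∀ (s : S) (ξ : ∀ s : S, T10 E s), ∃ a ∈ autAlg R Ω s, ∃ b ∈ autAlg R Ω s,
    ∀ z : {z : Z // α z = s}, θ z.1 (ξ (α z.1)) = a z + Complex.I • b z

/-- `θ'` is the complex conjugation of `θ` with respect to `Ω`: the differentiable bundle
morphism from `T̄_S` to vertical vector fields which on every fiber sends `ξ̄` to minus the complex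
conjugate of `θ(ξ)` with respect to the real form `𝔞𝔲𝔱(X_s, Ω_s)`. -/
structure IsComplexConjugation (R : RelComplexStructure E EZ α) (Ω : TwoForm EZ Z)
    (θ : LiftMap EZ α (T10 E)) (θ' : LiftMap EZ α (T01 E)) : Prop where
  smooth : θ'.SmoothOn univ
  conj : ∀ (s : S) (ξ : ∀ s : S, T10 E s), ∃ a ∈ autAlg R Ω s, ∃ b ∈ autAlg R Ω s,
    ∀ z : {z : Z // α z = s}, θ z.1 (ξ (α z.1)) = a z + Complex.I • b z ∧
      θ' z.1 (conj10 (ξ (α z.1))) = -(a z - Complex.I • b z)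

/-! ## The automorphism relating two relative complex structures -/

/-- A real bundle automorphism `β` of `T_Z` which maps `T_A` to `T_B` and induces the identity on
`α^* T_S`. -/
structure BundleAut (A B : RelComplexStructure E EZ α) where
  toFun : ∀ z : Z, TangentSpace 𝓘(ℝ, EZ) z ≃ₗ[ℝ] TangentSpace 𝓘(ℝ, EZ) z
  smooth : ∀ (U : Set Z) (X : ∀ z : Z, TangentSpace 𝓘(ℝ, EZ) z), IsOpen U →
    RealSmoothOn X U → RealSmoothOn (fun z => toFun z (X z)) U
  smooth_symm : ∀ (U : Set Z) (X : ∀ z : Z, TangentSpace 𝓘(ℝ, EZ) z), IsOpen U →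
    RealSmoothOn X U → RealSmoothOn (fun z => (toFun z).symm (X z)) U
  base : ∀ z v, mfderiv 𝓘(ℝ, EZ) 𝓘(ℝ, E) α z (toFun z v) = mfderiv 𝓘(ℝ, EZ) 𝓘(ℝ, E) α z v
  map_eq : ∀ z, (A.T z).map (Cx.map (toFun z).toLinearMap) = B.T z

namespace BundleAut

variable {A B : RelComplexStructure E EZ α} (β : BundleAut A B)

/-- `β` on complex tangent vectors -/
def cmap (z : Z) : CT EZ z →ₗ[ℂ] CT EZ z := Cx.map (β.toFun z).toLinearMap

/-- `β⁻¹` on complex tangent vectors -/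
def cinv (z : Z) : CT EZ z →ₗ[ℂ] CT EZ z := Cx.map (β.toFun z).symm.toLinearMap

theorem cinv_cmap (z : Z) (v : CT EZ z) : β.cinv z (β.cmap z v) = v := by
  ext <;> simp [cinv, cmap]

theorem bar_le (z : Z) : B.bar z ≤ (A.bar z).comap (β.cinv z) := by
  intro v hv
  have hv' : Cx.conj v ∈ B.T z := hv
  rw [← β.map_eq z] at hv'
  obtain ⟨u, hu, huv⟩ := hv'
  change Cx.conj (β.cinv z v) ∈ A.T z
  have h : β.cmap z u = Cx.conj v := huv
  rw [cinv, Cx.conj_map, ← h]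
  have h2 := β.cinv_cmap z u
  rw [cinv] at h2
  rwa [h2]

/-- The map `T_Z / T̄_B → T_Z / T̄_A` induced by `β⁻¹`. -/
def quotInv (z : Z) : (CT EZ z ⧸ B.bar z) →ₗ[ℂ] (CT EZ z ⧸ A.bar z) :=
  (B.bar z).mapQ (A.bar z) (β.cinv z) (β.bar_le z)

/-- `β` respects the local lifting condition for smooth local lifts `α^* P → T_Z`: such a lift
satisfies it for `T_A` if and only if its image under `β` satisfies it for `T_B`. -/
def RespectsLifting (P : ∀ s : S, Submodule ℂ (CT E s)) : Prop :=
  ∀ (U : Set Z) (l : LiftMap EZ α P), IsOpen U → l.SmoothOn U →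
    (∀ z ∈ U, ∀ ξ, dC E EZ α z (l z ξ) = ξ.1) →
    (l.VerticallyHolomorphicOn A U ↔
      LiftMap.VerticallyHolomorphicOn B (fun z => (β.cmap z).comp (l z)) U)

/-- `β` preserves the local lifting condition, for lifts of `∂̄`-operators and for lifts of
almost connections. -/
def PreservesLocalLifting : Prop := β.RespectsLifting (T01 E) ∧ β.RespectsLifting (T10 E)

end BundleAut

variable {A B : RelComplexStructure E EZ α}

/-- An allowable hermitian metric on the holomorphic Higgs bundle `(g, θ)`, `g` given by `dbar` on
`(α, T_B)`: it is preserved by `β`, its Chern connection is holomorphic along the vertical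
direction, it is auto-finite and `θ`-adapted. -/
structure IsAllowable (β : BundleAut A B) (dbar : BaseMap B (T01 E)) (θ : LiftMap EZ α (T10 E))
    (Ω : TwoForm EZ Z) : Prop where
  hermitian : IsHermitianMetric B Ω
  preserved : ∀ z u v, Ω.toFun z (β.toFun z u) (β.toFun z v) = Ω.toFun z u v
  chern : ∃ c, IsChernConnection B dbar Ω c ∧ IsVerticallyHolomorphic B c
  autoFinite : IsAutoFinite B Ω
  adapted : IsAdapted B Ω θ

/-! ## From Higgs fields to almost connections -/

/-- `∂̄_Ω = β⁻¹ ∘ (∂̄_g + θ̄_Ω)`. -/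
def simpsonDbar (β : BundleAut A B) (dbar : BaseMap B (T01 E)) (θ' : LiftMap EZ α (T01 E)) :
    BaseMap A (T01 E) :=
  fun z => (β.quotInv z).comp (dbar z + (B.bar z).mkQ.comp (θ' z))

/-- `∇_Ω = ∂_Ω + 2 β⁻¹ ∘ θ`, where `c = ∂_Ω` is a Chern connection. -/
def simpsonNabla (β : BundleAut A B) (c : BaseMap A (T10 E)) (θ : LiftMap EZ α (T10 E)) :
    BaseMap A (T10 E) :=
  fun z => c z + (2 : ℂ) • (A.bar z).mkQ.comp ((β.cinv z).comp (θ z))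

/-- `D = ∇ + ∂̄` on the whole complexified tangent bundle of the base. -/
def totalOp (R : RelComplexStructure E EZ α) (c : BaseMap R (T10 E)) (dbar : BaseMap R (T01 E)) :
    BaseMap R (fun s : S => (⊤ : Submodule ℂ (CT E s))) :=
  fun z => ((c z).comp (proj10 (α z)) + (dbar z).comp (proj01 (α z))).comp
    (Submodule.subtype ⊤)

/-! ## Curvature -/

variable (E EZ α) in
/-- Families of bilinear forms on the complexified tangent spaces of the base, with values in the
complexified tangent spaces of `Z`. -/
abbrev BaseTwoForm : Type _ := ∀ z : Z, CT E (α z) →ₗ[ℂ] CT E (α z) →ₗ[ℂ] CT EZ z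

/-- `G` is a differentiable section over `S` of `Ω²_{S_ℂ} ⊗ g_* T_{Y/S}`: an alternating form on
the base whose values on local vector fields of the base are smooth sections of `T_rel`,
holomorphic along the fibers. -/
structure IsVerticalTwoForm (R : RelComplexStructure E EZ α) (G : BaseTwoForm E EZ α) : Prop where
  alternating : ∀ z ξ, G z ξ ξ = 0
  mem : ∀ z ξ η, G z ξ η ∈ R.T z
  smooth : ∀ (W : Set S) (a b : ∀ s : S, CT E s), IsOpen W → SmoothOn a W → SmoothOn b W →
    SmoothOn (fun z => G z (a (α z)) (b (α z))) (α ⁻¹' W)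
  holomorphic : ∀ (W : Set S) (a b : ∀ s : S, CT E s), IsOpen W → SmoothOn a W → SmoothOn b W →
    BracketPreserves R.bar (fun z => G z (a (α z)) (b (α z))) (α ⁻¹' W)

/-- `G` is the curvature tensor of `D : α^* T_S → T_Z / T̄_A` (complexified), carried to `T_B` by
`β`: for local vector fields `a`, `b` of the base and local lifts `X`, `Y`, `K` to `T_Z` of `D a`,
`D b`, `D [a, b]`, the class of `β⁻¹ (G (a, b))` modulo `T̄_A` is that of `[X, Y] - K`. -/
structure IsCurvatureTensor (β : BundleAut A B)
    (D : BaseMap A (fun s : S => (⊤ : Submodule ℂ (CT E s)))) (G : BaseTwoForm E EZ α) : Prop where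
  isVerticalTwoForm : IsVerticalTwoForm B G
  curvature : ∀ (W : Set S) (a b : ∀ s : S, CT E s) (U : Set Z) (X Y K : ∀ z : Z, CT EZ z),
    IsOpen W → SmoothOn a W → SmoothOn b W → IsOpen U → U ⊆ α ⁻¹' W →
    SmoothOn X U → SmoothOn Y U → SmoothOn K U →
    (∀ z ∈ U, (A.bar z).mkQ (X z) = D z ⟨a (α z), trivial⟩) →
    (∀ z ∈ U, (A.bar z).mkQ (Y z) = D z ⟨b (α z), trivial⟩) →
    (∀ z ∈ U, (A.bar z).mkQ (K z) = D z ⟨bracket a b (α z), trivial⟩) →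
    ∀ z ∈ U, (A.bar z).mkQ (β.cinv z (G z (a (α z)) (b (α z))))
      = (A.bar z).mkQ (bracket X Y z - K z)

/-- `G` has only a component of type `(2,0)` on the base. -/
def HasType20 (G : BaseTwoForm E EZ α) : Prop :=
  ∀ z, ∀ ξ ∈ T01 E (α z), ∀ η, G z ξ η = 0 ∧ G z η ξ = 0

/-- `G` has only a component of type `(1,1)` on the base. -/
def HasType11 (G : BaseTwoForm E EZ α) : Prop :=
  ∀ z, (∀ ξ ∈ T10 E (α z), ∀ η ∈ T10 E (α z), G z ξ η = 0) ∧
    (∀ ξ ∈ T01 E (α z), ∀ η ∈ T01 E (α z), G z ξ η = 0)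

/-- `G` has only a component of type `(0,2)` on the base. -/
def HasType02 (G : BaseTwoForm E EZ α) : Prop :=
  ∀ z, ∀ ξ ∈ T10 E (α z), ∀ η, G z ξ η = 0 ∧ G z η ξ = 0

end Bundle

end

end NonlinearHodge

open NonlinearHodge

set_option linter.unusedSectionVars false

/-! Everything rests on the vector fields `V` with `[T̄_rel, V] ⊆ T̄_rel`, here called fields that
preserve `T̄_rel`. A lift of the integrable operator `∂̄_g` takes base fields to such fields: the
bracket lies in `T̄` by integrability and is vertical, and the vertical vectors of `T̄` are those of
`T̄_rel`. The fields `θ(a)` and `θ̄_ω(a)` preserve `T̄_B` as well. On every fibre they are complex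
combinations of two holomorphic vector fields, and the bracket with a vertical vector at a point
sees a field only along the fibre (`bracket_eq_zero_of_fiber`, `preservesAt_of_fiber`).

The class of the Chern connection does not notice `θ̄_ω`: adding it changes `T` only by vectors
whose conjugates occur in `θ̄_ω`, and these vectors lie in `T̄_B`. As `β` is an isometry for `ω`,
the Chern connection of `∂̄_ω` is `β⁻¹` of that of `∂̄_g` (`isChernConnection_quotInv`); uniqueness
is positivity of `ω`. The lifts of `∂̄_g + θ̄_ω` and of `∂_g + 2θ` therefore satisfy the lifting
condition for `T_B`, and `β⁻¹` carries them to lifts that satisfy it for `T_A`. This is the first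
assertion.

For a lift `l` of `D_ω`, the expression `[l(a), l(b)] - l([a, b])` is linear over functions on the
base and vertical. Another choice of lifts changes it by brackets with sections of `T̄_A`, which
stay in `T̄_A`. Its `T_A`-component is thus a well-defined tensor (`exists_curvature_at`), and the
Jacobi identity shows that it preserves `T̄_A`. To move this property to `T_B`, the vertical field
is written as a difference of two lifts, since the hypothesis on `β` is about lifts only
(`BundleAut.RespectsLifting.preservesAt`).

For flatness one tests on holomorphic coordinate fields and their conjugates, all of which commute;
zero curvature then says that their lifts commute modulo `T̄_A`. The `(0,2)`, `(1,1)` and `(2,0)`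
parts correspond to integrability of `T̄`, to holomorphy of `∇`, and to closedness of the image of
`∇` in `T` (`isHolomorphicFlatBundle_of_curvature`, `IsHolomorphicFlatBundle.curvature_eq_zero`).

The calculus underneath works with germs of complex fields, local frames and dual coframes, so that
each bracket condition is checked on a frame by the Leibniz rule. -/

namespace NonlinearHodge

noncomputable section

open scoped Topology

open Filter VectorField Cx

/-! ## Germs of smooth real vector fields -/

section RealFields

variable {E : Type*} [NormedAddCommGroup E] [NormedSpace ℝ E] [FiniteDimensional ℝ E]
  {M : Type*} [TopologicalSpace M] [ChartedSpace E M]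

variable {X Y W : ∀ x : M, TangentSpace 𝓘(ℝ, E) x} {x : M} {f : M → ℝ}

section

variable [IsManifold 𝓘(ℝ, E) ∞ M]

/-- A real vector field is smooth at `x`. -/
def RealSmoothAt (X : ∀ x : M, TangentSpace 𝓘(ℝ, E) x) (x : M) : Prop :=
  ContMDiffAt 𝓘(ℝ, E) 𝓘(ℝ, E).tangent ∞ (fun x => (⟨x, X x⟩ : TangentBundle 𝓘(ℝ, E) M)) x

theorem RealSmoothOn.realSmoothAt {U : Set M} (hX : RealSmoothOn X U) (hU : IsOpen U)
    (hx : x ∈ U) : RealSmoothAt X x :=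
  (hX x hx).contMDiffAt (hU.mem_nhds hx)

theorem realSmoothOn_of_realSmoothAt {U : Set M} (h : ∀ x ∈ U, RealSmoothAt X x) :
    RealSmoothOn X U :=
  fun x hx => (h x hx).contMDiffWithinAt

namespace RealSmoothAt

theorem congr (hX : RealSmoothAt X x) (h : ∀ᶠ y in 𝓝 x, Y y = X y) : RealSmoothAt Y x :=
  ContMDiffAt.congr_of_eventuallyEq hX (h.mono fun y hy => by simp only [hy])

theorem mdifferentiableAt (hX : RealSmoothAt X x) :
    MDifferentiableAt 𝓘(ℝ, E) 𝓘(ℝ, E).tangent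
      (fun x => (⟨x, X x⟩ : TangentBundle 𝓘(ℝ, E) M)) x :=
  ContMDiffAt.mdifferentiableAt hX (by simp)

theorem add (hX : RealSmoothAt X x) (hY : RealSmoothAt Y x) : RealSmoothAt (X + Y) x :=
  ContMDiffAt.add_section hX hY

theorem neg (hX : RealSmoothAt X x) : RealSmoothAt (-X) x :=
  ContMDiffAt.neg_section hX

theorem sub (hX : RealSmoothAt X x) (hY : RealSmoothAt Y x) : RealSmoothAt (X - Y) x :=
  ContMDiffAt.sub_section hX hY

theorem smul (hf : ContMDiffAt 𝓘(ℝ, E) 𝓘(ℝ, ℝ) ∞ f x) (hX : RealSmoothAt X x) :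
    RealSmoothAt (f • X) x :=
  ContMDiffAt.smul_section hf hX

theorem zero : RealSmoothAt (0 : ∀ x : M, TangentSpace 𝓘(ℝ, E) x) x :=
  Bundle.contMDiff_zeroSection ℝ (TangentSpace 𝓘(ℝ, E) : M → Type _) x

theorem mlieBracket (hX : RealSmoothAt X x) (hY : RealSmoothAt Y x) :
    RealSmoothAt (mlieBracket 𝓘(ℝ, E) X Y) x := by
  have : IsManifold 𝓘(ℝ, E) (((⊤ : ℕ∞) : WithTop ℕ∞) + 1) M := by
    rw [show ((⊤ : ℕ∞) : WithTop ℕ∞) + 1 = ∞ from rfl]; infer_instance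
  have : IsManifold 𝓘(ℝ, E) (minSmoothness ℝ 2) M := by
    rw [minSmoothness_of_isRCLikeNormedField]; infer_instance
  refine ContMDiffAt.mlieBracket_vectorField (m := ⊤) (n := ⊤) hX hY ?_
  rw [minSmoothness_of_isRCLikeNormedField]
  exact le_rfl

theorem two (hX : RealSmoothAt X x) :
    ContMDiffAt 𝓘(ℝ, E) 𝓘(ℝ, E).tangent (minSmoothness ℝ 2)
      (fun x => (⟨x, X x⟩ : TangentBundle 𝓘(ℝ, E) M)) x :=
  ContMDiffAt.of_le hX (by
    rw [minSmoothness_of_isRCLikeNormedField]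
    exact WithTop.coe_le_coe.2 le_top)

end RealSmoothAt

theorem realJacobi (hX : RealSmoothAt X x) (hY : RealSmoothAt Y x) (hW : RealSmoothAt W x) :
    mlieBracket 𝓘(ℝ, E) X (mlieBracket 𝓘(ℝ, E) Y W) x
      = mlieBracket 𝓘(ℝ, E) (mlieBracket 𝓘(ℝ, E) X Y) W x
        + mlieBracket 𝓘(ℝ, E) Y (mlieBracket 𝓘(ℝ, E) X W) x := by
  have : IsManifold 𝓘(ℝ, E) (minSmoothness ℝ 3) M := by
    rw [minSmoothness_of_isRCLikeNormedField]; infer_instance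
  exact leibniz_identity_mlieBracket_apply hX.two hY.two hW.two

variable {F : Type*} [NormedAddCommGroup F] [NormedSpace ℝ F]

/-- The derivative of a smooth function along a smooth vector field is smooth. -/
theorem RealSmoothAt.contMDiffAt_mvfderiv {f : M → F} (hX : RealSmoothAt X x)
    (hf : ContMDiffAt 𝓘(ℝ, E) 𝓘(ℝ, F) ∞ f x) :
    ContMDiffAt 𝓘(ℝ, E) 𝓘(ℝ, F) ∞ (fun y => mvfderiv 𝓘(ℝ, E) f y (X y)) x := by
  have h1 : ContMDiffAt 𝓘(ℝ, E) 𝓘(ℝ, E →L[ℝ] F) ∞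
      (inTangentCoordinates 𝓘(ℝ, E) 𝓘(ℝ, F) id f (mfderiv 𝓘(ℝ, E) 𝓘(ℝ, F) f) x) x :=
    hf.mfderiv_const le_rfl
  have h2 := ContMDiffAt.clm_apply_of_inCoordinates h1 hX hf
  have h3 := Bundle.contMDiffAt_totalSpace.1 h2
  refine h3.2.congr_of_eventuallyEq (Eventually.of_forall fun y => ?_)
  simp [mvfderiv]
  rfl

variable (E) in
/-- The vector field with constant value `v` in the chart at `x₀`. -/
def chartField (x₀ : M) (v : E) (x : M) : TangentSpace 𝓘(ℝ, E) x :=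
  mpullback 𝓘(ℝ, E) 𝓘(ℝ, E) (extChartAt 𝓘(ℝ, E) x₀) (fun _ => v) x

theorem realSmoothAt_chartField {x₀ : M} (v : E) (hx : x ∈ (chartAt E x₀).source) :
    RealSmoothAt (chartField E x₀ v) x := by
  refine ContMDiffAt.mpullback_vectorField_preimage (n := ∞) ?_ (contMDiffAt_extChartAt' hx)
    (isInvertible_mfderiv_extChartAt (by simpa using hx)) le_rfl
  exact contMDiffAt_vectorSpace_iff_contDiffAt.2 contDiffAt_const

theorem mvfderiv_extChartAt_chartField {x₀ : M} (v : E) (hx : x ∈ (chartAt E x₀).source) :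
    mvfderiv 𝓘(ℝ, E) (extChartAt 𝓘(ℝ, E) x₀) x (chartField E x₀ v x) = v := by
  have := isInvertible_mfderiv_extChartAt (I := 𝓘(ℝ, E)) (x := x₀) (y := x) (by simpa using hx)
  exact this.self_apply_inverse _

theorem chartField_mvfderiv_extChartAt {x₀ : M} (hx : x ∈ (chartAt E x₀).source)
    (v : TangentSpace 𝓘(ℝ, E) x) :
    chartField E x₀ (mvfderiv 𝓘(ℝ, E) (extChartAt 𝓘(ℝ, E) x₀) x v) x = v := by
  have := isInvertible_mfderiv_extChartAt (I := 𝓘(ℝ, E)) (x := x₀) (y := x) (by simpa using hx)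
  exact this.inverse_apply_self _

/-- Brackets commute with pullback along the chart, and constant fields on a vector space commute.
-/
theorem mlieBracket_chartField {x₀ : M} (v w : E) (hx : x ∈ (chartAt E x₀).source) :
    mlieBracket 𝓘(ℝ, E) (chartField E x₀ v) (chartField E x₀ w) x = 0 := by
  have : IsManifold 𝓘(ℝ, E) (minSmoothness ℝ 2) M := by
    rw [minSmoothness_of_isRCLikeNormedField]; infer_instance
  have hc : ∀ v : E, MDifferentiableAt 𝓘(ℝ, E) 𝓘(ℝ, E).tangent
      (fun y : E => (⟨y, v⟩ : TangentBundle 𝓘(ℝ, E) E)) (extChartAt 𝓘(ℝ, E) x₀ x) := fun v =>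
    (contMDiffAt_vectorSpace_iff_contDiffAt (n := 1).2 contDiffAt_const).mdifferentiableAt
      one_ne_zero
  have h := mpullback_mlieBracket (I := 𝓘(ℝ, E)) (x₀ := x) (hc v) (hc w)
    (contMDiffAt_extChartAt' (n := ∞) hx) (by
      rw [minSmoothness_of_isRCLikeNormedField]; exact WithTop.coe_le_coe.2 le_top)
  have h0 : mlieBracket 𝓘(ℝ, E) (fun _ : E => v) (fun _ : E => w) = 0 := by
    refine mlieBracketWithin_univ.symm.trans
      ((mlieBracketWithin_eq_lieBracketWithin (V := fun _ : E => v) (W := fun _ : E => w)).trans ?_)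
    funext y
    simp [lieBracketWithin]
    rfl
  rw [h0] at h
  exact h.symm.trans (by simp [mpullback_apply])

theorem mlieBracket_smul_eq (hf : ContMDiffAt 𝓘(ℝ, E) 𝓘(ℝ, ℝ) ∞ f x) (hY : RealSmoothAt Y x) :
    mlieBracket 𝓘(ℝ, E) X (f • Y) x
      = mvfderiv 𝓘(ℝ, E) f x (X x) • Y x + f x • mlieBracket 𝓘(ℝ, E) X Y x :=
  mlieBracket_smul_right (hf.mdifferentiableAt (by simp)) hY.mdifferentiableAt

/-- Read off from the Jacobi identity for `X`, `Y` and `f • U`, with `U` nonzero at `x`. The mixed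
terms cancel, the terms in undifferentiated `f` cancel by the Jacobi identity for `U`, and what is
left is the claimed formula times `U x`. -/
theorem mvfderiv_mlieBracket {f : M → ℝ} (hX : RealSmoothAt X x) (hY : RealSmoothAt Y x)
    (hf : ContMDiffAt 𝓘(ℝ, E) 𝓘(ℝ, ℝ) ∞ f x) :
    mvfderiv 𝓘(ℝ, E) f x (mlieBracket 𝓘(ℝ, E) X Y x)
      = mvfderiv 𝓘(ℝ, E) (fun y => mvfderiv 𝓘(ℝ, E) f y (Y y)) x (X x)
        - mvfderiv 𝓘(ℝ, E) (fun y => mvfderiv 𝓘(ℝ, E) f y (X y)) x (Y x) := by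
  -- In dimension zero no nonvanishing `U` exists, but every tangent vector is zero.
  rcases subsingleton_or_nontrivial E with hE | hE
  · have h0 : ∀ v : TangentSpace 𝓘(ℝ, E) x, v = 0 := fun v => Subsingleton.elim (α := E) _ _
    rw [h0 (mlieBracket _ _ _ _), h0 (X x), h0 (Y x)]
    simp
  obtain ⟨v, hv⟩ := exists_ne (0 : E)
  set U := chartField E x v with hU
  have hxs := mem_chart_source E x
  have hUx : U x ≠ 0 := fun h => hv (by
    rw [← mvfderiv_extChartAt_chartField v hxs, ← hU, h, map_zero])
  have hUs : RealSmoothAt U x := realSmoothAt_chartField v hxs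
  have hf1 : ∀ᶠ y in 𝓝 x, MDifferentiableAt 𝓘(ℝ, E) 𝓘(ℝ, ℝ) f y := by
    have h1 : ContMDiffAt 𝓘(ℝ, E) 𝓘(ℝ, ℝ) 1 f x := hf.of_le (by simp)
    filter_upwards [(contMDiffAt_iff_contMDiffAt_nhds (by simp)).1 h1] with y hy
    exact hy.mdifferentiableAt one_ne_zero
  -- The Leibniz rule is needed on a neighbourhood of `x`, because its outcome is bracketed once
  -- more.
  have key : ∀ T : ∀ x : M, TangentSpace 𝓘(ℝ, E) x, mlieBracket 𝓘(ℝ, E) T (f • U) =ᶠ[𝓝 x]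
      (fun y => mvfderiv 𝓘(ℝ, E) f y (T y)) • U + f • mlieBracket 𝓘(ℝ, E) T U := fun T => by
    filter_upwards [hf1, (chartAt E x).open_source.mem_nhds hxs] with y hy hys
    exact mlieBracket_smul_right hy (realSmoothAt_chartField v hys).mdifferentiableAt
  have main : ∀ {T T' : ∀ x : M, TangentSpace 𝓘(ℝ, E) x}, RealSmoothAt T x → RealSmoothAt T' x →
      mlieBracket 𝓘(ℝ, E) T (mlieBracket 𝓘(ℝ, E) T' (f • U)) x
      = mvfderiv 𝓘(ℝ, E) (fun y => mvfderiv 𝓘(ℝ, E) f y (T' y)) x (T x) • U x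
        + mvfderiv 𝓘(ℝ, E) f x (T' x) • mlieBracket 𝓘(ℝ, E) T U x
        + (mvfderiv 𝓘(ℝ, E) f x (T x) • mlieBracket 𝓘(ℝ, E) T' U x
        + f x • mlieBracket 𝓘(ℝ, E) T (mlieBracket 𝓘(ℝ, E) T' U) x) := by
    intro T T' hT hT'
    rw [Filter.EventuallyEq.mlieBracket_vectorField_eq (EventuallyEq.refl _ T) (key T'),
      mlieBracket_add_right, mlieBracket_smul_eq (hT'.contMDiffAt_mvfderiv hf) hUs,
      mlieBracket_smul_eq hf (hT'.mlieBracket hUs)]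
    · exact (RealSmoothAt.smul (hT'.contMDiffAt_mvfderiv hf) hUs).mdifferentiableAt
    · exact (RealSmoothAt.smul hf (hT'.mlieBracket hUs)).mdifferentiableAt
  have hJ := realJacobi hX hY (RealSmoothAt.smul hf hUs)
  rw [main hX hY, main hY hX, mlieBracket_smul_eq hf hUs, realJacobi hX hY hUs] at hJ
  have h2 : (mvfderiv 𝓘(ℝ, E) f x (mlieBracket 𝓘(ℝ, E) X Y x)
      - (mvfderiv 𝓘(ℝ, E) (fun y => mvfderiv 𝓘(ℝ, E) f y (Y y)) x (X x)
        - mvfderiv 𝓘(ℝ, E) (fun y => mvfderiv 𝓘(ℝ, E) f y (X y)) x (Y x))) • U x = 0 := by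
    rw [← sub_eq_zero] at hJ
    rw [← neg_eq_zero, ← hJ]
    module
  exact sub_eq_zero.1 ((smul_eq_zero.1 h2).resolve_right hUx)

end

theorem _root_.ContMDiffAt.eventually_mdifferentiableAt {E' : Type*} [NormedAddCommGroup E']
    [NormedSpace ℝ E'] {N : Type*} [TopologicalSpace N] [ChartedSpace E' N]
    [IsManifold 𝓘(ℝ, E) ∞ M] [IsManifold 𝓘(ℝ, E') ∞ N] {g : M → N}
    (hg : ContMDiffAt 𝓘(ℝ, E) 𝓘(ℝ, E') ∞ g x) :
    ∀ᶠ y in 𝓝 x, MDifferentiableAt 𝓘(ℝ, E) 𝓘(ℝ, E') g y := by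
  have h1 : ContMDiffAt 𝓘(ℝ, E) 𝓘(ℝ, E') 1 g x := hg.of_le (by simp)
  filter_upwards [(contMDiffAt_iff_contMDiffAt_nhds (by simp)).1 h1] with y hy
  exact hy.mdifferentiableAt one_ne_zero

theorem mvfderiv_congr {F : Type*} [NormedAddCommGroup F] [NormedSpace ℝ F] {f g : M → F}
    (h : f =ᶠ[𝓝 x] g) : mvfderiv 𝓘(ℝ, E) f x = mvfderiv 𝓘(ℝ, E) g x := by
  ext v
  simp only [mvfderiv, ContinuousLinearMap.comp_apply]
  rw [h.mfderiv_eq]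
  rfl

/-! ### Brackets of vector fields related by a smooth map. -/

section Related

variable [IsManifold 𝓘(ℝ, E) ∞ M]
  {E' : Type*} [NormedAddCommGroup E'] [NormedSpace ℝ E'] [FiniteDimensional ℝ E']
  {N : Type*} [TopologicalSpace N] [ChartedSpace E' N] [IsManifold 𝓘(ℝ, E') ∞ N]

/-- The map need not be a local diffeomorphism, so fields cannot be pulled back along it. Both sides
are compared as derivations on functions `L ∘ chart` with `L` a linear functional; these functions
separate tangent vectors. -/
theorem mlieBracket_related {α : N → M} {z : N} (hα : ContMDiffAt 𝓘(ℝ, E') 𝓘(ℝ, E) ∞ α z)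
    {X Y : ∀ z : N, TangentSpace 𝓘(ℝ, E') z} {a b : ∀ x : M, TangentSpace 𝓘(ℝ, E) x}
    (hX : RealSmoothAt X z) (hY : RealSmoothAt Y z)
    (ha : RealSmoothAt a (α z)) (hb : RealSmoothAt b (α z))
    (hXa : ∀ᶠ y in 𝓝 z, mfderiv 𝓘(ℝ, E') 𝓘(ℝ, E) α y (X y) = a (α y))
    (hYb : ∀ᶠ y in 𝓝 z, mfderiv 𝓘(ℝ, E') 𝓘(ℝ, E) α y (Y y) = b (α y)) :
    mfderiv 𝓘(ℝ, E') 𝓘(ℝ, E) α z (mlieBracket 𝓘(ℝ, E') X Y z)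
      = mlieBracket 𝓘(ℝ, E) a b (α z) := by
  have hs := mem_chart_source E (α z)
  -- Passing to chart coordinates turns the goal into an equality in the model space, where linear
  -- functionals can be applied.
  rw [← chartField_mvfderiv_extChartAt hs (mfderiv 𝓘(ℝ, E') 𝓘(ℝ, E) α z _),
    ← chartField_mvfderiv_extChartAt hs (mlieBracket 𝓘(ℝ, E) a b (α z))]
  congr 1
  refine (SeparatingDual.eq_iff_forall_dual_eq (R := ℝ)).2 fun L => ?_
  set h : M → ℝ := fun x => L (extChartAt 𝓘(ℝ, E) (α z) x) with hh
  have hφ : ContMDiffAt 𝓘(ℝ, E) 𝓘(ℝ, E) ∞ (extChartAt 𝓘(ℝ, E) (α z)) (α z) :=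
    contMDiffAt_extChartAt
  have hhs : ContMDiffAt 𝓘(ℝ, E) 𝓘(ℝ, ℝ) ∞ h (α z) := L.contMDiff.contMDiffAt.comp (α z) hφ
  have hL : ∀ v, L (mvfderiv 𝓘(ℝ, E) (extChartAt 𝓘(ℝ, E) (α z)) (α z) v)
      = mvfderiv 𝓘(ℝ, E) h (α z) v := fun v => by
    have h1 : MDifferentiableAt 𝓘(ℝ, E) 𝓘(ℝ, ℝ) L (extChartAt 𝓘(ℝ, E) (α z) (α z)) :=
      L.differentiableAt.mdifferentiableAt
    refine Eq.trans ?_ (mvfderiv_comp_apply (α z) h1 (hφ.mdifferentiableAt (by simp)) v).symm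
    rw [mvfderiv, mvfderiv, ContinuousLinearMap.mfderiv_eq]
    rfl
  rw [hL, hL]
  have hcomp : ∀ {k : M → ℝ}, ContMDiffAt 𝓘(ℝ, E) 𝓘(ℝ, ℝ) ∞ k (α z) →
      ∀ᶠ y in 𝓝 z, ∀ v, mvfderiv 𝓘(ℝ, E') (k ∘ α) y v
        = mvfderiv 𝓘(ℝ, E) k (α y) (mfderiv 𝓘(ℝ, E') 𝓘(ℝ, E) α y v) := fun {k} hk => by
    filter_upwards [hα.eventually_mdifferentiableAt,
      hα.continuousAt.eventually hk.eventually_mdifferentiableAt] with y h1 h2 v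
    exact mvfderiv_comp_apply y h2 h1 v
  have hder : ∀ {T : ∀ z : N, TangentSpace 𝓘(ℝ, E') z} {c : ∀ x : M, TangentSpace 𝓘(ℝ, E) x},
      (∀ᶠ y in 𝓝 z, mfderiv 𝓘(ℝ, E') 𝓘(ℝ, E) α y (T y) = c (α y)) →
      (fun y => mvfderiv 𝓘(ℝ, E') (h ∘ α) y (T y)) =ᶠ[𝓝 z]
        (fun x => mvfderiv 𝓘(ℝ, E) h x (c x)) ∘ α := fun {T c} hT => by
    filter_upwards [hT, hcomp hhs] with y h1 h2
    rw [h2, h1]; rfl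
  rw [← (hcomp hhs).self_of_nhds, mvfderiv_mlieBracket hX hY (hhs.comp z hα),
    mvfderiv_mlieBracket ha hb hhs, mvfderiv_congr (hder hYb), mvfderiv_congr (hder hXa),
    (hcomp (hb.contMDiffAt_mvfderiv hhs)).self_of_nhds,
    (hcomp (ha.contMDiffAt_mvfderiv hhs)).self_of_nhds, hXa.self_of_nhds, hYb.self_of_nhds]

end Related

end RealFields

/-! ## Germs of smooth complex vector fields -/

section ComplexFields

variable {E : Type*} [NormedAddCommGroup E] [NormedSpace ℝ E] [FiniteDimensional ℝ E]
  {M : Type*} [TopologicalSpace M] [ChartedSpace E M]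

theorem clm_mvfderiv {F G : Type*} [NormedAddCommGroup F] [NormedSpace ℝ F]
    [NormedAddCommGroup G] [NormedSpace ℝ G] (L : F →L[ℝ] G) {f : M → F} {x : M}
    (hf : MDifferentiableAt 𝓘(ℝ, E) 𝓘(ℝ, F) f x) (v : TangentSpace 𝓘(ℝ, E) x) :
    L (mvfderiv 𝓘(ℝ, E) f x v) = mvfderiv 𝓘(ℝ, E) (fun y => L (f y)) x v := by
  have h1 : MDifferentiableAt 𝓘(ℝ, F) 𝓘(ℝ, G) L (f x) := L.differentiableAt.mdifferentiableAt
  have h2 : mfderiv 𝓘(ℝ, E) 𝓘(ℝ, G) (L ∘ f) x v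
      = mfderiv 𝓘(ℝ, F) 𝓘(ℝ, G) L (f x) (mfderiv 𝓘(ℝ, E) 𝓘(ℝ, F) f x v) :=
    mfderiv_comp_apply x h1 hf v
  rw [ContinuousLinearMap.mfderiv_eq] at h2
  exact h2.symm

/-- The derivative of a complex function along a complex vector field. -/
def cderiv (V : ∀ x : M, CT E x) (f : M → ℂ) (x : M) : ℂ :=
  mvfderiv 𝓘(ℝ, E) f x (V x).re + Complex.I * mvfderiv 𝓘(ℝ, E) f x (V x).im

/-- A complex function is smooth at `x`. -/
abbrev FnSmoothAt (f : M → ℂ) (x : M) : Prop := ContMDiffAt 𝓘(ℝ, E) 𝓘(ℝ, ℂ) ∞ f x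

variable {V W V' W' : ∀ x : M, CT E x} {x : M} {f g : M → ℂ}

variable (E) in
theorem FnSmoothAt.re (hf : FnSmoothAt (E := E) f x) :
    ContMDiffAt 𝓘(ℝ, E) 𝓘(ℝ, ℝ) ∞ (fun y => (f y).re) x :=
  (Complex.reCLM.contMDiff (n := ∞)).contMDiffAt.comp x hf

variable (E) in
theorem FnSmoothAt.im (hf : FnSmoothAt (E := E) f x) :
    ContMDiffAt 𝓘(ℝ, E) 𝓘(ℝ, ℝ) ∞ (fun y => (f y).im) x :=
  (Complex.imCLM.contMDiff (n := ∞)).contMDiffAt.comp x hf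

theorem FnSmoothAt.mul (hf : FnSmoothAt (E := E) f x) (hg : FnSmoothAt (E := E) g x) :
    FnSmoothAt (E := E) (fun y => f y * g y) x :=
  ((contDiff_fst.mul contDiff_snd : ContDiff ℝ ∞ fun p : ℂ × ℂ => p.1 * p.2).contDiffAt).comp_contMDiffAt
    (hf.prodMk_space hg)

theorem FnSmoothAt.inv (hf : FnSmoothAt (E := E) f x) (h : f x ≠ 0) :
    FnSmoothAt (E := E) (fun y => (f y)⁻¹) x :=
  (contDiffAt_inv ℝ h).comp_contMDiffAt hf

theorem FnSmoothAt.sum {ι : Type*} {s : Finset ι} {f : ι → M → ℂ}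
    (hf : ∀ i ∈ s, FnSmoothAt (E := E) (f i) x) :
    FnSmoothAt (E := E) (fun y => ∑ i ∈ s, f i y) x := by
  classical
  induction s using Finset.induction_on with
  | empty => simpa using contMDiffAt_const
  | insert i s hi ih =>
    simp only [Finset.sum_insert hi]
    exact (hf i (by simp)).add (ih fun j hj => hf j (by simp [hj]))

theorem FnSmoothAt.prod {ι : Type*} {s : Finset ι} {f : ι → M → ℂ}
    (hf : ∀ i ∈ s, FnSmoothAt (E := E) (f i) x) :
    FnSmoothAt (E := E) (fun y => ∏ i ∈ s, f i y) x := by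
  classical
  induction s using Finset.induction_on with
  | empty => simpa using contMDiffAt_const
  | insert i s hi ih =>
    simp only [Finset.prod_insert hi]
    exact (hf i (by simp)).mul (ih fun j hj => hf j (by simp [hj]))

theorem bracket_congr (hV : ∀ᶠ y in 𝓝 x, V y = V' y) (hW : ∀ᶠ y in 𝓝 x, W y = W' y) :
    bracket V W x = bracket V' W' x := by
  have h1 : (fun y => (V y).re) =ᶠ[𝓝 x] fun y => (V' y).re :=
    hV.mono fun _ hy => congrArg Cx.re hy
  have h2 : (fun y => (V y).im) =ᶠ[𝓝 x] fun y => (V' y).im :=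
    hV.mono fun _ hy => congrArg Cx.im hy
  have h3 : (fun y => (W y).re) =ᶠ[𝓝 x] fun y => (W' y).re :=
    hW.mono fun _ hy => congrArg Cx.re hy
  have h4 : (fun y => (W y).im) =ᶠ[𝓝 x] fun y => (W' y).im :=
    hW.mono fun _ hy => congrArg Cx.im hy
  simp only [bracket, h1.mlieBracket_vectorField_eq h3, h1.mlieBracket_vectorField_eq h4,
    h2.mlieBracket_vectorField_eq h3, h2.mlieBracket_vectorField_eq h4]

theorem bracket_swap : bracket V W x = -bracket W V x := by
  ext
  · simp only [bracket, re_mk, re_neg]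
    rw [mlieBracket_swap_apply, mlieBracket_swap_apply (V := fun y => (V y).im)]
    abel
  · simp only [bracket, im_mk, im_neg]
    rw [mlieBracket_swap_apply, mlieBracket_swap_apply (V := fun y => (V y).im)]
    abel

theorem bracket_self : bracket V V x = 0 := by
  ext
  · simp [bracket, mlieBracket_self]
  · simp only [bracket, im_mk, im_zero]
    rw [mlieBracket_swap_apply, neg_add_cancel]

section

variable [IsManifold 𝓘(ℝ, E) ∞ M]

/-- A complex vector field is smooth at `x`. -/
def SmoothAt (V : ∀ x : M, CT E x) (x : M) : Prop :=
  RealSmoothAt (fun y => (V y).re) x ∧ RealSmoothAt (fun y => (V y).im) x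

theorem SmoothOn.smoothAt {U : Set M} (hV : SmoothOn V U) (hU : IsOpen U)
    (hx : x ∈ U) : SmoothAt V x :=
  ⟨hV.1.realSmoothAt hU hx, hV.2.realSmoothAt hU hx⟩

theorem SmoothOn.eventually {U : Set M} (hV : SmoothOn V U) (hU : IsOpen U)
    (hx : x ∈ U) : ∀ᶠ y in 𝓝 x, SmoothAt V y :=
  Eventually.mono (hU.mem_nhds hx) fun _ hy => hV.smoothAt hU hy

theorem smoothOn_of_smoothAt {U : Set M} (h : ∀ x ∈ U, SmoothAt V x) : SmoothOn V U :=
  ⟨realSmoothOn_of_realSmoothAt fun x hx => (h x hx).1,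
    realSmoothOn_of_realSmoothAt fun x hx => (h x hx).2⟩

namespace SmoothAt

theorem congr (hV : SmoothAt V x) (h : ∀ᶠ y in 𝓝 x, W y = V y) : SmoothAt W x :=
  ⟨hV.1.congr (h.mono fun y hy => by simp only [hy]),
    hV.2.congr (h.mono fun y hy => by simp only [hy])⟩

theorem add (hV : SmoothAt V x) (hW : SmoothAt W x) : SmoothAt (V + W) x :=
  ⟨hV.1.add hW.1, hV.2.add hW.2⟩

theorem sub (hV : SmoothAt V x) (hW : SmoothAt W x) : SmoothAt (V - W) x :=
  ⟨hV.1.sub hW.1, hV.2.sub hW.2⟩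

theorem neg (hV : SmoothAt V x) : SmoothAt (-V) x :=
  ⟨hV.1.neg, hV.2.neg⟩

theorem zero : SmoothAt (0 : ∀ x : M, CT E x) x :=
  ⟨RealSmoothAt.zero, RealSmoothAt.zero⟩

theorem smul (hf : FnSmoothAt (E := E) f x) (hV : SmoothAt V x) : SmoothAt (f • V) x :=
  ⟨(RealSmoothAt.smul (hf.re E) hV.1).sub (RealSmoothAt.smul (hf.im E) hV.2),
    (RealSmoothAt.smul (hf.re E) hV.2).add (RealSmoothAt.smul (hf.im E) hV.1)⟩

theorem const_smul (c : ℂ) (hV : SmoothAt V x) : SmoothAt (c • V) x :=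
  smul (f := fun _ => c) contMDiffAt_const hV

theorem conj (hV : SmoothAt V x) : SmoothAt (fun y => Cx.conj (V y)) x :=
  ⟨hV.1, hV.2.neg⟩

theorem sum {ι : Type*} {s : Finset ι} {V : ι → ∀ x : M, CT E x}
    (hV : ∀ i ∈ s, SmoothAt (V i) x) : SmoothAt (∑ i ∈ s, V i) x := by
  classical
  induction s using Finset.induction_on with
  | empty => simpa using zero
  | insert i s hi ih =>
    rw [Finset.sum_insert hi]
    exact (hV i (by simp)).add (ih fun j hj => hV j (by simp [hj]))

theorem bracket (hV : SmoothAt V x) (hW : SmoothAt W x) : SmoothAt (bracket V W) x :=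
  ⟨(hV.1.mlieBracket hW.1).sub (hV.2.mlieBracket hW.2),
    (hV.1.mlieBracket hW.2).add (hV.2.mlieBracket hW.1)⟩

end SmoothAt

theorem realBracket_add_right {X Y Y' : ∀ x : M, TangentSpace 𝓘(ℝ, E) x}
    (hY : RealSmoothAt Y x) (hY' : RealSmoothAt Y' x) :
    mlieBracket 𝓘(ℝ, E) X (Y + Y') x
      = mlieBracket 𝓘(ℝ, E) X Y x + mlieBracket 𝓘(ℝ, E) X Y' x :=
  mlieBracket_add_right hY.mdifferentiableAt hY'.mdifferentiableAt

theorem realBracket_neg_right {X Y : ∀ x : M, TangentSpace 𝓘(ℝ, E) x}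
    (hY : RealSmoothAt Y x) :
    mlieBracket 𝓘(ℝ, E) X (-Y) x = -mlieBracket 𝓘(ℝ, E) X Y x := by
  have := mlieBracket_const_smul_right (I := 𝓘(ℝ, E)) (c := (-1 : ℝ)) (V := X) hY.mdifferentiableAt
  rwa [neg_one_smul, neg_one_smul] at this

theorem realBracket_sub_right {X Y Y' : ∀ x : M, TangentSpace 𝓘(ℝ, E) x}
    (hY : RealSmoothAt Y x) (hY' : RealSmoothAt Y' x) :
    mlieBracket 𝓘(ℝ, E) X (Y - Y') x
      = mlieBracket 𝓘(ℝ, E) X Y x - mlieBracket 𝓘(ℝ, E) X Y' x := by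
  rw [sub_eq_add_neg, realBracket_add_right hY hY'.neg, realBracket_neg_right hY', sub_eq_add_neg]

theorem realBracket_neg_left {X Y : ∀ x : M, TangentSpace 𝓘(ℝ, E) x}
    (hX : RealSmoothAt X x) :
    mlieBracket 𝓘(ℝ, E) (-X) Y x = -mlieBracket 𝓘(ℝ, E) X Y x := by
  rw [mlieBracket_swap_apply, realBracket_neg_right hX, mlieBracket_swap_apply (V := X)]

theorem realBracket_add_left {X X' Y : ∀ x : M, TangentSpace 𝓘(ℝ, E) x}
    (hX : RealSmoothAt X x) (hX' : RealSmoothAt X' x) :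
    mlieBracket 𝓘(ℝ, E) (X + X') Y x
      = mlieBracket 𝓘(ℝ, E) X Y x + mlieBracket 𝓘(ℝ, E) X' Y x :=
  mlieBracket_add_left hX.mdifferentiableAt hX'.mdifferentiableAt

theorem realBracket_sub_left {X X' Y : ∀ x : M, TangentSpace 𝓘(ℝ, E) x}
    (hX : RealSmoothAt X x) (hX' : RealSmoothAt X' x) :
    mlieBracket 𝓘(ℝ, E) (X - X') Y x
      = mlieBracket 𝓘(ℝ, E) X Y x - mlieBracket 𝓘(ℝ, E) X' Y x := by
  rw [sub_eq_add_neg, realBracket_add_left hX hX'.neg, realBracket_neg_left hX', sub_eq_add_neg]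

theorem bracket_add_right (hW : SmoothAt W x) (hW' : SmoothAt W' x) :
    bracket V (W + W') x = bracket V W x + bracket V W' x := by
  have h1 : (fun y => ((W + W') y).re) = (fun y => (W y).re) + fun y => (W' y).re := rfl
  have h2 : (fun y => ((W + W') y).im) = (fun y => (W y).im) + fun y => (W' y).im := rfl
  ext
  · simp only [bracket, re_mk, re_add, h1, h2, realBracket_add_right hW.1 hW'.1,
      realBracket_add_right hW.2 hW'.2]
    abel
  · simp only [bracket, im_mk, im_add, h1, h2, realBracket_add_right hW.1 hW'.1,
      realBracket_add_right hW.2 hW'.2]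
    abel

theorem bracket_zero_right : bracket V 0 x = 0 := by
  have h1 : (fun y => ((0 : ∀ x : M, CT E x) y).re) = 0 := rfl
  have h2 : (fun y => ((0 : ∀ x : M, CT E x) y).im) = 0 := rfl
  simp only [bracket, h1, h2, mlieBracket_zero_right]
  ext <;> simp

theorem bracket_smul_right (hf : FnSmoothAt (E := E) f x) (hW : SmoothAt W x) :
    bracket V (f • W) x = cderiv V f x • W x + f x • bracket V W x := by
  have h1 : (fun y => ((f • W) y).re)
      = (fun y => (f y).re) • (fun y => (W y).re) - (fun y => (f y).im) • fun y => (W y).im := rfl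
  have h2 : (fun y => ((f • W) y).im)
      = (fun y => (f y).re) • (fun y => (W y).im) + (fun y => (f y).im) • fun y => (W y).re := rfl
  have hd := hf.mdifferentiableAt (by simp)
  have d1 : ∀ v, mvfderiv 𝓘(ℝ, E) (fun y => (f y).re) x v = (mvfderiv 𝓘(ℝ, E) f x v).re :=
    fun v => (clm_mvfderiv Complex.reCLM hd v).symm
  have d2 : ∀ v, mvfderiv 𝓘(ℝ, E) (fun y => (f y).im) x v = (mvfderiv 𝓘(ℝ, E) f x v).im :=
    fun v => (clm_mvfderiv Complex.imCLM hd v).symm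
  have e1 := fun X => mlieBracket_smul_eq (X := X) (hf.re E) hW.1
  have e2 := fun X => mlieBracket_smul_eq (X := X) (hf.re E) hW.2
  have e3 := fun X => mlieBracket_smul_eq (X := X) (hf.im E) hW.1
  have e4 := fun X => mlieBracket_smul_eq (X := X) (hf.im E) hW.2
  have s1 := RealSmoothAt.smul (hf.re E) hW.1
  have s2 := RealSmoothAt.smul (hf.re E) hW.2
  have s3 := RealSmoothAt.smul (hf.im E) hW.1
  have s4 := RealSmoothAt.smul (hf.im E) hW.2
  ext
  · simp only [bracket, cderiv, re_mk, im_mk, re_add, re_smul, h1, h2, realBracket_sub_right s1 s4,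
      realBracket_add_right s2 s3, e1, e2, e3, e4, d1, d2, Complex.add_re, Complex.add_im,
      Complex.mul_re, Complex.mul_im, Complex.I_re, Complex.I_im]
    module
  · simp only [bracket, cderiv, re_mk, im_mk, im_add, im_smul, h1, h2, realBracket_sub_right s1 s4,
      realBracket_add_right s2 s3, e1, e2, e3, e4, d1, d2, Complex.add_re, Complex.add_im,
      Complex.mul_re, Complex.mul_im, Complex.I_re, Complex.I_im]
    module

theorem cderiv_const (c : ℂ) : cderiv V (fun _ => c) x = 0 := by
  simp [cderiv, mvfderiv_const]

theorem bracket_const_smul_right (c : ℂ) (hW : SmoothAt W x) :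
    bracket V (c • W) x = c • bracket V W x := by
  have := bracket_smul_right (V := V) (f := fun _ => c) contMDiffAt_const hW
  rw [cderiv_const, zero_smul, zero_add] at this
  exact this

theorem bracket_neg_right (hW : SmoothAt W x) : bracket V (-W) x = -bracket V W x := by
  have := bracket_const_smul_right (V := V) (-1) hW
  rwa [neg_one_smul, neg_one_smul] at this

theorem bracket_sub_right (hW : SmoothAt W x) (hW' : SmoothAt W' x) :
    bracket V (W - W') x = bracket V W x - bracket V W' x := by
  rw [sub_eq_add_neg, bracket_add_right hW hW'.neg, bracket_neg_right hW', sub_eq_add_neg]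

theorem bracket_sub_left (hV : SmoothAt V x) (hV' : SmoothAt V' x) :
    bracket (V - V') W x = bracket V W x - bracket V' W x := by
  rw [bracket_swap, bracket_sub_right hV hV', bracket_swap (V := V), bracket_swap (V := V')]
  abel

theorem bracket_sum_right {ι : Type*} {s : Finset ι} {W : ι → ∀ x : M, CT E x}
    (hW : ∀ i ∈ s, SmoothAt (W i) x) :
    bracket V (∑ i ∈ s, W i) x = ∑ i ∈ s, bracket V (W i) x := by
  classical
  induction s using Finset.induction_on with
  | empty => simpa using bracket_zero_right
  | insert i s hi ih =>
    rw [Finset.sum_insert hi, Finset.sum_insert hi, bracket_add_right (hW i (by simp))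
      (SmoothAt.sum fun j hj => hW j (by simp [hj])), ih fun j hj => hW j (by simp [hj])]

theorem bracket_conj (hV : SmoothAt V x) (hW : SmoothAt W x) :
    bracket (fun y => Cx.conj (V y)) (fun y => Cx.conj (W y)) x = Cx.conj (bracket V W x) := by
  have h1 : (fun y => -(V y).im) = -fun y => (V y).im := rfl
  have h2 : (fun y => -(W y).im) = -fun y => (W y).im := rfl
  ext
  · simp only [bracket, re_mk, re_conj, im_conj, h1, h2, realBracket_neg_right hW.2,
      realBracket_neg_left hV.2, neg_neg]
  · simp only [bracket, im_mk, re_conj, im_conj, h1, h2, realBracket_neg_right hW.2,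
      realBracket_neg_left hV.2]
    abel

/-- Bilinearity over the reals reduces this to eight real Jacobi identities, one for each choice of
real or imaginary parts. -/
theorem jacobi {u : ∀ x : M, CT E x} (hu : SmoothAt u x) (hV : SmoothAt V x)
    (hW : SmoothAt W x) :
    bracket u (bracket V W) x = bracket (bracket u V) W x + bracket V (bracket u W) x := by
  have hre : ∀ V W : ∀ x : M, CT E x, (fun y => (bracket V W y).re)
      = mlieBracket 𝓘(ℝ, E) (fun y => (V y).re) (fun y => (W y).re)
      - mlieBracket 𝓘(ℝ, E) (fun y => (V y).im) (fun y => (W y).im) := fun _ _ => rfl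
  have him : ∀ V W : ∀ x : M, CT E x, (fun y => (bracket V W y).im)
      = mlieBracket 𝓘(ℝ, E) (fun y => (V y).re) (fun y => (W y).im)
      + mlieBracket 𝓘(ℝ, E) (fun y => (V y).im) (fun y => (W y).re) := fun _ _ => rfl
  have hb : ∀ a b : ∀ x : M, CT E x, bracket a b x = Cx.mk
    (mlieBracket 𝓘(ℝ, E) (fun y => (a y).re) (fun y => (b y).re) x
      - mlieBracket 𝓘(ℝ, E) (fun y => (a y).im) (fun y => (b y).im) x)
    (mlieBracket 𝓘(ℝ, E) (fun y => (a y).re) (fun y => (b y).im) x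
      + mlieBracket 𝓘(ℝ, E) (fun y => (a y).im) (fun y => (b y).re) x) := fun _ _ => rfl
  rw [hb u, hb (bracket u V), hb V]
  simp only [hre, him]
  simp only [realBracket_sub_right (hV.1.mlieBracket hW.1) (hV.2.mlieBracket hW.2),
    realBracket_add_right (hV.1.mlieBracket hW.2) (hV.2.mlieBracket hW.1),
    realBracket_sub_right (hu.1.mlieBracket hW.1) (hu.2.mlieBracket hW.2),
    realBracket_add_right (hu.1.mlieBracket hW.2) (hu.2.mlieBracket hW.1),
    realBracket_sub_left (hu.1.mlieBracket hV.1) (hu.2.mlieBracket hV.2),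
    realBracket_add_left (hu.1.mlieBracket hV.2) (hu.2.mlieBracket hV.1),
    realJacobi hu.1 hV.1 hW.1, realJacobi hu.1 hV.1 hW.2, realJacobi hu.1 hV.2 hW.1,
    realJacobi hu.1 hV.2 hW.2, realJacobi hu.2 hV.1 hW.1, realJacobi hu.2 hV.1 hW.2,
    realJacobi hu.2 hV.2 hW.1, realJacobi hu.2 hV.2 hW.2]
  ext
  · simp only [re_mk, re_add]
    abel
  · simp only [im_mk, im_add]
    abel

end

end ComplexFields

/-! ## Local frames and sections of subbundles -/

section Frames

variable {E : Type*} [NormedAddCommGroup E] [NormedSpace ℝ E] [FiniteDimensional ℝ E]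
  {M : Type*} [TopologicalSpace M] [ChartedSpace E M] [IsManifold 𝓘(ℝ, E) ∞ M]
  {P Q : ∀ x : M, Submodule ℂ (CT E x)} {V W u : ∀ x : M, CT E x} {x x₀ : M} {f : M → ℂ}

/-- Near `x`, the vector field `V` is a smooth section of `P`. -/
def IsSectionAt (P : ∀ x : M, Submodule ℂ (CT E x)) (V : ∀ x : M, CT E x) (x : M) : Prop :=
  ∀ᶠ y in 𝓝 x, SmoothAt V y ∧ V y ∈ P y

/-- `[P, V] ⊆ P` at the point `x`. -/
def PreservesAt (P : ∀ x : M, Submodule ℂ (CT E x)) (V : ∀ x : M, CT E x) (x : M) : Prop :=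
  ∀ u, IsSectionAt P u x → bracket u V x ∈ P x

namespace IsSectionAt

theorem smoothAt (hV : IsSectionAt P V x) : SmoothAt V x := hV.self_of_nhds.1

theorem mem (hV : IsSectionAt P V x) : V x ∈ P x := hV.self_of_nhds.2

theorem eventually (hV : IsSectionAt P V x) : ∀ᶠ y in 𝓝 x, IsSectionAt P V y :=
  eventually_eventually_nhds.2 hV

theorem mono (hV : IsSectionAt P V x) (h : ∀ y, P y ≤ Q y) : IsSectionAt Q V x :=
  Eventually.mono hV fun y hy => ⟨hy.1, h y hy.2⟩

theorem of_conj (hV : IsSectionAt (fun y => conjSub (P y)) V x) :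
    IsSectionAt P (fun y => Cx.conj (V y)) x := by
  filter_upwards [hV] with y h1
  exact ⟨h1.1.conj, h1.2⟩

end IsSectionAt

theorem isSectionAt_of_smoothOn {U : Set M} (hU : IsOpen U) (hx : x ∈ U) (hV : SmoothOn V U)
    (h : ∀ y ∈ U, V y ∈ P y) : IsSectionAt P V x := by
  filter_upwards [hU.mem_nhds hx] with y hy
  exact ⟨hV.smoothAt hU hy, h y hy⟩

theorem IsInvolutive.bracket_mem (hP : IsInvolutive P) (hV : IsSectionAt P V x)
    (hW : IsSectionAt P W x) : bracket V W x ∈ P x := by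
  obtain ⟨U, h, hU, hx⟩ := eventually_nhds_iff.1 (hV.and hW)
  exact hP U V W hU (smoothOn_of_smoothAt fun y hy => (h y hy).1.1)
    (smoothOn_of_smoothAt fun y hy => (h y hy).2.1) (fun y hy => (h y hy).1.2)
    (fun y hy => (h y hy).2.2) x hx

theorem isInvolutive_of_bracket_mem
    (h : ∀ x V W, IsSectionAt P V x → IsSectionAt P W x → bracket V W x ∈ P x) :
    IsInvolutive P := fun _ V W hU hV hW hVP hWP x hx =>
  h x V W (isSectionAt_of_smoothOn hU hx hV hVP) (isSectionAt_of_smoothOn hU hx hW hWP)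

/-- Replaces quantification over open subsets and their sections by a condition on germs at each
point, the form in which the argument is carried out. -/
theorem bracketPreserves_iff {U : Set M} (hU : IsOpen U) :
    BracketPreserves P V U ↔ ∀ x ∈ U, PreservesAt P V x := by
  constructor
  · intro h x hx u hu
    obtain ⟨U', h', hU', hx'⟩ := eventually_nhds_iff.1 hu
    exact h (U' ∩ U) u (hU'.inter hU) inter_subset_right
      (smoothOn_of_smoothAt fun y hy => (h' y hy.1).1) (fun y hy => (h' y hy.1).2) x ⟨hx', hx⟩
  · intro h U' u hU' hs hu huP x hx
    exact h x (hs hx) u (isSectionAt_of_smoothOn hU' hx hu huP)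

theorem IsInvolutive.preservesAt (hP : IsInvolutive P) (hV : IsSectionAt P V x) :
    PreservesAt P V x := fun _ hu => hP.bracket_mem hu hV

namespace PreservesAt

theorem congr (hV : PreservesAt P V x) (h : ∀ᶠ y in 𝓝 x, W y = V y) : PreservesAt P W x :=
  fun u hu => by
    rw [bracket_congr (Eventually.of_forall fun _ => rfl) h]
    exact hV u hu

theorem add (hV : PreservesAt P V x) (hVs : SmoothAt V x) (hW : PreservesAt P W x)
    (hWs : SmoothAt W x) : PreservesAt P (V + W) x := fun u hu => by
  rw [bracket_add_right hVs hWs]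
  exact add_mem (hV u hu) (hW u hu)

theorem sub (hV : PreservesAt P V x) (hVs : SmoothAt V x) (hW : PreservesAt P W x)
    (hWs : SmoothAt W x) : PreservesAt P (V - W) x := fun u hu => by
  rw [bracket_sub_right hVs hWs]
  exact sub_mem (hV u hu) (hW u hu)

/-- The derivative term of the Leibniz rule drops out. The intended functions are pullbacks from the
base, which vertical fields kill. -/
theorem smul (hf : FnSmoothAt (E := E) f x) (h0 : ∀ u, IsSectionAt P u x → cderiv u f x = 0)
    (hV : PreservesAt P V x) (hVs : SmoothAt V x) : PreservesAt P (f • V) x := fun u hu => by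
  rw [bracket_smul_right hf hVs, h0 u hu, zero_smul, zero_add]
  exact Submodule.smul_mem _ _ (hV u hu)

end PreservesAt

theorem bracket_conj_mem (h : bracket V W x ∈ P x) (hV : SmoothAt V x) (hW : SmoothAt W x) :
    bracket (fun y => Cx.conj (V y)) (fun y => Cx.conj (W y)) x ∈ conjSub (P x) := by
  rw [bracket_conj hV hW, mem_conjSub, conj_conj]
  exact h

theorem IsInvolutive.conj (hP : IsInvolutive P) : IsInvolutive (fun x => conjSub (P x)) :=
  isInvolutive_of_bracket_mem fun x V W hV hW => by
    have := bracket_conj_mem (hP.bracket_mem hV.of_conj hW.of_conj) hV.of_conj.smoothAt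
      hW.of_conj.smoothAt
    simpa using this

/-! ### The coordinate frame of a chart -/

variable (E) in
/-- The coordinate vector fields of the chart at `x₀`, as complex vector fields. -/
def chartFrame (x₀ : M) (i : Fin (Module.finrank ℝ E)) (x : M) : CT E x :=
  Cx.mk (chartField E x₀ (Module.finBasis ℝ E i) x) 0

variable (E) in
/-- The complex coordinates of complex tangent vectors in the chart at `x₀`. -/
def chartCoord (x₀ : M) (i : Fin (Module.finrank ℝ E)) (x : M) : CT E x →ₗ[ℂ] ℂ where
  toFun v := ⟨(Module.finBasis ℝ E).coord i (mvfderiv 𝓘(ℝ, E) (extChartAt 𝓘(ℝ, E) x₀) x v.re),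
    (Module.finBasis ℝ E).coord i (mvfderiv 𝓘(ℝ, E) (extChartAt 𝓘(ℝ, E) x₀) x v.im)⟩
  map_add' u v := by
    apply Complex.ext <;> simp only [re_add, im_add, map_add, Complex.add_re, Complex.add_im]
  map_smul' c v := by
    apply Complex.ext <;>
      simp only [re_smul, im_smul, map_add, map_sub, map_smul, smul_eq_mul, Complex.mul_re,
        Complex.mul_im, RingHom.id_apply]

theorem smoothAt_mk {X Y : ∀ x : M, TangentSpace 𝓘(ℝ, E) x} (hX : RealSmoothAt X x)
    (hY : RealSmoothAt Y x) : SmoothAt (fun y => Cx.mk (X y) (Y y)) x := ⟨hX, hY⟩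

theorem smoothAt_chartFrame (i) (hx : x ∈ (chartAt E x₀).source) :
    SmoothAt (chartFrame E x₀ i) x :=
  smoothAt_mk (realSmoothAt_chartField _ hx) RealSmoothAt.zero

theorem chartField_sum {ι : Type*} (s : Finset ι) (c : ι → ℝ) (v : ι → E) :
    chartField E x₀ (∑ i ∈ s, c i • v i) x = ∑ i ∈ s, c i • chartField E x₀ (v i) x := by
  have : ∀ w, chartField E x₀ w x
    = (mfderiv 𝓘(ℝ, E) 𝓘(ℝ, E) (extChartAt 𝓘(ℝ, E) x₀) x).inverse w := fun _ => rfl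
  simp only [this]
  exact (map_sum _ _ _).trans (Finset.sum_congr rfl fun i _ => map_smul _ _ _)

theorem Cx.re_sum {F ι : Type*} [AddCommGroup F] [Module ℝ F] (s : Finset ι) (v : ι → Cx F) :
    (∑ i ∈ s, v i).re = ∑ i ∈ s, (v i).re :=
  map_sum (⟨⟨Cx.re, rfl⟩, fun _ _ => rfl⟩ : Cx F →+ F) v s

theorem Cx.im_sum {F ι : Type*} [AddCommGroup F] [Module ℝ F] (s : Finset ι) (v : ι → Cx F) :
    (∑ i ∈ s, v i).im = ∑ i ∈ s, (v i).im :=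
  map_sum (⟨⟨Cx.im, rfl⟩, fun _ _ => rfl⟩ : Cx F →+ F) v s

theorem sum_chartCoord_smul (hx : x ∈ (chartAt E x₀).source) (v : CT E x) :
    ∑ i, chartCoord E x₀ i x v • chartFrame E x₀ i x = v := by
  have key : ∀ w : TangentSpace 𝓘(ℝ, E) x, ∑ i, (Module.finBasis ℝ E).coord i
      (mvfderiv 𝓘(ℝ, E) (extChartAt 𝓘(ℝ, E) x₀) x w) •
        chartField E x₀ (Module.finBasis ℝ E i) x = w := fun w => by
    rw [← chartField_sum]
    simp only [Module.Basis.coord_apply, Module.Basis.sum_repr]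
    exact chartField_mvfderiv_extChartAt hx w
  ext
  · rw [Cx.re_sum]
    simp only [re_smul, chartFrame, re_mk, im_mk, smul_zero, sub_zero]
    exact key v.re
  · rw [Cx.im_sum]
    simp only [im_smul, chartFrame, re_mk, im_mk, smul_zero, zero_add]
    exact key v.im

theorem SmoothAt.chartCoord (i) (hx : x ∈ (chartAt E x₀).source) (hV : SmoothAt V x) :
    FnSmoothAt (E := E) (fun y => chartCoord E x₀ i y (V y)) x := by
  have hφ : ContMDiffAt 𝓘(ℝ, E) 𝓘(ℝ, E) ∞ (extChartAt 𝓘(ℝ, E) x₀) x := contMDiffAt_extChartAt' hx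
  have h : ∀ {X : ∀ x : M, TangentSpace 𝓘(ℝ, E) x}, RealSmoothAt X x →
      ContMDiffAt 𝓘(ℝ, E) 𝓘(ℝ, ℝ) ∞ (fun y => (Module.finBasis ℝ E).coord i
        (mvfderiv 𝓘(ℝ, E) (extChartAt 𝓘(ℝ, E) x₀) y (X y))) x := fun {X} hX =>
    (LinearMap.toContinuousLinearMap
      ((Module.finBasis ℝ E).coord i)).contMDiff.contMDiffAt.comp x (hX.contMDiffAt_mvfderiv hφ)
  have h2 := (Complex.equivRealProdCLM.symm.contDiff (n := ∞)).contDiffAt.comp_contMDiffAt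
    ((h hV.1).prodMk_space (h hV.2))
  exact h2

/-! ### Dual frames -/

theorem fnSmoothAt_det {κ : Type*} [Fintype κ] [DecidableEq κ] {A : M → Matrix κ κ ℂ}
    (hA : ∀ i j, FnSmoothAt (E := E) (fun y => A y i j) x) :
    FnSmoothAt (E := E) (fun y => (A y).det) x := by
  simp only [Matrix.det_apply']
  exact FnSmoothAt.sum fun σ _ => FnSmoothAt.mul contMDiffAt_const
    (FnSmoothAt.prod fun i _ => hA _ _)

/-- Cramer's rule: each entry is a determinant with smooth entries divided by the nonvanishing
determinant. -/
theorem fnSmoothAt_inv {κ : Type*} [Fintype κ] [DecidableEq κ] {A : M → Matrix κ κ ℂ}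
    (hA : ∀ i j, FnSmoothAt (E := E) (fun y => A y i j) x) (h0 : (A x).det ≠ 0) (i j : κ) :
    FnSmoothAt (E := E) (fun y => (A y)⁻¹ i j) x := by
  simp only [Matrix.inv_def, Matrix.smul_apply, Ring.inverse_eq_inv', smul_eq_mul,
    Matrix.adjugate_apply]
  refine FnSmoothAt.mul (FnSmoothAt.inv (fnSmoothAt_det hA) h0) (fnSmoothAt_det fun k l => ?_)
  by_cases hk : k = j
  · subst hk
    simp only [Matrix.updateRow_self]
    exact contMDiffAt_const
  · simp only [Matrix.updateRow_ne hk]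
    exact hA k l

/-- A left inverse at `x₀` alone is extended with constant coefficients in the chart, then corrected
by the inverse of the matrix of its values on `e`, which is the identity at `x₀`. The fields `e`
need not span the tangent space, so `ψ` involves a choice away from their span. -/
theorem exists_dual_frame {κ : Type*} [Fintype κ] {e : κ → ∀ x : M, CT E x}
    (he : ∀ k, ∀ᶠ y in 𝓝 x₀, SmoothAt (e k) y) (hli : LinearIndependent ℂ fun k => e k x₀) :
    ∃ ψ : κ → ∀ x : M, CT E x →ₗ[ℂ] ℂ, ∀ᶠ y in 𝓝 x₀,
      (∀ k (c : κ → ℂ), ψ k y (∑ j, c j • e j y) = c k) ∧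
      ∀ k V, SmoothAt V y → FnSmoothAt (E := E) (fun y => ψ k y (V y)) y := by
  classical
  obtain ⟨p, hp⟩ := LinearMap.exists_leftInverse_of_injective
    (Fintype.linearCombination ℂ fun k => e k x₀)
    (LinearMap.ker_eq_bot.2 (linearIndependent_iff_injective_fintypeLinearCombination.1 hli))
  let q : ∀ x : M, CT E x →ₗ[ℂ] (κ → ℂ) := fun x =>
    ∑ i, (chartCoord E x₀ i x).smulRight (p (chartFrame E x₀ i x₀))
  have hxs := mem_chart_source E x₀
  have hq0 : q x₀ = p := by
    ext v k
    conv_rhs => rw [← sum_chartCoord_smul hxs v]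
    simp [q]
  have hqs : ∀ y ∈ (chartAt E x₀).source, ∀ V k, SmoothAt V y →
      FnSmoothAt (E := E) (fun y => q y (V y) k) y := fun y hy V k hV => by
    simp only [q, LinearMap.sum_apply, Finset.sum_apply, LinearMap.smulRight_apply, Pi.smul_apply,
      smul_eq_mul]
    exact FnSmoothAt.sum fun i _ => FnSmoothAt.mul (hV.chartCoord i hy) contMDiffAt_const
  let A : M → Matrix κ κ ℂ := fun x => Matrix.of fun k j => q x (e j x) k
  have hA0 : A x₀ = 1 := by
    ext k j
    have h1 : p (e j x₀) = Pi.single j 1 := by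
      have := LinearMap.congr_fun hp (Pi.single j 1)
      simpa using this
    simp [A, hq0, h1, Matrix.one_apply, Pi.single_apply]
  have hAs : ∀ᶠ y in 𝓝 x₀, ∀ i j, FnSmoothAt (E := E) (fun y => A y i j) y := by
    filter_upwards [(chartAt E x₀).open_source.mem_nhds hxs, eventually_all.2 he] with y hy hey i j
    exact hqs y hy _ _ (hey j)
  have hdet : ∀ᶠ y in 𝓝 x₀, (A y).det ≠ 0 :=
    (fnSmoothAt_det hAs.self_of_nhds).continuousAt.eventually_ne (by simp [hA0])
  refine ⟨fun k x => ∑ l, (A x)⁻¹ k l • (LinearMap.proj l).comp (q x), ?_⟩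
  filter_upwards [(chartAt E x₀).open_source.mem_nhds hxs, hAs, hdet] with y hy hAy hdy
  constructor
  · intro k c
    have hδ : ∀ j, (∑ l, (A y)⁻¹ k l • (LinearMap.proj l).comp (q y)) (e j y)
        = if k = j then 1 else 0 := fun j => by
      have := congrFun (congrFun (Matrix.nonsing_inv_mul (A y) (isUnit_iff_ne_zero.2 hdy)) k) j
      rw [Matrix.mul_apply, Matrix.one_apply] at this
      simpa [A] using this
    simp only [map_sum, map_smul, hδ, smul_eq_mul, mul_ite, mul_one, mul_zero]
    rw [Finset.sum_ite_eq, if_pos (Finset.mem_univ k)]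
  · intro k V hV
    simp only [LinearMap.sum_apply, LinearMap.smul_apply, LinearMap.comp_apply,
      LinearMap.proj_apply, smul_eq_mul]
    exact FnSmoothAt.sum fun l _ => FnSmoothAt.mul (fnSmoothAt_inv hAy hdy k l)
      (hqs y hy V l hV)

/-- Near `x`, the vector fields `e k` form a smooth frame of `P`. -/
def IsFrameAt {κ : Type*} (P : ∀ x : M, Submodule ℂ (CT E x)) (e : κ → ∀ x : M, CT E x)
    (x : M) : Prop :=
  ∀ᶠ y in 𝓝 x, (∀ k, SmoothAt (e k) y) ∧ LinearIndependent ℂ (fun k => e k y) ∧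
    Submodule.span ℂ (range fun k => e k y) = P y

theorem IsSmoothSubbundle.exists_frame (hP : IsSmoothSubbundle P) (x : M) :
    ∃ (n : ℕ) (e : Fin n → ∀ x : M, CT E x), IsFrameAt P e x := by
  obtain ⟨U, hU, hx, n, e, he, h⟩ := hP x
  refine ⟨n, e, ?_⟩
  filter_upwards [hU.mem_nhds hx] with y hy
  exact ⟨fun k => (he k).smoothAt hU hy, h y hy⟩

namespace IsFrameAt

variable {κ : Type*} {e : κ → ∀ x : M, CT E x}

theorem smoothAt (he : IsFrameAt P e x) (k : κ) : SmoothAt (e k) x := he.self_of_nhds.1 k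

theorem isSectionAt (he : IsFrameAt P e x) (k : κ) : IsSectionAt P (e k) x := by
  filter_upwards [he] with y hy
  exact ⟨hy.1 k, hy.2.2 ▸ Submodule.subset_span ⟨k, rfl⟩⟩

theorem exists_coeff [Fintype κ] (he : IsFrameAt P e x) (hV : IsSectionAt P V x) :
    ∃ c : κ → M → ℂ, (∀ k, ∀ᶠ y in 𝓝 x, FnSmoothAt (E := E) (c k) y) ∧
      ∀ᶠ y in 𝓝 x, V y = (∑ k, c k • e k) y := by
  obtain ⟨ψ, hψ⟩ := exists_dual_frame (fun k => he.mono fun y hy => hy.1 k) he.self_of_nhds.2.1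
  refine ⟨fun k y => ψ k y (V y), fun k => ?_, ?_⟩
  · filter_upwards [hψ, hV] with y h1 h2
    exact h1.2 k V h2.1
  · filter_upwards [hψ, hV, he] with y h1 h2 h3
    have h4 := h2.2
    rw [← h3.2.2, Submodule.mem_span_range_iff_exists_fun] at h4
    obtain ⟨c, hc⟩ := h4
    rw [Finset.sum_apply]
    simp only [Pi.smul_apply', ← hc, h1.1]

theorem conj [Fintype κ] (he : IsFrameAt P e x) :
    IsFrameAt (fun y => conjSub (P y)) (fun k y => Cx.conj (e k y)) x := by
  filter_upwards [he] with y ⟨h1, h2, h3⟩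
  have hsum : ∀ c : κ → ℂ, ∑ k, c k • Cx.conj (e k y)
      = Cx.conj (∑ k, starRingEnd ℂ (c k) • e k y) := fun c => by
    rw [map_sum]
    exact Finset.sum_congr rfl fun k _ => by rw [LinearMap.map_smulₛₗ, Complex.conj_conj]
  refine ⟨fun k => (h1 k).conj, Fintype.linearIndependent_iff.2 fun c hc k => ?_, ?_⟩
  · rw [hsum] at hc
    have h4 := congrArg Cx.conj hc
    rw [conj_conj, map_zero] at h4
    simpa using Fintype.linearIndependent_iff.1 h2 _ h4 k
  · ext v
    rw [mem_conjSub, ← h3, Submodule.mem_span_range_iff_exists_fun,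
      Submodule.mem_span_range_iff_exists_fun]
    constructor
    · rintro ⟨c, rfl⟩
      exact ⟨fun k => starRingEnd ℂ (c k), by rw [hsum, conj_conj]⟩
    · rintro ⟨c, hc⟩
      exact ⟨fun k => starRingEnd ℂ (c k), by rw [hsum]; simp [hc]⟩

theorem sumElim {κ' : Type*} {e' : κ' → ∀ x : M, CT E x} (he : IsFrameAt P e x)
    (he' : IsFrameAt Q e' x) (h : ∀ᶠ y in 𝓝 x, P y ⊓ Q y = ⊥) :
    IsFrameAt (fun y => P y ⊔ Q y) (Sum.elim e e') x := by
  filter_upwards [he, he', h] with y ⟨h1, h2, h3⟩ ⟨h1', h2', h3'⟩ h4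
  have hf : (fun k => Sum.elim e e' k y) = Sum.elim (fun k => e k y) (fun k => e' k y) := by
    ext (k | k) <;> rfl
  rw [hf]
  refine ⟨fun k => ?_, h2.sum_type h2' ?_, ?_⟩
  · rcases k with k | k
    exacts [h1 k, h1' k]
  · rw [h3, h3', disjoint_iff]
    exact h4
  · rw [Sum.elim_range, Submodule.span_union, h3, h3']

/-- Expanding `V` in the frame, the Leibniz rule yields multiples of the brackets of the frame
fields and multiples of the frame fields themselves; `hQ` takes care of the latter. -/
theorem bracket_mem [Fintype κ] (he : IsFrameAt Q e x) (hQ : Q x ≤ P x)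
    (h : ∀ k, bracket (e k) W x ∈ P x) (hV : IsSectionAt Q V x) : bracket V W x ∈ P x := by
  obtain ⟨c, hc, hVc⟩ := he.exists_coeff hV
  rw [bracket_congr hVc (Eventually.of_forall fun _ => rfl), bracket_swap,
    bracket_sum_right fun k _ => (he.smoothAt k).smul (hc k).self_of_nhds]
  refine neg_mem (sum_mem fun k _ => ?_)
  rw [bracket_smul_right (hc k).self_of_nhds (he.smoothAt k)]
  refine add_mem (Submodule.smul_mem _ _ (hQ (he.isSectionAt k).mem)) (Submodule.smul_mem _ _ ?_)
  rw [bracket_swap]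
  exact neg_mem (h k)

theorem bracket_mem_of_frame [Fintype κ] (he : IsFrameAt P e x)
    (h : ∀ j k, bracket (e j) (e k) x ∈ P x) (hV : IsSectionAt P V x) (hW : IsSectionAt P W x) :
    bracket V W x ∈ P x := by
  refine he.bracket_mem le_rfl (fun k => ?_) hV
  rw [bracket_swap]
  exact neg_mem (he.bracket_mem le_rfl (fun j => h j k) hW)

end IsFrameAt

/-- Two transversal smooth subbundles have local smooth projections onto the first one. -/
theorem exists_smooth_projection (hP : IsSmoothSubbundle P) (hQ : IsSmoothSubbundle Q)
    (h : ∀ y, P y ⊓ Q y = ⊥) (x : M) :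
    ∃ π : ∀ y : M, CT E y →ₗ[ℂ] CT E y, ∀ᶠ y in 𝓝 x, (∀ v ∈ P y, π y v = v) ∧
      (∀ v ∈ Q y, π y v = 0) ∧ (∀ v, π y v ∈ P y) ∧
      ∀ V, SmoothAt V y → SmoothAt (fun y => π y (V y)) y := by
  obtain ⟨n, e, he⟩ := hP.exists_frame x
  obtain ⟨m, e', he'⟩ := hQ.exists_frame x
  have hs := he.sumElim he' (Eventually.of_forall h)
  obtain ⟨ψ, hψ⟩ := exists_dual_frame (fun k => hs.mono fun y hy => hy.1 k) hs.self_of_nhds.2.1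
  have hr : ∀ y, (∀ k (c : Fin n ⊕ Fin m → ℂ), ψ k y (∑ j, c j • Sum.elim e e' j y) = c k) →
      ∀ (a : Fin n → ℂ) (b : Fin m → ℂ) i,
        ψ (Sum.inl i) y (∑ j, a j • e j y + ∑ j, b j • e' j y) = a i := fun y hy a b i => by
    have := hy (Sum.inl i) (Sum.elim a b)
    simpa [Fintype.sum_sum_type] using this
  -- The coframe dual to the joined frame reads off the `P`-coefficients. Outside `P y ⊔ Q y` the
  -- value depends on choices and nothing is claimed beyond membership in `P y`.
  refine ⟨fun y => ∑ i, (ψ (Sum.inl i) y).smulRight (e i y), ?_⟩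
  filter_upwards [he, he', hψ] with y ⟨h1, h2, h3⟩ ⟨h1', h2', h3'⟩ h4
  refine ⟨fun v hv => ?_, fun v hv => ?_, fun v => ?_, fun V hV => ?_⟩
  · rw [← h3, Submodule.mem_span_range_iff_exists_fun] at hv
    obtain ⟨c, rfl⟩ := hv
    have := hr y h4.1 c 0
    simp only [Pi.zero_apply, zero_smul, Finset.sum_const_zero, add_zero] at this
    simp only [LinearMap.sum_apply, LinearMap.smulRight_apply, this]
  · rw [← h3', Submodule.mem_span_range_iff_exists_fun] at hv
    obtain ⟨c, rfl⟩ := hv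
    have := hr y h4.1 0 c
    simp only [Pi.zero_apply, zero_smul, Finset.sum_const_zero, zero_add] at this
    simp only [LinearMap.sum_apply, LinearMap.smulRight_apply, this, zero_smul,
      Finset.sum_const_zero]
  · rw [LinearMap.sum_apply, ← h3]
    exact sum_mem fun i _ => Submodule.smul_mem _ _ (Submodule.subset_span ⟨i, rfl⟩)
  · have hs : SmoothAt (∑ i, (fun y => ψ (Sum.inl i) y (V y)) • e i) y :=
      SmoothAt.sum fun i _ => (h1 i).smul (h4.2 (Sum.inl i) V hV)
    refine hs.congr (Eventually.of_forall fun y' => ?_)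
    simp only [LinearMap.sum_apply, LinearMap.smulRight_apply, Finset.sum_apply, Pi.smul_apply']

theorem IsSmoothSubbundle.conj (hP : IsSmoothSubbundle P) :
    IsSmoothSubbundle fun x => conjSub (P x) := fun x => by
  obtain ⟨n, e, he⟩ := hP.exists_frame x
  obtain ⟨U, h, hU, hx⟩ := eventually_nhds_iff.1 he.conj
  exact ⟨U, hU, hx, n, _, fun i => smoothOn_of_smoothAt fun y hy => (h y hy).1 i,
    fun y hy => (h y hy).2⟩

end Frames

/-! ## Holomorphic frames on the base -/

section Base

variable {E : Type*} [NormedAddCommGroup E] [NormedSpace ℂ E] [FiniteDimensional ℂ E]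
  {S : Type*} [TopologicalSpace S] [ChartedSpace E S]

/-! ### From complex to real differentiability. -/

section RestrictScalars

variable {F : Type*} [NormedAddCommGroup F] [NormedSpace ℂ F] {f : S → F} {s : S}

theorem _root_.HasMFDerivAt.restrictScalars_real {f' : TangentSpace 𝓘(ℂ, E) s →L[ℂ] F}
    (h : HasMFDerivAt 𝓘(ℂ, E) 𝓘(ℂ, F) f s f') :
    HasMFDerivAt 𝓘(ℝ, E) 𝓘(ℝ, F) f s (show E →L[ℝ] F from
      ContinuousLinearMap.restrictScalars ℝ (show E →L[ℂ] F from f')) :=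
  ⟨h.1, HasFDerivWithinAt.restrictScalars ℝ h.2⟩

theorem mfderiv_real_smul (h : MDifferentiableAt 𝓘(ℂ, E) 𝓘(ℂ, F) f s) (c : ℂ) (v : E) :
    mvfderiv 𝓘(ℝ, E) f s (show E from c • v)
      = c • mvfderiv 𝓘(ℝ, E) f s v := by
  have h1 := h.hasMFDerivAt.restrictScalars_real.mfderiv
  rw [mvfderiv, h1]
  exact (show E →L[ℂ] F from mfderiv 𝓘(ℂ, E) 𝓘(ℂ, F) f s).map_smul c v

theorem _root_.ContMDiffAt.restrictScalars_real
    (h : ContMDiffAt 𝓘(ℂ, E) 𝓘(ℂ, F) ω f s) :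
    ContMDiffAt 𝓘(ℝ, E) 𝓘(ℝ, F) ∞ f s :=
  ⟨h.1, (ContDiffWithinAt.restrict_scalars ℝ h.2).of_le le_top⟩

end RestrictScalars

variable [IsManifold 𝓘(ℂ, E) ω S] {s s₀ : S}

/-- The extended charts over the real and over the complex numbers are the same function, so real
coordinate fields can serve to build holomorphic ones. -/
theorem contMDiffAt_extChartAt_complex (hs : s ∈ (chartAt E s₀).source) :
    ContMDiffAt 𝓘(ℂ, E) 𝓘(ℂ, E) ω (extChartAt 𝓘(ℝ, E) s₀) s :=
  contMDiffAt_extChartAt' (I := 𝓘(ℂ, E)) hs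

/-- `tangentJ` is multiplication by `i` under the identification of the tangent space at `s` with
the model space. The chart at `s₀` is holomorphic, so its differential commutes with `i`. -/
theorem mvfderiv_extChartAt_tangentJ (hs : s ∈ (chartAt E s₀).source)
    (v : TangentSpace 𝓘(ℝ, E) s) :
    mvfderiv 𝓘(ℝ, E) (extChartAt 𝓘(ℝ, E) s₀) s (tangentJ s v)
      = Complex.I • mvfderiv 𝓘(ℝ, E) (extChartAt 𝓘(ℝ, E) s₀) s v :=
  mfderiv_real_smul ((contMDiffAt_extChartAt_complex hs).mdifferentiableAt (by simp)) Complex.I v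

theorem chartField_I_smul (hs : s ∈ (chartAt E s₀).source) (v : E) :
    chartField E s₀ (Complex.I • v) s = tangentJ s (chartField E s₀ v s) := by
  rw [← chartField_mvfderiv_extChartAt hs (tangentJ s (chartField E s₀ v s)),
    mvfderiv_extChartAt_tangentJ hs, mvfderiv_extChartAt_chartField v hs]

/-- In chart coordinates the almost complex structure has constant coefficients: it takes the
coordinate field of `b i` to the coordinate field of `Complex.I • b i`. -/
theorem RealSmoothAt.tangentJ {X : ∀ s : S, TangentSpace 𝓘(ℝ, E) s} (hX : RealSmoothAt X s) :
    RealSmoothAt (fun s => tangentJ s (X s)) s := by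
  have hs := mem_chart_source E s
  let b := Module.finBasis ℝ E
  have hc : ∀ i, ContMDiffAt 𝓘(ℝ, E) 𝓘(ℝ, ℝ) ∞ (fun y => b.coord i
      (mvfderiv 𝓘(ℝ, E) (extChartAt 𝓘(ℝ, E) s) y (X y))) s := fun i =>
    (LinearMap.toContinuousLinearMap (b.coord i)).contMDiff.contMDiffAt.comp s
      (hX.contMDiffAt_mvfderiv (contMDiffAt_extChartAt' hs))
  have h1 : ∀ A : Finset (Fin (Module.finrank ℝ E)), RealSmoothAt (∑ i ∈ A, (fun y => b.coord i
      (mvfderiv 𝓘(ℝ, E) (extChartAt 𝓘(ℝ, E) s) y (X y))) •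
        chartField E s (Complex.I • b i)) s := fun A => by
    induction A using Finset.induction_on with
    | empty => simpa using RealSmoothAt.zero
    | insert i A hi ih =>
      rw [Finset.sum_insert hi]
      exact (RealSmoothAt.smul (hc i) (realSmoothAt_chartField _ hs)).add ih
  refine (h1 Finset.univ).congr ?_
  filter_upwards [(chartAt E s).open_source.mem_nhds hs] with y hy
  rw [Finset.sum_apply]
  simp only [Pi.smul_apply', chartField_I_smul hy, ← map_smul, ← map_sum, ← chartField_sum]
  congr 1
  simp only [Module.Basis.coord_apply, Module.Basis.sum_repr]
  exact (chartField_mvfderiv_extChartAt hy _).symm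

variable {a b : ∀ s : S, CT E s}

theorem SmoothAt.map_tangentJ (ha : SmoothAt a s) :
    SmoothAt (fun s => Cx.map (NonlinearHodge.tangentJ s) (a s)) s :=
  ⟨ha.1.tangentJ, ha.2.tangentJ⟩

theorem coe_proj10 (v : CT E s) : (proj10 s v : CT E s)
    = (1 / 2 : ℂ) • (v - Complex.I • Cx.map (tangentJ s) v) := rfl

theorem coe_proj01 (v : CT E s) : (proj01 s v : CT E s)
    = (1 / 2 : ℂ) • (v + Complex.I • Cx.map (tangentJ s) v) := rfl

theorem SmoothAt.proj10 (ha : SmoothAt a s) :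
    SmoothAt (fun s => (NonlinearHodge.proj10 s (a s) : CT E s)) s :=
  (ha.sub (ha.map_tangentJ.const_smul Complex.I)).const_smul (1 / 2)

theorem SmoothAt.proj01 (ha : SmoothAt a s) :
    SmoothAt (fun s => (NonlinearHodge.proj01 s (a s) : CT E s)) s :=
  (ha.add (ha.map_tangentJ.const_smul Complex.I)).const_smul (1 / 2)

theorem map_tangentJ_of_mem_T10 {v : CT E s} (hv : v ∈ T10 E s) :
    Cx.map (tangentJ s) v = Complex.I • v := by
  rw [T10, LinearMap.mem_ker, LinearMap.sub_apply, sub_eq_zero] at hv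
  exact hv

theorem map_tangentJ_of_mem_T01 {v : CT E s} (hv : v ∈ T01 E s) :
    Cx.map (tangentJ s) v = -(Complex.I • v) := by
  have h := map_tangentJ_of_mem_T10 (mem_conjSub.1 hv)
  have h2 := congrArg Cx.conj h
  rw [Cx.conj_map, conj_conj, LinearMap.map_smulₛₗ, conj_conj, Complex.conj_I, neg_smul] at h2
  exact h2

theorem proj10_of_mem_T10 {v : CT E s} (hv : v ∈ T10 E s) : proj10 s v = ⟨v, hv⟩ := by
  apply Subtype.ext
  rw [coe_proj10, map_tangentJ_of_mem_T10 hv, smul_smul, Complex.I_mul_I]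
  module

theorem proj01_of_mem_T10 {v : CT E s} (hv : v ∈ T10 E s) : proj01 s v = 0 := by
  apply Subtype.ext
  rw [coe_proj01, map_tangentJ_of_mem_T10 hv, smul_smul, Complex.I_mul_I]
  simp

theorem proj10_of_mem_T01 {v : CT E s} (hv : v ∈ T01 E s) : proj10 s v = 0 := by
  apply Subtype.ext
  rw [coe_proj10, map_tangentJ_of_mem_T01 hv, smul_neg, smul_smul, Complex.I_mul_I]
  simp

theorem proj01_of_mem_T01 {v : CT E s} (hv : v ∈ T01 E s) : proj01 s v = ⟨v, hv⟩ := by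
  apply Subtype.ext
  rw [coe_proj01, map_tangentJ_of_mem_T01 hv, smul_neg, smul_smul, Complex.I_mul_I]
  module

theorem ext_of_mem_T10 {u v : CT E s} (hu : u ∈ T10 E s) (hv : v ∈ T10 E s) (h : u.re = v.re) :
    u = v := by
  rw [mem_T10] at hu hv
  refine Cx.ext h ?_
  rw [← neg_inj, ← hu.1, ← hv.1, h]

variable (E) in
/-- The holomorphic section of `T_S` with constant value `v` in the chart at `s₀`. -/
def holField (s₀ : S) (v : E) (s : S) : T10 E s :=
  ⟨Cx.mk (chartField E s₀ v s) (-tangentJ s (chartField E s₀ v s)), by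
    rw [mem_T10]
    simp [tangentJ_tangentJ]⟩

theorem coe_holField (hs : s ∈ (chartAt E s₀).source) (v : E) :
    (holField E s₀ v s : CT E s)
      = Cx.mk (chartField E s₀ v s) (-chartField E s₀ (Complex.I • v) s) := by
  rw [chartField_I_smul hs]
  rfl

theorem smoothAt_holField (hs : s ∈ (chartAt E s₀).source) (v : E) :
    SmoothAt (fun s => (holField E s₀ v s : CT E s)) s :=
  smoothAt_mk (realSmoothAt_chartField v hs) (realSmoothAt_chartField v hs).tangentJ.neg

theorem chartField_add (s₀ s : S) (v w : E) :
    chartField E s₀ (v + w) s = chartField E s₀ v s + chartField E s₀ w s := by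
  have := chartField_sum (x₀ := s₀) (x := s) Finset.univ ![1, 1] ![v, w]
  simpa [Fin.sum_univ_two] using this

theorem chartField_smul (s₀ s : S) (c : ℝ) (v : E) :
    chartField E s₀ (c • v) s = c • chartField E s₀ v s := by
  have := chartField_sum (x₀ := s₀) (x := s) Finset.univ ![c] ![v]
  simpa using this

theorem holField_add (s₀ s : S) (v w : E) :
    holField E s₀ (v + w) s = holField E s₀ v s + holField E s₀ w s := by
  apply Subtype.ext
  refine ext_of_mem_T10 (Subtype.prop _) (Subtype.prop _) ?_
  exact chartField_add s₀ s v w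

theorem holField_smul (hs : s ∈ (chartAt E s₀).source) (c : ℂ) (v : E) :
    holField E s₀ (c • v) s = c • holField E s₀ v s := by
  apply Subtype.ext
  refine ext_of_mem_T10 (Subtype.prop _) (Subtype.prop _) ?_
  have h : c • v = c.re • v + c.im • (Complex.I • v) := by
    conv_lhs => rw [← Complex.re_add_im c]
    rw [add_smul, mul_smul]
    rfl
  rw [h, holField_add]
  simp only [Submodule.coe_add, Submodule.coe_smul, re_add, re_smul, coe_holField hs, re_mk, im_mk,
    chartField_smul]
  module

theorem holField_sum (hs : s ∈ (chartAt E s₀).source) {ι : Type*} (A : Finset ι) (c : ι → ℂ)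
    (v : ι → E) : ∑ i ∈ A, c i • holField E s₀ (v i) s = holField E s₀ (∑ i ∈ A, c i • v i) s := by
  let L : E →ₗ[ℂ] T10 E s :=
    ⟨⟨fun v => holField E s₀ v s, holField_add s₀ s⟩, holField_smul hs⟩
  exact ((map_sum L _ A).trans (Finset.sum_congr rfl fun i _ => map_smul L _ _)).symm

theorem holField_mvfderiv (hs : s ∈ (chartAt E s₀).source) (v : T10 E s) :
    holField E s₀ (mvfderiv 𝓘(ℝ, E) (extChartAt 𝓘(ℝ, E) s₀) s v.1.re) s = v := by
  apply Subtype.ext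
  refine ext_of_mem_T10 (Subtype.prop _) (Subtype.prop _) ?_
  exact chartField_mvfderiv_extChartAt hs _

variable (E) in
/-- The holomorphic coordinate frame of `T_S` of the chart at `s₀`. -/
def holFrame (s₀ : S) (k : Fin (Module.finrank ℂ E)) : ∀ s : S, T10 E s :=
  holField E s₀ (Module.finBasis ℂ E k)

theorem isFrameAt_holFrame (hs : s ∈ (chartAt E s₀).source) :
    IsFrameAt (T10 E) (fun k s => (holFrame E s₀ k s : CT E s)) s := by
  filter_upwards [(chartAt E s₀).open_source.mem_nhds hs] with y hy
  refine ⟨fun k => smoothAt_holField hy _, ?_, le_antisymm ?_ fun v hv => ?_⟩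
  · refine Fintype.linearIndependent_iff.2 fun c hc k => ?_
    have h1 : ∑ i, c i • holField E s₀ (Module.finBasis ℂ E i) y = 0 := by
      apply Subtype.ext
      simpa [holFrame] using hc
    rw [holField_sum hy] at h1
    have h2 := congrArg (fun u : T10 E y => mvfderiv 𝓘(ℝ, E) (extChartAt 𝓘(ℝ, E) s₀) y u.1.re) h1
    have h3 : ∑ i, c i • Module.finBasis ℂ E i = 0 :=
      (mvfderiv_extChartAt_chartField _ hy).symm.trans (h2.trans (map_zero _))
    exact Fintype.linearIndependent_iff.1 (Module.finBasis ℂ E).linearIndependent c h3 k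
  · rw [Submodule.span_le]
    rintro _ ⟨k, rfl⟩
    exact Subtype.prop _
  · rw [Submodule.mem_span_range_iff_exists_fun]
    refine ⟨fun k => (Module.finBasis ℂ E).repr
      (mvfderiv 𝓘(ℝ, E) (extChartAt 𝓘(ℝ, E) s₀) y v.re) k, ?_⟩
    have h1 := holField_sum hy Finset.univ (fun k => (Module.finBasis ℂ E).repr
      (mvfderiv 𝓘(ℝ, E) (extChartAt 𝓘(ℝ, E) s₀) y v.re) k) (Module.finBasis ℂ E)
    rw [Module.Basis.sum_repr, holField_mvfderiv hy ⟨v, hv⟩] at h1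
    simpa [holFrame] using congrArg Subtype.val h1

theorem bracket_mk_chartField (hs : s ∈ (chartAt E s₀).source) (v w v' w' : E) :
    bracket (fun s => Cx.mk (chartField E s₀ v s) (chartField E s₀ w s))
      (fun s => Cx.mk (chartField E s₀ v' s) (chartField E s₀ w' s)) s = 0 := by
  simp only [bracket, re_mk, im_mk]
  change Cx.mk (mlieBracket 𝓘(ℝ, E) (chartField E s₀ v) (chartField E s₀ v') s
      - mlieBracket 𝓘(ℝ, E) (chartField E s₀ w) (chartField E s₀ w') s)
      (mlieBracket 𝓘(ℝ, E) (chartField E s₀ v) (chartField E s₀ w') s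
      + mlieBracket 𝓘(ℝ, E) (chartField E s₀ w) (chartField E s₀ v') s) = 0
  simp only [mlieBracket_chartField _ _ hs]
  ext <;> simp

/-- Near `s` the imaginary part is a constant field of the chart too, so the brackets of these
fields and their conjugates reduce to brackets of constant coordinate fields and vanish. -/
theorem holField_eventually (hs : s ∈ (chartAt E s₀).source) (v : E) :
    ∀ᶠ y in 𝓝 s, (holField E s₀ v y : CT E y)
      = Cx.mk (chartField E s₀ v y) (chartField E s₀ (-(Complex.I • v)) y) := by
  filter_upwards [(chartAt E s₀).open_source.mem_nhds hs] with y hy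
  rw [coe_holField hy, ← neg_one_smul ℝ (Complex.I • v), chartField_smul, neg_one_smul]

theorem conj_holField_eventually (hs : s ∈ (chartAt E s₀).source) (v : E) :
    ∀ᶠ y in 𝓝 s, Cx.conj (holField E s₀ v y : CT E y)
      = Cx.mk (chartField E s₀ v y) (chartField E s₀ (Complex.I • v) y) := by
  filter_upwards [(chartAt E s₀).open_source.mem_nhds hs] with y hy
  rw [coe_holField hy]
  ext <;> simp

theorem bracket_holField_holField (hs : s ∈ (chartAt E s₀).source) (v w : E) :
    bracket (fun s => (holField E s₀ v s : CT E s)) (fun s => (holField E s₀ w s : CT E s)) s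
      = 0 := by
  rw [bracket_congr (holField_eventually hs v) (holField_eventually hs w)]
  exact bracket_mk_chartField hs _ _ _ _

theorem bracket_conj_holField_holField (hs : s ∈ (chartAt E s₀).source) (v w : E) :
    bracket (fun s => Cx.conj (holField E s₀ v s : CT E s))
      (fun s => (holField E s₀ w s : CT E s)) s = 0 := by
  rw [bracket_congr (conj_holField_eventually hs v) (holField_eventually hs w)]
  exact bracket_mk_chartField hs _ _ _ _

theorem bracket_conj_holField_conj_holField (hs : s ∈ (chartAt E s₀).source) (v w : E) :
    bracket (fun s => Cx.conj (holField E s₀ v s : CT E s))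
      (fun s => Cx.conj (holField E s₀ w s : CT E s)) s = 0 := by
  rw [bracket_congr (conj_holField_eventually hs v) (conj_holField_eventually hs w)]
  exact bracket_mk_chartField hs _ _ _ _

theorem smoothAt_holFrame (hs : s ∈ (chartAt E s₀).source) (k : Fin (Module.finrank ℂ E)) :
    SmoothAt (fun s => (holFrame E s₀ k s : CT E s)) s :=
  smoothAt_holField hs _

theorem mvfderiv_extChartAt_complex (hs : s ∈ (chartAt E s₀).source) (v : E) :
    mvfderiv 𝓘(ℂ, E) (extChartAt 𝓘(ℂ, E) s₀) s v
      = mvfderiv 𝓘(ℝ, E) (extChartAt 𝓘(ℝ, E) s₀) s v := by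
  have h := ((contMDiffAt_extChartAt_complex hs).mdifferentiableAt
    (by simp)).hasMFDerivAt.restrictScalars_real.mfderiv
  rw [mvfderiv, mvfderiv, h]
  rfl

/-- On the chart domain the real part is the pullback of a constant field along the chart over the
complex numbers, which is analytic. -/
theorem holomorphicOn_holField (s₀ : S) (v : E) :
    HolomorphicOn (holField E s₀ v) (chartAt E s₀).source := by
  intro s hs
  refine ContMDiffAt.contMDiffWithinAt ?_
  have h1 : ContMDiffAt 𝓘(ℂ, E) 𝓘(ℂ, E).tangent ω
      (fun s => (⟨s, mpullback 𝓘(ℂ, E) 𝓘(ℂ, E) (extChartAt 𝓘(ℂ, E) s₀) (fun _ => v) s⟩ :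
        TangentBundle 𝓘(ℂ, E) S)) s := by
    refine ContMDiffAt.mpullback_vectorField_preimage (n := ω) ?_ (contMDiffAt_extChartAt' hs)
      (isInvertible_mfderiv_extChartAt (by simpa using hs)) le_rfl
    exact contMDiffAt_vectorSpace_iff_contDiffAt.2 contDiffAt_const
  refine h1.congr_of_eventuallyEq ?_
  filter_upwards [(chartAt E s₀).open_source.mem_nhds hs] with y hy
  have h2 := (isInvertible_mfderiv_extChartAt (I := 𝓘(ℂ, E)) (x := s₀) (y := y)
    (by simpa using hy)).self_apply_inverse v
  have h3 := mvfderiv_extChartAt_complex hy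
    (mpullback 𝓘(ℂ, E) 𝓘(ℂ, E) (extChartAt 𝓘(ℂ, E) s₀) (fun _ => v) y)
  have h4 := chartField_mvfderiv_extChartAt hy
    (mpullback 𝓘(ℂ, E) 𝓘(ℂ, E) (extChartAt 𝓘(ℂ, E) s₀) (fun _ => v) y)
  rw [← h3] at h4
  have h5 : (holField E s₀ v y : CT E y).re
      = mpullback 𝓘(ℂ, E) 𝓘(ℂ, E) (extChartAt 𝓘(ℂ, E) s₀) (fun _ => v) y := by
    refine Eq.trans ?_ h4
    exact congrArg (fun w => chartField E s₀ w y) h2.symm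
  exact congrArg _ h5

theorem contMDiffAt_mvfderiv_complex {F : Type*} [NormedAddCommGroup F] [NormedSpace ℂ F]
    {f : S → F} {X : ∀ s : S, TangentSpace 𝓘(ℂ, E) s}
    (hX : ContMDiffAt 𝓘(ℂ, E) 𝓘(ℂ, E).tangent ω
      (fun s => (⟨s, X s⟩ : TangentBundle 𝓘(ℂ, E) S)) s)
    (hf : ContMDiffAt 𝓘(ℂ, E) 𝓘(ℂ, F) ω f s) :
    ContMDiffAt 𝓘(ℂ, E) 𝓘(ℂ, F) ω (fun y => mvfderiv 𝓘(ℂ, E) f y (X y)) s := by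
  have h1 : ContMDiffAt 𝓘(ℂ, E) 𝓘(ℂ, E →L[ℂ] F) ω
      (inTangentCoordinates 𝓘(ℂ, E) 𝓘(ℂ, F) id f (mfderiv 𝓘(ℂ, E) 𝓘(ℂ, F) f) s) s :=
    hf.mfderiv_const le_rfl
  have h2 := ContMDiffAt.clm_apply_of_inCoordinates h1 hX hf
  have h3 := Bundle.contMDiffAt_totalSpace.1 h2
  refine h3.2.congr_of_eventuallyEq (Eventually.of_forall fun y => ?_)
  simp [mvfderiv]
  rfl

theorem exists_holomorphic_coeff {a : ∀ s : S, T10 E s} {W : Set S} (hW : IsOpen W)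
    (ha : HolomorphicOn a W) (hs : s ∈ W) :
    ∃ c : Fin (Module.finrank ℂ E) → S → ℂ,
      (∀ k, ∀ᶠ y in 𝓝 s, ContMDiffAt 𝓘(ℂ, E) 𝓘(ℂ, ℂ) ω (c k) y) ∧
      ∀ᶠ y in 𝓝 s, (a y : CT E y)
        = (∑ k, c k • fun y => (holFrame E s k y : CT E y)) y := by
  have hn : ∀ᶠ y in 𝓝 s, y ∈ W ∧ y ∈ (chartAt E s).source :=
    Filter.Eventually.and (hW.mem_nhds hs)
      ((chartAt E s).open_source.mem_nhds (mem_chart_source E s))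
  refine ⟨fun k y => (Module.finBasis ℂ E).coord k
    (mvfderiv 𝓘(ℂ, E) (extChartAt 𝓘(ℂ, E) s) y (show E from (a y).1.re)), fun k => ?_, ?_⟩
  · filter_upwards [hn] with y hy
    exact (LinearMap.toContinuousLinearMap
      ((Module.finBasis ℂ E).coord k)).contMDiff.contMDiffAt.comp y
      (contMDiffAt_mvfderiv_complex ((ha y hy.1).contMDiffAt (hW.mem_nhds hy.1))
        (contMDiffAt_extChartAt' hy.2))
  · filter_upwards [hn] with y hy
    have h1 := holField_sum hy.2 Finset.univ (fun k => (Module.finBasis ℂ E).coord k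
      (mvfderiv 𝓘(ℂ, E) (extChartAt 𝓘(ℂ, E) s) y (show E from (a y).1.re)))
      (Module.finBasis ℂ E)
    simp only [Module.Basis.coord_apply] at h1
    rw [Module.Basis.sum_repr] at h1
    rw [Finset.sum_apply]
    have h2 := congrArg Subtype.val (h1.trans ((congrArg (fun w => holField E s w y)
      (mvfderiv_extChartAt_complex hy.2 (show E from (a y).1.re))).trans
        (holField_mvfderiv hy.2 (a y))))
    rw [← h2]
    simp [holFrame]

theorem HolomorphicOn.smoothOn {a : ∀ s : S, T10 E s} {W : Set S} (hW : IsOpen W)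
    (ha : HolomorphicOn a W) : SmoothOn (fun s => (a s : CT E s)) W :=
  smoothOn_of_smoothAt fun s hs => by
    obtain ⟨c, hc, hac⟩ := exists_holomorphic_coeff hW ha hs
    refine SmoothAt.congr (SmoothAt.sum fun k _ => ?_) hac
    exact (smoothAt_holField (mem_chart_source E s) _).smul
      (hc k).self_of_nhds.restrictScalars_real

/-- The conjugate coordinate fields commute with the holomorphic frame, and by the Cauchy–Riemann
equations they kill the holomorphic coefficients of `a` in that frame. -/
theorem HolomorphicOn.bracket_conj_holField {a : ∀ s : S, T10 E s} {W : Set S} (hW : IsOpen W)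
    (ha : HolomorphicOn a W) (hs : s ∈ W) (v : E) :
    bracket (fun y => Cx.conj (holField E s v y : CT E y)) (fun y => (a y : CT E y)) s = 0 := by
  have hss := mem_chart_source E s
  obtain ⟨c, hc, hac⟩ := exists_holomorphic_coeff hW ha hs
  have hcs := fun k => (hc k).self_of_nhds.restrictScalars_real
  rw [bracket_congr (Eventually.of_forall fun _ => rfl) hac, bracket_sum_right fun k _ =>
    (smoothAt_holFrame hss k).smul (hcs k)]
  refine Finset.sum_eq_zero fun k _ => ?_
  rw [bracket_smul_right (hcs k) (smoothAt_holFrame hss k)]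
  have h1 := bracket_conj_holField_holField hss v (Module.finBasis ℂ E k)
  have h2 : cderiv (fun y => Cx.conj (holField E s v y : CT E y)) (c k) s = 0 := by
    rw [cderiv, (conj_holField_eventually hss v).self_of_nhds, re_mk, im_mk, chartField_I_smul hss]
    have h3 := mfderiv_real_smul ((hc k).self_of_nhds.mdifferentiableAt (by simp)) Complex.I
      (chartField E s v s)
    -- Complex linearity of the differential `d` of the coefficient: `d(v) + i d(i v) = d(v) + i²
    -- d(v) = 0`.
    refine (congrArg (fun t => _ + Complex.I * t) h3).trans ?_
    rw [smul_eq_mul, ← mul_assoc, Complex.I_mul_I]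
    ring
  rw [h2, zero_smul, zero_add]
  exact (congrArg _ h1).trans (smul_zero _)

end Base

/-! ## Projectable vector fields, lifts, and fiberwise holomorphic fields -/

section Bundle

variable {E EZ EF : Type*} [NormedAddCommGroup E] [NormedSpace ℂ E] [FiniteDimensional ℂ E]
  [NormedAddCommGroup EZ] [NormedSpace ℝ EZ] [FiniteDimensional ℝ EZ]
  [NormedAddCommGroup EF] [NormedSpace ℝ EF]
  {S Z : Type*} [TopologicalSpace S] [ChartedSpace E S]
  [TopologicalSpace Z] [ChartedSpace EZ Z]
  [IsManifold 𝓘(ℂ, E) ω S] [IsManifold 𝓘(ℝ, EZ) ∞ Z] {α : Z → S}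

section Projectable

variable {z : Z} {X Y : ∀ z : Z, CT EZ z} {a b : ∀ s : S, CT E s}

theorem bracket_related (hα : ContMDiffAt 𝓘(ℝ, EZ) 𝓘(ℝ, E) ∞ α z) (hX : SmoothAt X z)
    (hY : SmoothAt Y z) (ha : SmoothAt a (α z)) (hb : SmoothAt b (α z))
    (hXa : ∀ᶠ y in 𝓝 z, dC E EZ α y (X y) = a (α y))
    (hYb : ∀ᶠ y in 𝓝 z, dC E EZ α y (Y y) = b (α y)) :
    dC E EZ α z (bracket X Y z) = bracket a b (α z) := by
  have x1 := hXa.mono fun y hy => congrArg Cx.re hy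
  have x2 := hXa.mono fun y hy => congrArg Cx.im hy
  have y1 := hYb.mono fun y hy => congrArg Cx.re hy
  have y2 := hYb.mono fun y hy => congrArg Cx.im hy
  ext
  · refine (map_sub (mfderiv 𝓘(ℝ, EZ) 𝓘(ℝ, E) α z) _ _).trans ?_
    rw [mlieBracket_related hα hX.1 hY.1 ha.1 hb.1 x1 y1,
      mlieBracket_related hα hX.2 hY.2 ha.2 hb.2 x2 y2]
    rfl
  · refine (map_add (mfderiv 𝓘(ℝ, EZ) 𝓘(ℝ, E) α z) _ _).trans ?_
    rw [mlieBracket_related hα hX.1 hY.2 ha.1 hb.2 x1 y2,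
      mlieBracket_related hα hX.2 hY.1 ha.2 hb.1 x2 y1]
    rfl

/-- A vertical field is related to the zero field of the base, whose brackets vanish. -/
theorem dC_bracket_vertical (hα : ContMDiffAt 𝓘(ℝ, EZ) 𝓘(ℝ, E) ∞ α z) (hX : SmoothAt X z)
    (hY : SmoothAt Y z) (hb : SmoothAt b (α z))
    (hX0 : ∀ᶠ y in 𝓝 z, dC E EZ α y (X y) = 0)
    (hYb : ∀ᶠ y in 𝓝 z, dC E EZ α y (Y y) = b (α y)) :
    dC E EZ α z (bracket X Y z) = 0 := by
  rw [bracket_related hα hX hY (a := 0) SmoothAt.zero hb hX0 hYb, bracket_swap,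
    bracket_zero_right, neg_zero]

theorem cderiv_comp {g : S → ℂ} (hα : ContMDiffAt 𝓘(ℝ, EZ) 𝓘(ℝ, E) ∞ α z)
    (hg : FnSmoothAt (E := E) g (α z)) (X : ∀ z : Z, CT EZ z) :
    cderiv X (g ∘ α) z = mvfderiv 𝓘(ℝ, E) g (α z) (dC E EZ α z (X z)).re
      + Complex.I * mvfderiv 𝓘(ℝ, E) g (α z) (dC E EZ α z (X z)).im := by
  have h : ∀ v, mvfderiv 𝓘(ℝ, EZ) (g ∘ α) z v
      = mvfderiv 𝓘(ℝ, E) g (α z) (mfderiv 𝓘(ℝ, EZ) 𝓘(ℝ, E) α z v) := fun v =>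
    mfderiv_comp_apply z (hg.mdifferentiableAt (by simp)) (hα.mdifferentiableAt (by simp)) v
  rw [cderiv, h, h]
  rfl

theorem cderiv_comp_related {g : S → ℂ} (hα : ContMDiffAt 𝓘(ℝ, EZ) 𝓘(ℝ, E) ∞ α z)
    (hg : FnSmoothAt (E := E) g (α z)) (hX : dC E EZ α z (X z) = a (α z)) :
    cderiv X (g ∘ α) z = cderiv a g (α z) := by
  rw [cderiv_comp hα hg, hX, cderiv]

theorem cderiv_comp_vertical {g : S → ℂ} (hα : ContMDiffAt 𝓘(ℝ, EZ) 𝓘(ℝ, E) ∞ α z)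
    (hg : FnSmoothAt (E := E) g (α z)) (hX : dC E EZ α z (X z) = 0) :
    cderiv X (g ∘ α) z = 0 := by
  rw [cderiv_comp hα hg, hX]
  simp

end Projectable

/-! ### Functions and fields that vanish along one fibre. -/

section Fiber

variable {F : Type*} [TopologicalSpace F] [ChartedSpace EF F]

/-- In a trivialization, freezing the base coordinate at `α z` gives a map `g` into the fibre
through `z` that fixes `z` and whose differential fixes vertical vectors. Since `f ∘ g` vanishes
near `z`, so does the derivative of `f` along `v`, the image of `v` under the differential of `g`.
-/
theorem mvfderiv_eq_zero_of_fiber {G : Type*} [NormedAddCommGroup G] [NormedSpace ℝ G]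
    (hα : IsSmoothFiberBundle E EZ EF F α) {f : Z → G} {z : Z}
    (hf : MDifferentiableAt 𝓘(ℝ, EZ) 𝓘(ℝ, G) f z) (h0 : ∀ᶠ y in 𝓝 z, α y = α z → f y = 0)
    {v : TangentSpace 𝓘(ℝ, EZ) z} (hv : mfderiv 𝓘(ℝ, EZ) 𝓘(ℝ, E) α z v = 0) :
    mvfderiv 𝓘(ℝ, EZ) f z v = 0 := by
  obtain ⟨e, hes, he, he'⟩ := hα.2 (α z)
  have hz : z ∈ e.source := e.mem_source.2 hes
  have hez : ContMDiffAt 𝓘(ℝ, EZ) (𝓘(ℝ, E).prod 𝓘(ℝ, EF)) ∞ e z :=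
    he.contMDiffAt (e.open_source.mem_nhds hz)
  have he1 : MDifferentiableAt 𝓘(ℝ, EZ) 𝓘(ℝ, EF) (fun y => (e y).2) z :=
    (contMDiff_snd.contMDiffAt.comp z hez).mdifferentiableAt (by simp)
  have he2 : MDifferentiableAt 𝓘(ℝ, EZ) 𝓘(ℝ, E) (fun y => (e y).1) z :=
    (contMDiff_fst.contMDiffAt.comp z hez).mdifferentiableAt (by simp)
  have hs : MDifferentiableAt (𝓘(ℝ, E).prod 𝓘(ℝ, EF)) 𝓘(ℝ, EZ)
      e.toOpenPartialHomeomorph.symm (e z) :=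
    (he'.contMDiffAt (e.open_target.mem_nhds (e.map_source hz))).mdifferentiableAt (by simp)
  have hfst : (fun y => (e y).1) =ᶠ[𝓝 z] α := by
    filter_upwards [e.open_source.mem_nhds hz] with y hy using e.coe_fst hy
  have hez1 : (e z).1 = α z := e.coe_fst hz
  set p : Z → S × F := fun y => (α z, (e y).2) with hp
  have hpz : p z = e z := Prod.ext hez1.symm rfl
  have hpd : MDifferentiableAt 𝓘(ℝ, EZ) (𝓘(ℝ, E).prod 𝓘(ℝ, EF)) p z :=
    mdifferentiableAt_const.prodMk he1
  -- `p` and `e` differ only in the base component, whose derivative along the vertical vector `v`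
  -- is zero.
  have hdp : mfderiv 𝓘(ℝ, EZ) (𝓘(ℝ, E).prod 𝓘(ℝ, EF)) p z v
      = mfderiv 𝓘(ℝ, EZ) (𝓘(ℝ, E).prod 𝓘(ℝ, EF)) e z v := by
    have h1 := (mdifferentiableAt_const (c := α z) (I := 𝓘(ℝ, EZ)) (I' := 𝓘(ℝ, E))
      (x := z)).mfderiv_prod he1
    have h2 := he2.mfderiv_prod he1
    have h3 : mfderiv 𝓘(ℝ, EZ) 𝓘(ℝ, E) (fun y => (e y).1) z v = 0 := by
      rw [hfst.mfderiv_eq]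
      exact hv
    refine (congrArg (fun L => L v) h1).trans (Eq.trans ?_ (congrArg (fun L => L v) h2).symm)
    refine Prod.ext ?_ rfl
    refine Eq.trans ?_ h3.symm
    rw [mfderiv_const]
    rfl
  have hs' : MDifferentiableAt (𝓘(ℝ, E).prod 𝓘(ℝ, EF)) 𝓘(ℝ, EZ)
      e.toOpenPartialHomeomorph.symm (p z) := by rw [hpz]; exact hs
  set g : Z → Z := e.toOpenPartialHomeomorph.symm ∘ p with hg
  have hgz : g z = z := by
    rw [hg, Function.comp_apply, hpz]
    exact e.toOpenPartialHomeomorph.left_inv hz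
  have hgd : MDifferentiableAt 𝓘(ℝ, EZ) 𝓘(ℝ, EZ) g z := hs'.comp z hpd
  have hdg : mfderiv 𝓘(ℝ, EZ) 𝓘(ℝ, EZ) g z v = v := by
    have h1 := mfderiv_comp_apply z hs' hpd v
    have h2 := mfderiv_comp_apply z hs (hez.mdifferentiableAt (by simp)) v
    have h3 : (e.toOpenPartialHomeomorph.symm ∘ e) =ᶠ[𝓝 z] id := by
      filter_upwards [e.open_source.mem_nhds hz] with y hy
      exact e.toOpenPartialHomeomorph.left_inv hy
    rw [hdp, hpz] at h1
    refine h1.trans (h2.symm.trans ?_)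
    rw [h3.mfderiv_eq, mfderiv_id]
    rfl
  have hfg : (f ∘ g) =ᶠ[𝓝 z] fun _ => (0 : G) := by
    have h1 : ∀ᶠ y in 𝓝 z, α (g y) = α z → f (g y) = 0 := by
      have h2 : Tendsto g (𝓝 z) (𝓝 z) := by
        have := hgd.continuousAt.tendsto
        rwa [hgz] at this
      exact h2.eventually h0
    filter_upwards [h1] with y hy
    refine hy ?_
    exact e.proj_symm_apply (e.mem_target.2 hes)
  have h1 : mfderiv 𝓘(ℝ, EZ) 𝓘(ℝ, G) (f ∘ g) z v
      = mfderiv 𝓘(ℝ, EZ) 𝓘(ℝ, G) f (g z) (mfderiv 𝓘(ℝ, EZ) 𝓘(ℝ, EZ) g z v) :=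
    mfderiv_comp_apply z (by rw [hgz]; exact hf) hgd v
  rw [hdg, hfg.mfderiv_eq, mfderiv_const, hgz] at h1
  exact h1.symm

/-- In a chart frame the bracket involves the coefficients of `W` at `z` and their derivatives along
`u z`, and both vanish. Consequently `bracket u W z`, for `u` vertical at `z`, depends on `W` only
along the fibre; this connects data given on fibres with fields on `Z`. -/
theorem bracket_eq_zero_of_fiber (hα : IsSmoothFiberBundle E EZ EF F α) {W u : ∀ z : Z, CT EZ z}
    {z : Z} (hW : SmoothAt W z) (h0 : ∀ᶠ y in 𝓝 z, α y = α z → W y = 0)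
    (hu : dC E EZ α z (u z) = 0) : bracket u W z = 0 := by
  have hzs := mem_chart_source EZ z
  have hc := fun i => hW.chartCoord i hzs
  have hWc : ∀ᶠ y in 𝓝 z, W y
      = (∑ i, (fun y => chartCoord EZ z i y (W y)) • chartFrame EZ z i) y := by
    filter_upwards [(chartAt EZ z).open_source.mem_nhds hzs] with y hy
    rw [Finset.sum_apply]
    exact (sum_chartCoord_smul hy _).symm
  rw [bracket_congr (Eventually.of_forall fun _ => rfl) hWc, bracket_sum_right fun i _ =>
    (smoothAt_chartFrame i hzs).smul (hc i)]
  refine Finset.sum_eq_zero fun i _ => ?_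
  rw [bracket_smul_right (hc i) (smoothAt_chartFrame i hzs)]
  have h1 : chartCoord EZ z i z (W z) = 0 := by rw [h0.self_of_nhds rfl, map_zero]
  have h2 : ∀ v : TangentSpace 𝓘(ℝ, EZ) z, mfderiv 𝓘(ℝ, EZ) 𝓘(ℝ, E) α z v = 0 →
      mvfderiv 𝓘(ℝ, EZ) (fun y => chartCoord EZ z i y (W y)) z v = 0 := fun v hv =>
    mvfderiv_eq_zero_of_fiber hα ((hc i).mdifferentiableAt (by simp))
      (h0.mono fun y hy h => by rw [hy h, map_zero]) hv
  rw [h1, zero_smul, add_zero, cderiv, h2 _ (congrArg Cx.re hu), h2 _ (congrArg Cx.im hu)]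
  simp

end Fiber

/-! ### The subbundles `T_rel` and `T̄_rel` -/

namespace RelComplexStructure

variable (R : RelComplexStructure E EZ α) {z : Z}

theorem dC_of_mem_T {v : CT EZ z} (hv : v ∈ R.T z) : dC E EZ α z v = 0 := by
  have : v ∈ LinearMap.ker (dC E EZ α z) := by
    rw [← R.sup_eq z]
    exact Submodule.mem_sup_left hv
  exact this

theorem dC_of_mem_bar {v : CT EZ z} (hv : v ∈ R.bar z) : dC E EZ α z v = 0 := by
  have : v ∈ LinearMap.ker (dC E EZ α z) := by
    rw [← R.sup_eq z]
    exact Submodule.mem_sup_right hv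
  exact this

theorem exists_of_dC {v : CT EZ z} (hv : dC E EZ α z v = 0) :
    ∃ t ∈ R.T z, ∃ u ∈ R.bar z, t + u = v := by
  have : v ∈ LinearMap.ker (dC E EZ α z) := hv
  rw [← R.sup_eq z] at this
  exact Submodule.mem_sup.1 this

theorem eq_zero_of_mem {v : CT EZ z} (h1 : v ∈ R.T z) (h2 : v ∈ R.bar z) : v = 0 := by
  have : v ∈ R.T z ⊓ conjSub (R.T z) := ⟨h1, h2⟩
  rwa [R.disjoint z] at this

theorem involutive_bar : IsInvolutive R.bar := R.involutive.conj

theorem smooth_bar : IsSmoothSubbundle R.bar := R.smooth.conj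

theorem conj_mem_bar {v : CT EZ z} (hv : v ∈ R.T z) : Cx.conj v ∈ R.bar z := by
  change Cx.conj (Cx.conj v) ∈ R.T z
  rwa [conj_conj]

theorem exists_projection (z : Z) : ∃ π : CT EZ z →ₗ[ℂ] CT EZ z, (∀ v ∈ R.T z, π v = v) ∧
    (∀ v ∈ R.bar z, π v = 0) ∧ ∀ v, π v ∈ R.T z := by
  obtain ⟨π, h⟩ := exists_smooth_projection R.smooth R.smooth_bar R.disjoint z
  exact ⟨π z, h.self_of_nhds.1, h.self_of_nhds.2.1, h.self_of_nhds.2.2.1⟩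

/-- The projection of the vertical vectors onto `T_rel` along `T̄_rel`. -/
def projT (z : Z) : CT EZ z →ₗ[ℂ] CT EZ z := (R.exists_projection z).choose

theorem projT_of_mem {v : CT EZ z} (hv : v ∈ R.T z) : R.projT z v = v :=
  (R.exists_projection z).choose_spec.1 v hv

theorem projT_of_mem_bar {v : CT EZ z} (hv : v ∈ R.bar z) : R.projT z v = 0 :=
  (R.exists_projection z).choose_spec.2.1 v hv

theorem projT_mem (v : CT EZ z) : R.projT z v ∈ R.T z :=
  (R.exists_projection z).choose_spec.2.2 v

theorem sub_projT_mem {v : CT EZ z} (hv : dC E EZ α z v = 0) : v - R.projT z v ∈ R.bar z := by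
  obtain ⟨t, ht, u, hu, rfl⟩ := R.exists_of_dC hv
  rw [map_add, R.projT_of_mem ht, R.projT_of_mem_bar hu, add_zero, add_sub_cancel_left]
  exact hu

theorem mkQ_projT {v : CT EZ z} (hv : dC E EZ α z v = 0) :
    (R.bar z).mkQ (R.projT z v) = (R.bar z).mkQ v := by
  rw [eq_comm, ← sub_eq_zero, ← map_sub, Submodule.mkQ_apply, Submodule.Quotient.mk_eq_zero]
  exact R.sub_projT_mem hv

/-- `projT` is chosen point by point with no regularity, but its values on vertical vectors are
forced, so there it agrees with any smooth local projection. -/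
theorem smoothAt_projT {V : ∀ z : Z, CT EZ z} (hV : ∀ᶠ y in 𝓝 z, SmoothAt V y)
    (h0 : ∀ᶠ y in 𝓝 z, dC E EZ α y (V y) = 0) :
    ∀ᶠ y in 𝓝 z, SmoothAt (fun y => R.projT y (V y)) y := by
  obtain ⟨π, h⟩ := exists_smooth_projection R.smooth R.smooth_bar R.disjoint z
  filter_upwards [hV, h, eventually_eventually_nhds.2 (h.and h0)] with y h1 h2 h3
  refine (h2.2.2.2 V h1).congr ?_
  filter_upwards [h3] with y ⟨h4, h5⟩
  obtain ⟨t, ht, u, hu, htu⟩ := R.exists_of_dC h5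
  rw [← htu, map_add, map_add, R.projT_of_mem ht, R.projT_of_mem_bar hu, h4.1 t ht, h4.2.1 u hu]

theorem proj_mkQ (v : CT EZ z) : R.proj z ((R.bar z).mkQ v) = dC E EZ α z v :=
  Submodule.liftQ_apply _ _ _

theorem mkQ_eq_iff {u v : CT EZ z} : (R.bar z).mkQ u = (R.bar z).mkQ v ↔ u - v ∈ R.bar z :=
  Submodule.Quotient.eq _

theorem preservesAt_of_section {V : ∀ z : Z, CT EZ z} (hV : IsSectionAt R.bar V z) :
    PreservesAt R.bar V z := R.involutive_bar.preservesAt hV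

end RelComplexStructure

end Bundle

/-! ## Germs of lifts -/

/-- A complex vector field is smooth on a neighbourhood of `x`. -/
def SmoothNear {E : Type*} [NormedAddCommGroup E] [NormedSpace ℝ E]
    [FiniteDimensional ℝ E] {M : Type*} [TopologicalSpace M] [ChartedSpace E M]
    [IsManifold 𝓘(ℝ, E) ∞ M] (V : ∀ x : M, CT E x) (x : M) : Prop :=
  ∀ᶠ y in 𝓝 x, SmoothAt V y

namespace SmoothNear

variable {E : Type*} [NormedAddCommGroup E] [NormedSpace ℝ E] [FiniteDimensional ℝ E]
  {M : Type*} [TopologicalSpace M] [ChartedSpace E M] [IsManifold 𝓘(ℝ, E) ∞ M]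
  {V W : ∀ x : M, CT E x} {x : M} {P : ∀ x : M, Submodule ℂ (CT E x)}

theorem smoothAt (hV : SmoothNear V x) : SmoothAt V x := hV.self_of_nhds

theorem eventually (hV : SmoothNear V x) : ∀ᶠ y in 𝓝 x, SmoothNear V y :=
  eventually_eventually_nhds.2 hV

theorem congr (hV : SmoothNear V x) (h : ∀ᶠ y in 𝓝 x, W y = V y) : SmoothNear W x := by
  filter_upwards [hV, eventually_eventually_nhds.2 h] with y h1 h2 using h1.congr h2

theorem add (hV : SmoothNear V x) (hW : SmoothNear W x) : SmoothNear (V + W) x := by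
  filter_upwards [hV, hW] with y h1 h2 using h1.add h2

theorem sub (hV : SmoothNear V x) (hW : SmoothNear W x) : SmoothNear (V - W) x := by
  filter_upwards [hV, hW] with y h1 h2 using h1.sub h2

theorem const_smul (c : ℂ) (hV : SmoothNear V x) : SmoothNear (c • V) x := by
  filter_upwards [hV] with y h1 using h1.const_smul c

theorem conj (hV : SmoothNear V x) : SmoothNear (fun y => Cx.conj (V y)) x := by
  filter_upwards [hV] with y h1 using h1.conj

theorem bracket (hV : SmoothNear V x) (hW : SmoothNear W x) : SmoothNear (bracket V W) x := by
  filter_upwards [hV, hW] with y h1 h2 using h1.bracket h2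

theorem isSectionAt (hV : SmoothNear V x) (h : ∀ᶠ y in 𝓝 x, V y ∈ P y) : IsSectionAt P V x :=
  hV.and h

theorem exists_isOpen (hV : SmoothNear V x) : ∃ U : Set M, IsOpen U ∧ x ∈ U ∧ SmoothOn V U := by
  obtain ⟨U, hU, ho, hx⟩ := eventually_nhds_iff.1 hV
  exact ⟨U, ho, hx, smoothOn_of_smoothAt hU⟩

end SmoothNear

theorem IsSectionAt.smoothNear {E : Type*} [NormedAddCommGroup E] [NormedSpace ℝ E]
    [FiniteDimensional ℝ E] {M : Type*} [TopologicalSpace M] [ChartedSpace E M]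
    [IsManifold 𝓘(ℝ, E) ∞ M] {V : ∀ x : M, CT E x} {x : M}
    {P : ∀ x : M, Submodule ℂ (CT E x)} (hV : IsSectionAt P V x) : SmoothNear V x :=
  Filter.Eventually.mono hV fun _ h => h.1

section Bundle

variable {E EZ EF : Type*} [NormedAddCommGroup E] [NormedSpace ℂ E] [FiniteDimensional ℂ E]
  [NormedAddCommGroup EZ] [NormedSpace ℝ EZ] [FiniteDimensional ℝ EZ]
  [NormedAddCommGroup EF] [NormedSpace ℝ EF]
  {S Z : Type*} [TopologicalSpace S] [ChartedSpace E S]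
  [TopologicalSpace Z] [ChartedSpace EZ Z]
  [IsManifold 𝓘(ℂ, E) ω S] [IsManifold 𝓘(ℝ, EZ) ∞ Z] {α : Z → S}
  {P : ∀ s : S, Submodule ℂ (CT E s)} {z : Z} {U : Set Z}

/-- The bundle morphism `l` is smooth near `z` on local sections of `P`. -/
def LiftMap.IsSmoothAt (l : LiftMap EZ α P) (z : Z) : Prop :=
  ∀ a : ∀ s : S, P s, SmoothNear (fun s => (a s).1) (α z) →
    SmoothNear (fun y => l y (a (α y))) z

/-- The local lifting condition at the point `z`. -/
def LiftMap.IsVerticallyHolomorphicAt (R : RelComplexStructure E EZ α) (l : LiftMap EZ α P)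
    (z : Z) : Prop :=
  ∀ a : ∀ s : S, P s, SmoothNear (fun s => (a s).1) (α z) →
    PreservesAt R.bar (fun y => l y (a (α y))) z

theorem LiftMap.smoothOn_iff (hα : Continuous α) {l : LiftMap EZ α P} (hU : IsOpen U) :
    l.SmoothOn U ↔ ∀ z ∈ U, l.IsSmoothAt z := by
  constructor
  · intro h z hz a ha
    obtain ⟨W, hW, hzW, haW⟩ := ha.exists_isOpen
    exact (h W a hW haW).eventually (hU.inter (hW.preimage hα)) ⟨hz, hzW⟩
  · intro h W a hW ha
    exact smoothOn_of_smoothAt fun z hz => (h z hz.1 a (ha.eventually hW hz.2)).smoothAt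

theorem LiftMap.verticallyHolomorphicOn_iff (hα : Continuous α) {R : RelComplexStructure E EZ α}
    {l : LiftMap EZ α P} (hU : IsOpen U) :
    l.VerticallyHolomorphicOn R U ↔ ∀ z ∈ U, l.IsVerticallyHolomorphicAt R z := by
  constructor
  · intro h z hz a ha
    obtain ⟨W, hW, hzW, haW⟩ := ha.exists_isOpen
    exact (bracketPreserves_iff (hU.inter (hW.preimage hα))).1 (h W a hW haW) z ⟨hz, hzW⟩
  · intro h W a hW ha
    exact (bracketPreserves_iff (hU.inter (hW.preimage hα))).2 fun z hz =>
      h z hz.1 a (ha.eventually hW hz.2)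

/-- `l` is a smooth lift of `D` near `z`. -/
def IsLiftAt (R : RelComplexStructure E EZ α) (D : BaseMap R P) (l : LiftMap EZ α P)
    (z : Z) : Prop :=
  ∀ᶠ y in 𝓝 z, l.IsSmoothAt y ∧ ∀ ξ, (R.bar y).mkQ (l y ξ) = D y ξ

variable {R : RelComplexStructure E EZ α} {D : BaseMap R P}

theorem isSplitting_iff (hα : Continuous α) : IsSplitting R D ↔
    (∀ z ξ, R.proj z (D z ξ) = ξ.1) ∧ ∀ z, ∃ l, IsLiftAt R D l z := by
  constructor
  · intro h
    refine ⟨h.splits, fun z => ?_⟩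
    obtain ⟨U, hU, hz, l, hl⟩ := h.smooth z
    refine ⟨l, ?_⟩
    filter_upwards [hU.mem_nhds hz] with y hy
    exact ⟨(LiftMap.smoothOn_iff hα hU).1 hl.1 y hy, hl.2 y hy⟩
  · rintro ⟨h1, h2⟩
    refine ⟨h1, fun z => ?_⟩
    obtain ⟨l, hl⟩ := h2 z
    obtain ⟨U, h, hU, hz⟩ := eventually_nhds_iff.1 hl
    exact ⟨U, hU, hz, l, (LiftMap.smoothOn_iff hα hU).2 fun y hy => (h y hy).1,
      fun y hy => (h y hy).2⟩

theorem isVerticallyHolomorphic_iff (hα : Continuous α) : IsVerticallyHolomorphic R D ↔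
    ∀ z, ∃ l, IsLiftAt R D l z ∧ ∀ᶠ y in 𝓝 z, l.IsVerticallyHolomorphicAt R y := by
  constructor
  · intro h z
    obtain ⟨U, hU, hz, l, hl, hh⟩ := h z
    refine ⟨l, ?_, ?_⟩
    · filter_upwards [hU.mem_nhds hz] with y hy
      exact ⟨(LiftMap.smoothOn_iff hα hU).1 hl.1 y hy, hl.2 y hy⟩
    · filter_upwards [hU.mem_nhds hz] with y hy
      exact (LiftMap.verticallyHolomorphicOn_iff hα hU).1 hh y hy
  · intro h z
    obtain ⟨l, hl, hh⟩ := h z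
    obtain ⟨U, h, hU, hz⟩ := eventually_nhds_iff.1 (hl.and hh)
    exact ⟨U, hU, hz, l, ⟨(LiftMap.smoothOn_iff hα hU).2 fun y hy => (h y hy).1.1,
      fun y hy => (h y hy).1.2⟩,
      (LiftMap.verticallyHolomorphicOn_iff hα hU).2 fun y hy => (h y hy).2⟩

theorem IsLiftAt.eventually {l : LiftMap EZ α P} (hl : IsLiftAt R D l z) :
    ∀ᶠ y in 𝓝 z, IsLiftAt R D l y := eventually_eventually_nhds.2 hl

theorem IsLiftAt.isSmoothAt {l : LiftMap EZ α P} (hl : IsLiftAt R D l z) : l.IsSmoothAt z :=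
  hl.self_of_nhds.1

theorem dC_of_mkQ (hD : ∀ z ξ, R.proj z (D z ξ) = ξ.1) {v : CT EZ z} {ξ : P (α z)}
    (hv : (R.bar z).mkQ v = D z ξ) : dC E EZ α z v = ξ.1 := by
  rw [← R.proj_mkQ, hv, hD]

theorem IsLiftAt.dC_eq {l : LiftMap EZ α P} (hl : IsLiftAt R D l z)
    (hD : ∀ z ξ, R.proj z (D z ξ) = ξ.1) :
    ∀ᶠ y in 𝓝 z, ∀ ξ, dC E EZ α y (l y ξ) = ξ.1 :=
  hl.mono fun _ hy ξ => dC_of_mkQ hD (hy.2 ξ)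

namespace LiftMap

variable {l l' : LiftMap EZ α P}

theorem IsSmoothAt.add (hl : IsSmoothAt l z) (hl' : IsSmoothAt l' z) :
    IsSmoothAt (fun y => l y + l' y) z := fun a ha => (hl a ha).add (hl' a ha)

theorem IsSmoothAt.const_smul (c : ℂ) (hl : IsSmoothAt l z) :
    IsSmoothAt (fun y => c • l y) z := fun a ha => (hl a ha).const_smul c

theorem IsVerticallyHolomorphicAt.add (hs : IsSmoothAt l z) (hs' : IsSmoothAt l' z)
    (hl : IsVerticallyHolomorphicAt R l z) (hl' : IsVerticallyHolomorphicAt R l' z) :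
    IsVerticallyHolomorphicAt R (fun y => l y + l' y) z := fun a ha =>
  (hl a ha).add (hs a ha).smoothAt (hl' a ha) (hs' a ha).smoothAt

end LiftMap

/-! ### The automorphism `β` on germs -/

namespace BundleAut

variable {A B : RelComplexStructure E EZ α} (β : BundleAut A B)

theorem cmap_cinv (z : Z) (v : CT EZ z) : β.cmap z (β.cinv z v) = v := by
  ext <;> simp [cinv, cmap]

theorem conj_cmap (v : CT EZ z) : Cx.conj (β.cmap z v) = β.cmap z (Cx.conj v) := conj_map _ _

theorem conj_cinv (v : CT EZ z) : Cx.conj (β.cinv z v) = β.cinv z (Cx.conj v) := conj_map _ _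

theorem dC_cmap (v : CT EZ z) : dC E EZ α z (β.cmap z v) = dC E EZ α z v := by
  ext
  · exact β.base z v.re
  · exact β.base z v.im

theorem dC_cinv (v : CT EZ z) : dC E EZ α z (β.cinv z v) = dC E EZ α z v := by
  rw [← β.dC_cmap, cmap_cinv]

theorem cmap_mem_T {v : CT EZ z} (hv : v ∈ A.T z) : β.cmap z v ∈ B.T z := by
  rw [← β.map_eq z]
  exact ⟨v, hv, rfl⟩

theorem cinv_mem_T {v : CT EZ z} (hv : v ∈ B.T z) : β.cinv z v ∈ A.T z := by
  rw [← β.map_eq z] at hv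
  obtain ⟨u, hu, rfl⟩ := hv
  have := β.cinv_cmap z u
  rw [cmap] at this
  rwa [this]

theorem cinv_mem_bar {v : CT EZ z} (hv : v ∈ B.bar z) : β.cinv z v ∈ A.bar z := β.bar_le z hv

theorem quotInv_mkQ (v : CT EZ z) :
    β.quotInv z ((B.bar z).mkQ v) = (A.bar z).mkQ (β.cinv z v) := rfl

theorem smoothNear_cmap {V : ∀ z : Z, CT EZ z} (hV : SmoothNear V z) :
    SmoothNear (fun y => β.cmap y (V y)) z := by
  obtain ⟨U, hU, hz, hV⟩ := hV.exists_isOpen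
  exact SmoothOn.eventually ⟨β.smooth U _ hU hV.1, β.smooth U _ hU hV.2⟩ hU hz

theorem smoothNear_cinv {V : ∀ z : Z, CT EZ z} (hV : SmoothNear V z) :
    SmoothNear (fun y => β.cinv y (V y)) z := by
  obtain ⟨U, hU, hz, hV⟩ := hV.exists_isOpen
  exact SmoothOn.eventually ⟨β.smooth_symm U _ hU hV.1, β.smooth_symm U _ hU hV.2⟩ hU hz

variable {l : LiftMap EZ α P}

theorem isSmoothAt_cmap (hl : l.IsSmoothAt z) :
    LiftMap.IsSmoothAt (fun y => (β.cmap y).comp (l y)) z := fun a ha =>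
  β.smoothNear_cmap (hl a ha)

theorem isSmoothAt_cinv (hl : l.IsSmoothAt z) :
    LiftMap.IsSmoothAt (fun y => (β.cinv y).comp (l y)) z := fun a ha =>
  β.smoothNear_cinv (hl a ha)

variable {β}

theorem RespectsLifting.eventually_iff (hα : Continuous α) (hβ : β.RespectsLifting P)
    (hl : ∀ᶠ y in 𝓝 z, l.IsSmoothAt y) (hd : ∀ᶠ y in 𝓝 z, ∀ ξ, dC E EZ α y (l y ξ) = ξ.1) :
    (∀ᶠ y in 𝓝 z, l.IsVerticallyHolomorphicAt A y) ↔
      ∀ᶠ y in 𝓝 z, LiftMap.IsVerticallyHolomorphicAt B (fun z => (β.cmap z).comp (l z)) y := by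
  have key : ∀ U, IsOpen U → (∀ y ∈ U, l.IsSmoothAt y ∧ ∀ ξ, dC E EZ α y (l y ξ) = ξ.1) →
      ((∀ y ∈ U, l.IsVerticallyHolomorphicAt A y) ↔
      ∀ y ∈ U, LiftMap.IsVerticallyHolomorphicAt B (fun z => (β.cmap z).comp (l z)) y) :=
    fun U hU h => by
    have h1 := hβ U l hU ((LiftMap.smoothOn_iff hα hU).2 fun y hy => (h y hy).1)
      fun y hy => (h y hy).2
    rwa [LiftMap.verticallyHolomorphicOn_iff hα hU, LiftMap.verticallyHolomorphicOn_iff hα hU]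
      at h1
  constructor
  · intro h
    obtain ⟨U, hU, ho, hz⟩ := eventually_nhds_iff.1 (h.and (hl.and hd))
    filter_upwards [ho.mem_nhds hz] with y hy
    exact (key U ho fun y hy => (hU y hy).2).1 (fun y hy => (hU y hy).1) y hy
  · intro h
    obtain ⟨U, hU, ho, hz⟩ := eventually_nhds_iff.1 (h.and (hl.and hd))
    filter_upwards [ho.mem_nhds hz] with y hy
    exact (key U ho fun y hy => (hU y hy).2).2 (fun y hy => (hU y hy).1) y hy

/-- Transport of the local lifting condition along `β⁻¹`. -/
theorem RespectsLifting.cinv (hα : Continuous α) (hβ : β.RespectsLifting P)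
    (hl : ∀ᶠ y in 𝓝 z, l.IsSmoothAt y) (hd : ∀ᶠ y in 𝓝 z, ∀ ξ, dC E EZ α y (l y ξ) = ξ.1)
    (h : ∀ᶠ y in 𝓝 z, l.IsVerticallyHolomorphicAt B y) :
    ∀ᶠ y in 𝓝 z, LiftMap.IsVerticallyHolomorphicAt A (fun z => (β.cinv z).comp (l z)) y := by
  refine (hβ.eventually_iff hα (hl.mono fun y hy => β.isSmoothAt_cinv hy) ?_).2 ?_
  · filter_upwards [hd] with y hy ξ
    exact (β.dC_cinv _).trans (hy ξ)
  · have : (fun z => (β.cmap z).comp ((β.cinv z).comp (l z))) = l := by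
      funext y
      ext1 ξ
      exact β.cmap_cinv y _
    rwa [this]

end BundleAut

/-! ### Fiberwise holomorphic vector fields -/

section Fiber

variable {F : Type*} [TopologicalSpace F] [ChartedSpace EF F]

theorem IsHolomorphicOnFiber.mem {s : S} {v : FiberField EZ α s} (hv : IsHolomorphicOnFiber R s v)
    (z : {z : Z // α z = s}) : v z ∈ R.T z.1 := by
  obtain ⟨U, V, -, hz, -, h1, h2, -⟩ := hv z
  rw [← h2 z hz]
  exact h1 _ hz

/-- Holomorphy on the fibre supplies local extensions of `v` and `w` that preserve `T̄_rel` at the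
points of the fibre. `V` differs from their combination by a field that vanishes on the fibre, so
`bracket_eq_zero_of_fiber` removes the difference. -/
theorem preservesAt_of_fiber (hα : IsSmoothFiberBundle E EZ EF F α) {V : ∀ z : Z, CT EZ z}
    (hV : SmoothNear V z) {v w : FiberField EZ α (α z)} (hv : IsHolomorphicOnFiber R (α z) v)
    (hw : IsHolomorphicOnFiber R (α z) w) (c d : ℂ)
    (h : ∀ y : {y : Z // α y = α z}, V y.1 = c • v y + d • w y) : PreservesAt R.bar V z := by
  intro u hu
  obtain ⟨U₁, V₁, hU₁, hz₁, hs₁, -, he₁, hb₁⟩ := hv ⟨z, rfl⟩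
  obtain ⟨U₂, V₂, hU₂, hz₂, hs₂, -, he₂, hb₂⟩ := hw ⟨z, rfl⟩
  have hS : SmoothAt (c • V₁ + d • V₂) z :=
    ((hs₁.smoothAt hU₁ hz₁).const_smul c).add ((hs₂.smoothAt hU₂ hz₂).const_smul d)
  have h0 : bracket u (V - (c • V₁ + d • V₂)) z = 0 := by
    refine bracket_eq_zero_of_fiber hα (hV.smoothAt.sub hS) ?_ (R.dC_of_mem_bar hu.mem)
    filter_upwards [hU₁.mem_nhds hz₁, hU₂.mem_nhds hz₂] with y h1 h2 hy
    have e1 : V₁ y = v ⟨y, hy⟩ := he₁ ⟨y, hy⟩ h1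
    have e2 : V₂ y = w ⟨y, hy⟩ := he₂ ⟨y, hy⟩ h2
    have e3 : V y = c • v ⟨y, hy⟩ + d • w ⟨y, hy⟩ := h ⟨y, hy⟩
    change V y - (c • V₁ y + d • V₂ y) = 0
    rw [e1, e2, e3, sub_self]
  rw [bracket_sub_right hV.smoothAt hS, sub_eq_zero, bracket_add_right
    ((hs₁.smoothAt hU₁ hz₁).const_smul c) ((hs₂.smoothAt hU₂ hz₂).const_smul d),
    bracket_const_smul_right c (hs₁.smoothAt hU₁ hz₁),
    bracket_const_smul_right d (hs₂.smoothAt hU₂ hz₂)] at h0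
  obtain ⟨U, hU, ho, hz⟩ := eventually_nhds_iff.1 hu
  rw [h0]
  refine Submodule.add_mem _ (Submodule.smul_mem _ _ ?_) (Submodule.smul_mem _ _ ?_)
  · exact hb₁ (U ∩ U₁) u (ho.inter hU₁) inter_subset_right
      (smoothOn_of_smoothAt fun y hy => (hU y hy.1).1) (fun y hy => (hU y hy.1).2) z
      ⟨hz, hz₁⟩ rfl
  · exact hb₂ (U ∩ U₂) u (ho.inter hU₂) inter_subset_right
      (smoothOn_of_smoothAt fun y hy => (hU y hy.1).1) (fun y hy => (hU y hy.1).2) z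
      ⟨hz, hz₂⟩ rfl

variable {Ω : TwoForm EZ Z} {θ : LiftMap EZ α (T10 E)} {θ' : LiftMap EZ α (T01 E)}

/-- Elements of the isometry algebra of a fibre are holomorphic vector fields there, hence so are
their complex combinations, among them the values of `θ`. The same reason applies to the complex
conjugation of `θ`. -/
theorem IsAdapted.isVerticallyHolomorphicAt (hα : IsSmoothFiberBundle E EZ EF F α)
    (h : IsAdapted R Ω θ) (hθ : θ.IsSmoothAt z) : θ.IsVerticallyHolomorphicAt R z := by
  intro a ha
  obtain ⟨v, hv, w, hw, h1⟩ := h (α z) a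
  exact preservesAt_of_fiber hα (hθ a ha) hv.1 hw.1 1 Complex.I fun y => by
    rw [one_smul]; exact h1 y

theorem conj_conj10 {s : S} (ξ : T10 E s) : Cx.conj (conj10 ξ : CT E s) = ξ := conj_conj _

/-- Complex conjugation `T̄_S → T_S`. -/
def conj01 {s : S} (ξ : T01 E s) : T10 E s := ⟨Cx.conj ξ.1, ξ.2⟩

theorem conj10_conj01 {s : S} (ξ : T01 E s) : conj10 (conj01 ξ) = ξ :=
  Subtype.ext (conj_conj _)

theorem IsComplexConjugation.isVerticallyHolomorphicAt (hα : IsSmoothFiberBundle E EZ EF F α)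
    (h : IsComplexConjugation R Ω θ θ') : θ'.IsVerticallyHolomorphicAt R z := by
  intro a ha
  obtain ⟨v, hv, w, hw, h1⟩ := h.conj (α z) fun s => conj01 (a s)
  have hθ' := (LiftMap.smoothOn_iff hα.1.continuous isOpen_univ).1 h.smooth z trivial
  refine preservesAt_of_fiber hα (hθ' a ha) hv.1 hw.1 (-1) Complex.I fun y => ?_
  have h2 := (h1 y).2
  rw [conj10_conj01] at h2
  rw [h2]
  module

theorem IsComplexConjugation.mem (h : IsComplexConjugation R Ω θ θ') (ξ : T01 E (α z)) :
    θ' z ξ ∈ R.T z := by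
  classical
  -- The conjugation is specified on arbitrary families of `(1,0)`-vectors, without regularity, so a
  -- family supported at the single point `α z` reaches the given vector.
  have h0 : ∃ b : ∀ s : S, T10 E s, b (α z) = conj01 ξ :=
    ⟨Function.update 0 (α z) (conj01 ξ), Function.update_self _ _ _⟩
  obtain ⟨b, hb⟩ := h0
  obtain ⟨v, hv, w, hw, h1⟩ := h.conj (α z) b
  have h2 := (h1 ⟨z, rfl⟩).2
  simp only [hb, conj10_conj01] at h2
  rw [h2]
  exact Submodule.neg_mem _ (Submodule.sub_mem _ (hv.1.mem ⟨z, rfl⟩)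
    (Submodule.smul_mem _ _ (hw.1.mem ⟨z, rfl⟩)))

end Fiber

end Bundle

namespace Cx

variable {V : Type*} [AddCommGroup V] [Module ℝ V] (Ω : V →ₗ[ℝ] V →ₗ[ℝ] ℝ) (u v w : Cx V)

theorem bilin_add_left : bilin Ω (u + v) w = bilin Ω u w + bilin Ω v w := by
  apply Complex.ext <;> simp [bilin] <;> ring

theorem bilin_sub_left : bilin Ω (u - v) w = bilin Ω u w - bilin Ω v w := by
  apply Complex.ext <;> simp [bilin] <;> ring

theorem bilin_conj_conj : bilin Ω (conj u) (conj v) = starRingEnd ℂ (bilin Ω u v) := by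
  apply Complex.ext <;> simp [bilin] <;> ring

end Cx

section Bundle

variable {E EZ EF : Type*} [NormedAddCommGroup E] [NormedSpace ℂ E] [FiniteDimensional ℂ E]
  [NormedAddCommGroup EZ] [NormedSpace ℝ EZ] [FiniteDimensional ℝ EZ]
  [NormedAddCommGroup EF] [NormedSpace ℝ EF]
  {S Z : Type*} [TopologicalSpace S] [ChartedSpace E S]
  [TopologicalSpace Z] [ChartedSpace EZ Z]
  [IsManifold 𝓘(ℂ, E) ω S] [IsManifold 𝓘(ℝ, EZ) ∞ Z] {α : Z → S}
  {P : ∀ s : S, Submodule ℂ (CT E s)} {z : Z}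

/-! ### The bundles `T̄` and `T` of a `∂̄`-operator -/

section BarT

variable {R : RelComplexStructure E EZ α} {D : BaseMap R (T01 E)} {v : CT EZ z}

theorem mem_barT_of_mkQ {ξ : T01 E (α z)} (h : (R.bar z).mkQ v = D z ξ) : v ∈ barT R D z :=
  ⟨ξ, h.symm⟩

theorem bar_le_barT : R.bar z ≤ barT R D z := fun v hv =>
  mem_barT_of_mkQ (ξ := 0) (by
    rw [map_zero, Submodule.mkQ_apply, Submodule.Quotient.mk_eq_zero]
    exact hv)

theorem T_le_acsT : R.T z ≤ acsT R D z := fun _ hv => bar_le_barT (R.conj_mem_bar hv)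

theorem dC_conj (v : CT EZ z) : dC E EZ α z (Cx.conj v) = Cx.conj (dC E EZ α z v) :=
  (conj_map _ _).symm

theorem conj_mem_barT (hv : v ∈ acsT R D z) : Cx.conj v ∈ barT R D z := hv

theorem conj_mem_acsT (hv : v ∈ barT R D z) : Cx.conj v ∈ acsT R D z := by
  change Cx.conj (Cx.conj v) ∈ barT R D z
  rwa [conj_conj]

theorem mkQ_of_mem_barT (hD : ∀ z ξ, R.proj z (D z ξ) = ξ.1)
    (hv : v ∈ barT R D z) {ξ : T01 E (α z)}
    (h : dC E EZ α z v = ξ.1) : (R.bar z).mkQ v = D z ξ := by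
  obtain ⟨η, hη⟩ := hv
  rw [dC_of_mkQ hD hη.symm] at h
  rw [← hη, Subtype.ext h]

/-- The operator splits the projection to the base, so a vertical vector of `T̄` represents the
image of `0`. -/
theorem mem_bar_of_mem_barT (hD : ∀ z ξ, R.proj z (D z ξ) = ξ.1)
    (hv : v ∈ barT R D z) (h : dC E EZ α z v = 0) : v ∈ R.bar z := by
  have := mkQ_of_mem_barT hD hv (ξ := 0) h
  rwa [map_zero, Submodule.mkQ_apply, Submodule.Quotient.mk_eq_zero] at this

theorem mem_T_of_mem_acsT (hD : ∀ z ξ, R.proj z (D z ξ) = ξ.1)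
    (hv : v ∈ acsT R D z) (h : dC E EZ α z v = 0) : v ∈ R.T z := by
  have := mem_bar_of_mem_barT hD (conj_mem_barT hv) (by rw [dC_conj, h, map_zero])
  change Cx.conj (Cx.conj v) ∈ R.T z at this
  rwa [conj_conj] at this

theorem eq_zero_of_mem_acsT_of_mem_bar (hD : ∀ z ξ, R.proj z (D z ξ) = ξ.1)
    (hv : v ∈ acsT R D z) (h : v ∈ R.bar z) : v = 0 :=
  R.eq_zero_of_mem (mem_T_of_mem_acsT hD hv (R.dC_of_mem_bar h)) h

/-- Local lifts of an integrable `∂̄`-operator satisfy the local lifting condition. -/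
theorem IsLiftAt.isVerticallyHolomorphicAt (hD : ∀ z ξ, R.proj z (D z ξ) = ξ.1)
    (hα : ContMDiff 𝓘(ℝ, EZ) 𝓘(ℝ, E) ∞ α)
    {l : LiftMap EZ α (T01 E)} (hl : IsLiftAt R D l z) (hi : IsInvolutive (barT R D)) :
    l.IsVerticallyHolomorphicAt R z := by
  intro a ha u hu
  have hs := hl.isSmoothAt a ha
  have hla : IsSectionAt (barT R D) (fun y => l y (a (α y))) z :=
    hs.isSectionAt (hl.mono fun y hy => mem_barT_of_mkQ (hy.2 _))
  -- Integrability puts the bracket in `T̄`; being vertical, it is then in `T̄_rel`.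
  refine mem_bar_of_mem_barT hD (hi.bracket_mem (hu.mono fun y => bar_le_barT) hla) ?_
  exact dC_bracket_vertical (b := fun s => (a s).1) hα.contMDiffAt hu.smoothAt hs.smoothAt
    ha.smoothAt (Filter.Eventually.mono hu fun y hy => R.dC_of_mem_bar hy.2)
    ((hl.dC_eq hD).mono fun y hy => hy _)

end BarT

/-! ### The total operator -/

section Total

variable {R : RelComplexStructure E EZ α} {c : BaseMap R (T10 E)} {D : BaseMap R (T01 E)}
  {m : LiftMap EZ α (T10 E)} {l : LiftMap EZ α (T01 E)}

/-- The lift `m ⊕ l` of `∇ + ∂̄`, given lifts of `∇` and of `∂̄`. -/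
def totalLift (m : LiftMap EZ α (T10 E)) (l : LiftMap EZ α (T01 E)) :
    LiftMap EZ α (fun s : S => (⊤ : Submodule ℂ (CT E s))) :=
  fun z => ((m z).comp (proj10 (α z)) + (l z).comp (proj01 (α z))).comp (Submodule.subtype ⊤)

theorem totalLift_apply (ξ : (⊤ : Submodule ℂ (CT E (α z)))) :
    totalLift m l z ξ = m z (proj10 (α z) ξ.1) + l z (proj01 (α z) ξ.1) := rfl

theorem SmoothNear.proj10 {a : ∀ s : S, CT E s} {s : S} (ha : SmoothNear a s) :
    SmoothNear (fun s => (NonlinearHodge.proj10 s (a s) : CT E s)) s := by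
  filter_upwards [ha] with t ht using ht.proj10

theorem SmoothNear.proj01 {a : ∀ s : S, CT E s} {s : S} (ha : SmoothNear a s) :
    SmoothNear (fun s => (NonlinearHodge.proj01 s (a s) : CT E s)) s := by
  filter_upwards [ha] with t ht using ht.proj01

theorem isSmoothAt_totalLift (hm : m.IsSmoothAt z) (hl : l.IsSmoothAt z) :
    (totalLift m l).IsSmoothAt z := fun a ha =>
  (hm (fun s => proj10 s (a s).1) ha.proj10).add (hl (fun s => proj01 s (a s).1) ha.proj01)

theorem isVerticallyHolomorphicAt_totalLift (hm : m.IsSmoothAt z) (hl : l.IsSmoothAt z)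
    (hm' : m.IsVerticallyHolomorphicAt R z) (hl' : l.IsVerticallyHolomorphicAt R z) :
    (totalLift m l).IsVerticallyHolomorphicAt R z := fun a ha =>
  PreservesAt.add (hm' (fun s => proj10 s (a s).1) ha.proj10) (hm _ ha.proj10).smoothAt
    (hl' (fun s => proj01 s (a s).1) ha.proj01) (hl _ ha.proj01).smoothAt

theorem isLiftAt_totalLift (hm : IsLiftAt R c m z) (hl : IsLiftAt R D l z) :
    IsLiftAt R (totalOp R c D) (totalLift m l) z := by
  filter_upwards [hm, hl] with y h1 h2
  refine ⟨isSmoothAt_totalLift h1.1 h2.1, fun ξ => ?_⟩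
  rw [totalLift_apply, map_add, h1.2, h2.2]
  rfl

theorem proj_totalOp (hc : ∀ z ξ, R.proj z (c z ξ) = ξ.1) (hD : ∀ z ξ, R.proj z (D z ξ) = ξ.1)
    (z : Z) (ξ : (⊤ : Submodule ℂ (CT E (α z)))) :
    R.proj z (totalOp R c D z ξ) = ξ.1 := by
  change R.proj z (c z (proj10 (α z) ξ.1) + D z (proj01 (α z) ξ.1)) = ξ.1
  rw [map_add, hc, hD, proj10_add_proj01]

theorem isSplitting_totalOp (hα : Continuous α) (hc : IsSplitting R c) (hD : IsSplitting R D) :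
    IsSplitting R (totalOp R c D) := by
  rw [isSplitting_iff hα] at hc hD ⊢
  refine ⟨proj_totalOp hc.1 hD.1, fun z => ?_⟩
  obtain ⟨m, hm⟩ := hc.2 z
  obtain ⟨l, hl⟩ := hD.2 z
  exact ⟨_, isLiftAt_totalLift hm hl⟩

theorem isVerticallyHolomorphic_totalOp (hα : Continuous α) (hc : IsVerticallyHolomorphic R c)
    (hD : IsVerticallyHolomorphic R D) : IsVerticallyHolomorphic R (totalOp R c D) := by
  rw [isVerticallyHolomorphic_iff hα] at hc hD ⊢
  intro z
  obtain ⟨m, hm, hm'⟩ := hc z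
  obtain ⟨l, hl, hl'⟩ := hD z
  refine ⟨_, isLiftAt_totalLift hm hl, ?_⟩
  filter_upwards [hm, hl, hm', hl'] with y h1 h2 h3 h4
  exact isVerticallyHolomorphicAt_totalLift h1.1 h2.1 h3 h4

end Total

/-! ### Chern connections -/

section Chern

variable {R : RelComplexStructure E EZ α} {Ω : TwoForm EZ Z} {D : BaseMap R (T01 E)}

theorem IsHermitianMetric.bilin_bar (hΩ : IsHermitianMetric R Ω) {u v : CT EZ z}
    (hu : u ∈ R.bar z) (hv : v ∈ R.bar z) : bilin (Ω.toFun z) u v = 0 := by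
  have h := hΩ.type11 z _ hu _ hv
  rw [bilin_conj_conj] at h
  exact (map_eq_zero _).1 h

/-- Representatives in `T` of the two values differ by a vector of `T_rel` that is orthogonal to
itself, and positivity makes it zero. -/
theorem IsChernConnection.unique (hΩ : IsHermitianMetric R Ω)
    (hD : ∀ z ξ, R.proj z (D z ξ) = ξ.1) {c c' : BaseMap R (T10 E)}
    (hc : IsChernConnection R D Ω c) (hc' : IsChernConnection R D Ω c') : c = c' := by
  funext z
  ext1 ξ
  obtain ⟨v, hv, hvc⟩ := hc.almostConnection.mem z ξ
  obtain ⟨v', hv', hvc'⟩ := hc'.almostConnection.mem z ξ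
  have ht : v - v' ∈ R.T z := by
    refine mem_T_of_mem_acsT hD (Submodule.sub_mem _ hv hv') ?_
    rw [map_sub, dC_of_mkQ hc.almostConnection.isSplitting.splits hvc,
      dC_of_mkQ hc'.almostConnection.isSplitting.splits hvc', sub_self]
  have h0 : bilin (Ω.toFun z) (v - v') (Cx.conj (v - v')) = 0 := by
    rw [bilin_sub_left, hc.orthogonal z ξ v hvc _ ht, hc'.orthogonal z ξ v' hvc' _ ht, sub_self]
  rw [← hvc, ← hvc']
  by_contra hne
  have h1 := hΩ.pos z _ ht fun h => hne (by rw [sub_eq_zero.1 h])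
  rw [h0] at h1
  simp at h1

end Chern

/-! ### The operators attached to a Higgs bundle with an allowable metric -/

section Simpson

variable {A B : RelComplexStructure E EZ α} {β : BundleAut A B} {dbar : BaseMap B (T01 E)}
  {θ : LiftMap EZ α (T10 E)} {θ' : LiftMap EZ α (T01 E)} {Ω : TwoForm EZ Z}
  {F : Type*} [TopologicalSpace F] [ChartedSpace EF F]

theorem bilin_cmap (h : ∀ z u v, Ω.toFun z (β.toFun z u) (β.toFun z v) = Ω.toFun z u v)
    (u v : CT EZ z) : bilin (Ω.toFun z) (β.cmap z u) (β.cmap z v) = bilin (Ω.toFun z) u v := by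
  apply Complex.ext <;> simp [bilin, BundleAut.cmap, h]

theorem IsHermitianMetric.of_preserved (hΩ : IsHermitianMetric B Ω)
    (h : ∀ z u v, Ω.toFun z (β.toFun z u) (β.toFun z v) = Ω.toFun z u v) :
    IsHermitianMetric A Ω where
  closed := hΩ.closed
  type11 z u hu v hv := by
    rw [← bilin_cmap h]
    exact hΩ.type11 z _ (β.cmap_mem_T hu) _ (β.cmap_mem_T hv)
  pos z u hu h0 := by
    rw [← bilin_cmap h, ← β.conj_cmap]
    refine hΩ.pos z _ (β.cmap_mem_T hu) fun hz => h0 ?_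
    rw [← β.cinv_cmap z u, hz, map_zero]

theorem simpsonDbar_apply {v : CT EZ z} {ξ : T01 E (α z)} (h : (B.bar z).mkQ v = dbar z ξ) :
    simpsonDbar β dbar θ' z ξ = (A.bar z).mkQ (β.cinv z (v + θ' z ξ)) := by
  rw [← β.quotInv_mkQ, map_add, h]
  rfl

theorem isLiftAt_simpsonDbar {l : LiftMap EZ α (T01 E)} (hl : IsLiftAt B dbar l z)
    (hθ' : ∀ y, θ'.IsSmoothAt y) :
    IsLiftAt A (simpsonDbar β dbar θ') (fun y => (β.cinv y).comp (l y + θ' y)) z := by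
  filter_upwards [hl] with y hy
  exact ⟨β.isSmoothAt_cinv (hy.1.add (hθ' y)), fun ξ => (simpsonDbar_apply (hy.2 ξ)).symm⟩

theorem proj_simpsonDbar (hD : ∀ z ξ, B.proj z (dbar z ξ) = ξ.1) (hθ' : ∀ z ξ, θ' z ξ ∈ B.T z)
    (z : Z) (ξ : T01 E (α z)) : A.proj z (simpsonDbar β dbar θ' z ξ) = ξ.1 := by
  obtain ⟨v, hv⟩ := (B.bar z).mkQ_surjective (dbar z ξ)
  rw [simpsonDbar_apply hv, A.proj_mkQ, β.dC_cinv, map_add, dC_of_mkQ hD hv,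
    B.dC_of_mem_T (hθ' z ξ), add_zero]

theorem isSplitting_simpsonDbar (hα : Continuous α) (hD : IsSplitting B dbar)
    (hθ' : ∀ y, θ'.IsSmoothAt y) (hm : ∀ z ξ, θ' z ξ ∈ B.T z) :
    IsSplitting A (simpsonDbar β dbar θ') := by
  rw [isSplitting_iff hα] at hD ⊢
  refine ⟨proj_simpsonDbar hD.1 hm, fun z => ?_⟩
  obtain ⟨l, hl⟩ := hD.2 z
  exact ⟨_, isLiftAt_simpsonDbar hl hθ'⟩

/-- The lift of `∂̄_g` and `θ'` are added on the side of `B`, where each satisfies the condition,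
and only the sum is moved by `β⁻¹`: `RespectsLifting` speaks of lifts that split the projection,
which vertical maps like `θ'` do not. -/
theorem isVerticallyHolomorphic_simpsonDbar (hα : ContMDiff 𝓘(ℝ, EZ) 𝓘(ℝ, E) ∞ α)
    (hβ : β.RespectsLifting (T01 E)) (hD : IsHolomorphicFibration B dbar)
    (hθ' : ∀ y, θ'.IsSmoothAt y) (hm : ∀ z ξ, θ' z ξ ∈ B.T z)
    (hh : ∀ y, θ'.IsVerticallyHolomorphicAt B y) :
    IsVerticallyHolomorphic A (simpsonDbar β dbar θ') := by
  rw [isVerticallyHolomorphic_iff hα.continuous]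
  intro z
  have hs := (isSplitting_iff hα.continuous).1 hD.isSplitting
  obtain ⟨l, hl⟩ := hs.2 z
  refine ⟨_, isLiftAt_simpsonDbar hl hθ', ?_⟩
  refine hβ.cinv hα.continuous (l := fun y => l y + θ' y) ?_ ?_ ?_
  · filter_upwards [hl] with y hy using hy.1.add (hθ' y)
  · filter_upwards [hl.dC_eq hs.1] with y hy ξ
    change dC E EZ α y (l y ξ + θ' y ξ) = _
    rw [map_add, hy, B.dC_of_mem_T (hm y ξ), add_zero]
  · filter_upwards [hl.eventually] with y hy
    exact .add hy.isSmoothAt (hθ' y)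
      (IsLiftAt.isVerticallyHolomorphicAt hs.1 hα hy hD.integrable) (hh y)

/-- Adding `θ'` to the operator alters `T` only by conjugates of values of `θ'`. These lie in `T̄_B`
and disappear in the quotient, while `β` preserves the pairing. Hence the new Chern connection is
`β⁻¹` of the old one, whatever the vertical map `θ'`. -/
theorem isChernConnection_quotInv (hα : Continuous α) (hD : IsSplitting B dbar)
    (hm : ∀ z ξ, θ' z ξ ∈ B.T z) (hΩ : IsHermitianMetric B Ω)
    (h : ∀ z u v, Ω.toFun z (β.toFun z u) (β.toFun z v) = Ω.toFun z u v)
    {c : BaseMap B (T10 E)} (hc : IsChernConnection B dbar Ω c) :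
    IsChernConnection A (simpsonDbar β dbar θ') Ω (fun z => (β.quotInv z).comp (c z)) := by
  have hcs := (isSplitting_iff hα).1 hc.almostConnection.isSplitting
  refine ⟨⟨(isSplitting_iff hα).2 ⟨fun z ξ => ?_, fun z => ?_⟩, fun z ξ => ?_⟩,
    fun z ξ u hu w hw => ?_⟩
  · obtain ⟨v, hv⟩ := (B.bar z).mkQ_surjective (c z ξ)
    rw [LinearMap.comp_apply, ← hv, β.quotInv_mkQ, A.proj_mkQ, β.dC_cinv, dC_of_mkQ hcs.1 hv]
  · obtain ⟨l, hl⟩ := hcs.2 z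
    refine ⟨fun y => (β.cinv y).comp (l y), ?_⟩
    filter_upwards [hl] with y hy
    refine ⟨β.isSmoothAt_cinv hy.1, fun ξ => ?_⟩
    rw [LinearMap.comp_apply, LinearMap.comp_apply, ← hy.2, β.quotInv_mkQ]
  · obtain ⟨v, hv, hvc⟩ := hc.almostConnection.mem z ξ
    have hb : Cx.conj (θ' z (conj10 ξ)) ∈ B.bar z := B.conj_mem_bar (hm z _)
    -- The conjugate of this vector is `β⁻¹` of a representative of `∂̄_g(ξ̄)` plus `θ'(ξ̄)`, so the
    -- vector lies in the new `T`; the added summand is in `T̄_B` and leaves the class of `v`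
    -- unchanged.
    refine ⟨β.cinv z (v + Cx.conj (θ' z (conj10 ξ))), ?_, ?_⟩
    · change Cx.conj (β.cinv z (v + Cx.conj (θ' z (conj10 ξ)))) ∈ barT A _ z
      rw [β.conj_cinv, map_add, conj_conj]
      refine mem_barT_of_mkQ (ξ := conj10 ξ) (simpsonDbar_apply ?_).symm
      refine mkQ_of_mem_barT hD.splits hv ?_
      rw [dC_conj, dC_of_mkQ hcs.1 hvc]
      rfl
    · rw [map_add, map_add, show (A.bar z).mkQ (β.cinv z (Cx.conj (θ' z (conj10 ξ)))) = 0 from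
        (Submodule.Quotient.mk_eq_zero _).2 (β.cinv_mem_bar hb), add_zero, ← β.quotInv_mkQ, hvc]
      rfl
  · obtain ⟨v, hv⟩ := (B.bar z).mkQ_surjective (c z ξ)
    rw [LinearMap.comp_apply, ← hv, β.quotInv_mkQ, A.mkQ_eq_iff] at hu
    -- `u` differs from `β⁻¹ v` by a vector of `T̄_A`, which pairs to zero with the conjugate of `w`
    -- because `Ω` has type `(1,1)` on the fibres.
    rw [← sub_add_cancel u (β.cinv z v), bilin_add_left,
      (hΩ.of_preserved h).bilin_bar hu (A.conj_mem_bar hw), zero_add, ← bilin_cmap h,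
      β.cmap_cinv, ← β.conj_cmap]
    exact hc.orthogonal z ξ v hv _ (β.cmap_mem_T hw)

theorem isAlmostConnection_simpsonNabla (hα : Continuous α) {D : BaseMap A (T01 E)}
    {c : BaseMap A (T10 E)} (hc : IsAlmostConnection A D c) (hθ : ∀ y, θ.IsSmoothAt y)
    (hm : ∀ z ξ, θ z ξ ∈ B.T z) : IsAlmostConnection A D (simpsonNabla β c θ) := by
  have hcs := (isSplitting_iff hα).1 hc.isSplitting
  refine ⟨(isSplitting_iff hα).2 ⟨fun z ξ => ?_, fun z => ?_⟩, fun z ξ => ?_⟩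
  · change A.proj z (c z ξ + (2 : ℂ) • (A.bar z).mkQ (β.cinv z (θ z ξ))) = _
    rw [map_add, map_smul, hcs.1, A.proj_mkQ, β.dC_cinv, B.dC_of_mem_T (hm z ξ), smul_zero,
      add_zero]
  · obtain ⟨l, hl⟩ := hcs.2 z
    refine ⟨fun y => l y + (2 : ℂ) • (β.cinv y).comp (θ y), ?_⟩
    filter_upwards [hl] with y hy
    refine ⟨hy.1.add ((β.isSmoothAt_cinv (hθ y)).const_smul 2), fun ξ => ?_⟩
    rw [LinearMap.add_apply, map_add, hy.2]
    rfl
  · obtain ⟨v, hv, hvc⟩ := hc.mem z ξ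
    refine ⟨v + (2 : ℂ) • β.cinv z (θ z ξ), Submodule.add_mem _ hv
      (Submodule.smul_mem _ _ (T_le_acsT (β.cinv_mem_T (hm z ξ)))), ?_⟩
    rw [map_add, hvc]
    rfl

theorem isVerticallyHolomorphic_simpsonNabla (hα : Continuous α)
    (hβ : β.RespectsLifting (T10 E)) {c : BaseMap B (T10 E)} (hs : IsSplitting B c)
    (hc : IsVerticallyHolomorphic B c) (hθ : ∀ y, θ.IsSmoothAt y)
    (hm : ∀ z ξ, θ z ξ ∈ B.T z) (hh : ∀ y, θ.IsVerticallyHolomorphicAt B y) :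
    IsVerticallyHolomorphic A (simpsonNabla β (fun z => (β.quotInv z).comp (c z)) θ) := by
  rw [isVerticallyHolomorphic_iff hα] at hc ⊢
  intro z
  obtain ⟨l, hl, hlh⟩ := hc z
  have h2 : ∀ y, LiftMap.IsVerticallyHolomorphicAt B (fun y => (2 : ℂ) • θ y) y :=
    fun y a ha u hu => by
      have := (hh y).add (hθ y) (hθ y) (hh y) a ha u hu
      refine cast (congrArg (· ∈ B.bar y) (bracket_congr
        (Eventually.of_forall fun _ => rfl) (Eventually.of_forall fun x => ?_))) this
      exact (two_smul ℂ _).symm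
  refine ⟨fun y => (β.cinv y).comp (l y + (2 : ℂ) • θ y), ?_, ?_⟩
  · filter_upwards [hl] with y hy
    refine ⟨β.isSmoothAt_cinv (hy.1.add ((hθ y).const_smul 2)), fun ξ => ?_⟩
    change (A.bar y).mkQ (β.cinv y (l y ξ + (2 : ℂ) • θ y ξ))
      = β.quotInv y (c y ξ) + (2 : ℂ) • (A.bar y).mkQ (β.cinv y (θ y ξ))
    rw [map_add, map_add, map_smul, map_smul, ← hy.2, β.quotInv_mkQ]
  · refine hβ.cinv hα (l := fun y => l y + (2 : ℂ) • θ y) ?_ ?_ ?_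
    · filter_upwards [hl] with y hy using hy.1.add ((hθ y).const_smul 2)
    · filter_upwards [hl.dC_eq hs.splits] with y hy ξ
      change dC E EZ α y (l y ξ + (2 : ℂ) • θ y ξ) = _
      rw [map_add, map_smul, hy, B.dC_of_mem_T (hm y ξ), smul_zero, add_zero]
    · filter_upwards [hl, hlh] with y h1 h3
      exact .add h1.1 ((hθ y).const_smul 2) h3 (h2 y)

end Simpson

end Bundle

/-! ## Curvature -/

section Bundle

variable {E EZ EF : Type*} [NormedAddCommGroup E] [NormedSpace ℂ E] [FiniteDimensional ℂ E]
  [NormedAddCommGroup EZ] [NormedSpace ℝ EZ] [FiniteDimensional ℝ EZ]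
  {S Z : Type*} [TopologicalSpace S] [ChartedSpace E S]
  [TopologicalSpace Z] [ChartedSpace EZ Z]
  [IsManifold 𝓘(ℂ, E) ω S] [IsManifold 𝓘(ℝ, EZ) ∞ Z] {α : Z → S} {z : Z}

theorem exists_smoothNear_extension (s : S) (ξ : CT E s) :
    ∃ a : ∀ s : S, CT E s, SmoothNear a s ∧ a s = ξ := by
  refine ⟨∑ i, chartCoord E s i s ξ • chartFrame E s i, ?_, ?_⟩
  · filter_upwards [(chartAt E s).open_source.mem_nhds (mem_chart_source E s)] with t ht
    exact .sum fun i _ => (smoothAt_chartFrame i ht).const_smul _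
  · rw [Finset.sum_apply]
    exact sum_chartCoord_smul (mem_chart_source E s) ξ

/-- The vector field `l(α^* a)`. -/
def LiftMap.ofField (l : LiftMap EZ α (fun s : S => (⊤ : Submodule ℂ (CT E s))))
    (a : ∀ s : S, CT E s) (z : Z) : CT EZ z := l z ⟨a (α z), trivial⟩

/-! ### The curvature expression of one fixed lift. -/

section Raw

variable {l : LiftMap EZ α (fun s : S => (⊤ : Submodule ℂ (CT E s)))} {a b b' : ∀ s : S, CT E s}

theorem LiftMap.IsSmoothAt.ofField (hl : l.IsSmoothAt z) (ha : SmoothNear a (α z)) :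
    SmoothNear (l.ofField a) z := hl (fun s => ⟨a s, trivial⟩) ha

/-- `[l(a), l(b)] - l([a, b])` -/
def curvatureAt (l : LiftMap EZ α (fun s : S => (⊤ : Submodule ℂ (CT E s))))
    (a b : ∀ s : S, CT E s) : ∀ z : Z, CT EZ z :=
  bracket (l.ofField a) (l.ofField b) - l.ofField (bracket a b)

theorem curvatureAt_swap : curvatureAt l a b z = -curvatureAt l b a z := by
  have h : l.ofField (bracket a b) z = -l.ofField (bracket b a) z :=
    (congrArg (l z) (Subtype.ext bracket_swap :
      (⟨bracket a b (α z), trivial⟩ : (⊤ : Submodule ℂ (CT E (α z))))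
        = -⟨bracket b a (α z), trivial⟩)).trans (map_neg _ _)
  change bracket _ _ z - l.ofField (bracket a b) z
    = -(bracket _ _ z - l.ofField (bracket b a) z)
  rw [bracket_swap, h]
  abel

theorem curvatureAt_congr_right (hα : ContinuousAt α z) (h : ∀ᶠ s in 𝓝 (α z), b s = b' s) :
    curvatureAt l a b z = curvatureAt l a b' z := by
  have h1 : ∀ᶠ y in 𝓝 z, l.ofField b y = l.ofField b' y := by
    filter_upwards [hα.eventually h] with y hy
    exact congrArg (l y) (Subtype.ext hy)
  change bracket _ _ z - l z ⟨bracket a b (α z), trivial⟩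
    = bracket _ _ z - l z ⟨bracket a b' (α z), trivial⟩
  have h2 : bracket a b (α z) = bracket a b' (α z) :=
    bracket_congr (Eventually.of_forall fun _ => rfl) h
  rw [bracket_congr (Eventually.of_forall fun _ => rfl) h1]
  congr 3

/-- Tensoriality. The lift of `a` differentiates `f ∘ α` as `a` differentiates `f`, so the
derivative term of the bracket on `Z` equals the lift of the derivative term on the base, and the
two cancel. -/
theorem curvatureAt_sum_right (hα : ContMDiff 𝓘(ℝ, EZ) 𝓘(ℝ, E) ∞ α) (hl : l.IsSmoothAt z)
    (hd : ∀ᶠ y in 𝓝 z, ∀ ξ, dC E EZ α y (l y ξ) = ξ.1) {ι : Type*} (I : Finset ι)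
    {f : ι → S → ℂ} {e : ι → ∀ s : S, CT E s}
    (hf : ∀ i ∈ I, FnSmoothAt (E := E) (f i) (α z)) (he : ∀ i ∈ I, SmoothNear (e i) (α z)) :
    curvatureAt l a (∑ i ∈ I, f i • e i) z
      = ∑ i ∈ I, f i (α z) • curvatureAt l a (e i) z := by
  have h1 : l.ofField (∑ i ∈ I, f i • e i) = ∑ i ∈ I, (f i ∘ α) • l.ofField (e i) := by
    funext y
    rw [Finset.sum_apply]
    have : (⟨(∑ i ∈ I, f i • e i) (α y), trivial⟩ : (⊤ : Submodule ℂ (CT E (α y))))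
        = ∑ i ∈ I, f i (α y) • ⟨e i (α y), trivial⟩ := by
      apply Subtype.ext
      rw [Finset.sum_apply, AddSubmonoidClass.coe_finsetSum]
      rfl
    refine (congrArg (l y) this).trans ?_
    rw [map_sum]
    exact Finset.sum_congr rfl fun i _ => map_smul _ _ _
  have hfs : ∀ i ∈ I, FnSmoothAt (E := EZ) (f i ∘ α) z := fun i hi =>
    (hf i hi).comp z hα.contMDiffAt
  have hes : ∀ i ∈ I, SmoothAt (l.ofField (e i)) z := fun i hi => (hl.ofField (he i hi)).smoothAt
  have h2 : bracket a (∑ i ∈ I, f i • e i) (α z) = ∑ i ∈ I,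
      (cderiv a (f i) (α z) • e i (α z) + f i (α z) • bracket a (e i) (α z)) := by
    rw [bracket_sum_right fun i hi => (he i hi).smoothAt.smul (hf i hi)]
    exact Finset.sum_congr rfl fun i hi => bracket_smul_right (hf i hi) (he i hi).smoothAt
  have h3 : l.ofField (bracket a (∑ i ∈ I, f i • e i)) z = ∑ i ∈ I,
      (cderiv a (f i) (α z) • l.ofField (e i) z
        + f i (α z) • l.ofField (bracket a (e i)) z) := by
    have : (⟨bracket a (∑ i ∈ I, f i • e i) (α z), trivial⟩ : (⊤ : Submodule ℂ (CT E (α z))))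
        = ∑ i ∈ I, (cderiv a (f i) (α z) • ⟨e i (α z), trivial⟩
          + f i (α z) • ⟨bracket a (e i) (α z), trivial⟩) := by
      apply Subtype.ext
      rw [h2, AddSubmonoidClass.coe_finsetSum]
      rfl
    refine (congrArg (l z) this).trans ?_
    rw [map_sum]
    exact Finset.sum_congr rfl fun i _ => by rw [map_add, map_smul, map_smul]; rfl
  have h4 : bracket (l.ofField a) (l.ofField (∑ i ∈ I, f i • e i)) z = ∑ i ∈ I,
      (cderiv a (f i) (α z) • l.ofField (e i) z
        + f i (α z) • bracket (l.ofField a) (l.ofField (e i)) z) := by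
    rw [h1, bracket_sum_right fun i hi => (hes i hi).smul (hfs i hi)]
    refine Finset.sum_congr rfl fun i hi => ?_
    rw [bracket_smul_right (hfs i hi) (hes i hi),
      cderiv_comp_related (a := a) hα.contMDiffAt (hf i hi) (hd.self_of_nhds _)]
    rfl
  change bracket _ _ z - l.ofField _ z = _
  rw [h3, h4, ← Finset.sum_sub_distrib]
  refine Finset.sum_congr rfl fun i _ => ?_
  change _ = f i (α z) • (bracket _ _ z - l.ofField _ z)
  rw [smul_sub]
  abel

theorem curvatureAt_eq_sum_right (hα : ContMDiff 𝓘(ℝ, EZ) 𝓘(ℝ, E) ∞ α) (hl : l.IsSmoothAt z)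
    (hd : ∀ᶠ y in 𝓝 z, ∀ ξ, dC E EZ α y (l y ξ) = ξ.1) (hb : SmoothNear b (α z)) :
    curvatureAt l a b z = ∑ i, chartCoord E (α z) i (α z) (b (α z)) •
      curvatureAt l a (chartFrame E (α z) i) z := by
  have hs := (chartAt E (α z)).open_source.mem_nhds (mem_chart_source E (α z))
  rw [← curvatureAt_sum_right hα hl hd Finset.univ
    (f := fun i s => chartCoord E (α z) i s (b s))
    (fun i _ => hb.smoothAt.chartCoord i (mem_chart_source E (α z)))
    fun i _ => by filter_upwards [hs] with t ht using smoothAt_chartFrame i ht]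
  refine curvatureAt_congr_right hα.continuous.continuousAt ?_
  filter_upwards [hs] with t ht
  rw [Finset.sum_apply]
  exact (sum_chartCoord_smul ht _).symm

theorem dC_curvatureAt (hα : ContMDiff 𝓘(ℝ, EZ) 𝓘(ℝ, E) ∞ α) (hl : l.IsSmoothAt z)
    (hd : ∀ᶠ y in 𝓝 z, ∀ ξ, dC E EZ α y (l y ξ) = ξ.1)
    (ha : SmoothNear a (α z)) (hb : SmoothNear b (α z)) :
    dC E EZ α z (curvatureAt l a b z) = 0 := by
  change dC E EZ α z (bracket _ _ z - l.ofField _ z) = 0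
  rw [map_sub, bracket_related hα.contMDiffAt (hl.ofField ha).smoothAt (hl.ofField hb).smoothAt
    ha.smoothAt hb.smoothAt (hd.mono fun y hy => hy _) (hd.mono fun y hy => hy _), sub_eq_zero]
  exact (hd.self_of_nhds ⟨bracket a b (α z), trivial⟩).symm

theorem smoothNear_curvatureAt (hl : l.IsSmoothAt z) (ha : SmoothNear a (α z))
    (hb : SmoothNear b (α z)) : SmoothNear (curvatureAt l a b) z :=
  ((hl.ofField ha).bracket (hl.ofField hb)).sub (hl.ofField (ha.bracket hb))

/-- By the Jacobi identity, brackets of fields that preserve `T̄_rel` again preserve it. The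
condition is needed near `z`, since the inner bracket has to be a local section of `T̄_rel`. -/
theorem preservesAt_curvatureAt {R : RelComplexStructure E EZ α}
    (hα : ContMDiff 𝓘(ℝ, EZ) 𝓘(ℝ, E) ∞ α) (hl : l.IsSmoothAt z)
    (hh : ∀ᶠ y in 𝓝 z, l.IsVerticallyHolomorphicAt R y)
    (ha : SmoothNear a (α z)) (hb : SmoothNear b (α z)) :
    PreservesAt R.bar (curvatureAt l a b) z := by
  have hha : ∀ {a : ∀ s : S, CT E s}, SmoothNear a (α z) →
      ∀ᶠ y in 𝓝 z, PreservesAt R.bar (l.ofField a) y := fun {a} ha => by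
    filter_upwards [hh, hα.continuous.continuousAt.eventually ha.eventually] with y h1 h2
    exact h1 (fun s => ⟨a s, trivial⟩) h2
  have hsa := hl.ofField ha
  have hsb := hl.ofField hb
  refine PreservesAt.sub ?_ (hsa.bracket hsb).smoothAt (hha (ha.bracket hb)).self_of_nhds
    (hl.ofField (ha.bracket hb)).smoothAt
  intro u hu
  have hbr : ∀ {V : ∀ z : Z, CT EZ z}, SmoothNear V z → (∀ᶠ y in 𝓝 z, PreservesAt R.bar V y) →
      IsSectionAt R.bar (bracket u V) z := fun {V} hV h => by
    refine (hu.smoothNear.bracket hV).isSectionAt ?_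
    filter_upwards [h, hu.eventually] with y h1 h2 using h1 u h2
  rw [jacobi hu.smoothAt hsa.smoothAt hsb.smoothAt]
  refine Submodule.add_mem _ ((hha hb).self_of_nhds _ (hbr hsa (hha ha))) ?_
  rw [bracket_swap]
  exact Submodule.neg_mem _ ((hha ha).self_of_nhds _ (hbr hsb (hha hb)))

end Raw

/-! ### The curvature form of a vertically holomorphic operator -/

variable {R : RelComplexStructure E EZ α}
  {D : BaseMap R (fun s : S => (⊤ : Submodule ℂ (CT E s)))} {K : BaseTwoForm E EZ α}

/-- `K` is the curvature of `D`: it has values in `T_rel`, and `K(a, b)` represents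
`[X, Y] - D([a, b])` for all local lifts `X`, `Y` of `D(a)`, `D(b)`. -/
structure IsCurvatureForm (R : RelComplexStructure E EZ α)
    (D : BaseMap R (fun s : S => (⊤ : Submodule ℂ (CT E s)))) (K : BaseTwoForm E EZ α) :
    Prop where
  mem : ∀ z ξ η, K z ξ η ∈ R.T z
  mkQ_bracket : ∀ (z : Z) (a b : ∀ s : S, CT E s) (X Y : ∀ z : Z, CT EZ z),
    SmoothNear a (α z) → SmoothNear b (α z) → SmoothNear X z → SmoothNear Y z →
    (∀ᶠ y in 𝓝 z, (R.bar y).mkQ (X y) = D y ⟨a (α y), trivial⟩) →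
    (∀ᶠ y in 𝓝 z, (R.bar y).mkQ (Y y) = D y ⟨b (α y), trivial⟩) →
    (R.bar z).mkQ (bracket X Y z) = (R.bar z).mkQ (K z (a (α z)) (b (α z)))
      + D z ⟨bracket a b (α z), trivial⟩

/-- For one lift satisfying the lifting condition, the curvature expression is tensorial and
vertical, so its values on a coordinate frame, projected to `T_rel`, define `K`. Other
representatives `X`, `Y` differ from this lift by sections of `T̄_rel`, and the lifting condition
keeps the resulting brackets in `T̄_rel`. -/
theorem exists_curvature_at (hα : ContMDiff 𝓘(ℝ, EZ) 𝓘(ℝ, E) ∞ α)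
    (hD : ∀ z ξ, R.proj z (D z ξ) = ξ.1) (hh : IsVerticallyHolomorphic R D) (z : Z) :
    ∃ K : CT E (α z) →ₗ[ℂ] CT E (α z) →ₗ[ℂ] CT EZ z, (∀ ξ η, K ξ η ∈ R.T z) ∧
    ∀ (a b : ∀ s : S, CT E s) (X Y : ∀ z : Z, CT EZ z),
    SmoothNear a (α z) → SmoothNear b (α z) → SmoothNear X z → SmoothNear Y z →
    (∀ᶠ y in 𝓝 z, (R.bar y).mkQ (X y) = D y ⟨a (α y), trivial⟩) →
    (∀ᶠ y in 𝓝 z, (R.bar y).mkQ (Y y) = D y ⟨b (α y), trivial⟩) →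
    (R.bar z).mkQ (bracket X Y z) = (R.bar z).mkQ (K (a (α z)) (b (α z)))
      + D z ⟨bracket a b (α z), trivial⟩ := by
  obtain ⟨l, hl, hlh⟩ := (isVerticallyHolomorphic_iff hα.continuous).1 hh z
  have hd := hl.dC_eq hD
  let e := chartFrame E (α z)
  let c := fun i => chartCoord E (α z) i (α z)
  let K : CT E (α z) →ₗ[ℂ] CT E (α z) →ₗ[ℂ] CT EZ z := LinearMap.mk₂ ℂ
    (fun ξ η => ∑ i, c i ξ • ∑ j, c j η • R.projT z (curvatureAt l (e i) (e j) z))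
    (fun _ _ _ => by simp only [map_add, add_smul, Finset.sum_add_distrib])
    (fun _ _ _ => by simp only [map_smul, smul_assoc, Finset.smul_sum])
    (fun _ _ _ => by simp only [map_add, add_smul, smul_add, Finset.sum_add_distrib])
    (fun r _ _ => by
      simp only [map_smul, smul_assoc, Finset.smul_sum]
      exact Finset.sum_congr rfl fun i _ => Finset.sum_congr rfl fun j _ => smul_comm _ _ _)
  have hK : ∀ a b, SmoothNear a (α z) → SmoothNear b (α z) →
      K (a (α z)) (b (α z)) = R.projT z (curvatureAt l a b z) := fun a b ha hb => by
    have hs : ∀ i, SmoothNear (e i) (α z) := fun i => by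
      filter_upwards [(chartAt E (α z)).open_source.mem_nhds (mem_chart_source E (α z))]
        with t ht using smoothAt_chartFrame i ht
    have h1 : ∀ i, curvatureAt l (e i) b z
        = ∑ j, c j (b (α z)) • curvatureAt l (e i) (e j) z := fun i =>
      curvatureAt_eq_sum_right hα hl.isSmoothAt hd hb
    have h2 : curvatureAt l a b z = ∑ i, c i (a (α z)) • curvatureAt l (e i) b z := by
      rw [curvatureAt_swap, curvatureAt_eq_sum_right hα hl.isSmoothAt hd ha,
        ← Finset.sum_neg_distrib]
      refine Finset.sum_congr rfl fun i _ => ?_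
      rw [← smul_neg, ← curvatureAt_swap]
    change ∑ i, c i (a (α z)) • ∑ j, c j (b (α z)) •
      R.projT z (curvatureAt l (e i) (e j) z) = _
    rw [h2, map_sum]
    refine Finset.sum_congr rfl fun i _ => ?_
    rw [map_smul, h1, map_sum]
    simp only [map_smul]
  refine ⟨K, fun ξ η => ?_, fun a b X Y ha hb hX hY hXa hYb => ?_⟩
  · change ∑ i, c i ξ • ∑ j, c j η • R.projT z (curvatureAt l (e i) (e j) z) ∈ _
    exact Submodule.sum_mem _ fun i _ => Submodule.smul_mem _ _ (Submodule.sum_mem _ fun j _ =>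
      Submodule.smul_mem _ _ (R.projT_mem _))
  rw [hK a b ha hb, R.mkQ_projT (dC_curvatureAt hα hl.isSmoothAt hd ha hb),
    ← hl.self_of_nhds.2, ← map_add]
  have hsa := hl.isSmoothAt.ofField ha
  have hsb := hl.isSmoothAt.ofField hb
  have e1 : curvatureAt l a b z + l z ⟨bracket a b (α z), trivial⟩
      = bracket (l.ofField a) (l.ofField b) z := sub_add_cancel _ _
  rw [e1, R.mkQ_eq_iff]
  have hx : IsSectionAt R.bar (X - l.ofField a) z := by
    refine (hX.sub hsa).isSectionAt ?_
    filter_upwards [hXa, hl] with y h1 h2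
    exact R.mkQ_eq_iff.1 (h1.trans (h2.2 _).symm)
  have hy : IsSectionAt R.bar (Y - l.ofField b) z := by
    refine (hY.sub hsb).isSectionAt ?_
    filter_upwards [hYb, hl] with y h1 h2
    exact R.mkQ_eq_iff.1 (h1.trans (h2.2 _).symm)
  -- With `e3`, this writes the change of the bracket through brackets that have a factor in
  -- `T̄_rel`.
  have e2 : bracket X Y z - bracket (l.ofField a) (l.ofField b) z
      = bracket (X - l.ofField a) Y z - bracket (Y - l.ofField b) (l.ofField a) z := by
    rw [bracket_sub_left hX.smoothAt hsa.smoothAt, bracket_sub_left hY.smoothAt hsb.smoothAt,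
      bracket_swap (V := Y), bracket_swap (V := l.ofField b)]
    abel
  have hva := hlh.self_of_nhds (fun s => ⟨a s, trivial⟩) ha
  have hvb := hlh.self_of_nhds (fun s => ⟨b s, trivial⟩) hb
  have e3 : bracket (X - l.ofField a) Y z = bracket (X - l.ofField a) (Y - l.ofField b) z
      + bracket (X - l.ofField a) (l.ofField b) z := by
    rw [bracket_sub_right hY.smoothAt hsb.smoothAt, sub_add_cancel]
  rw [e2, e3]
  exact Submodule.sub_mem _ (Submodule.add_mem _ (R.involutive_bar.bracket_mem hx hy)
    (hvb _ hx)) (hva _ hy)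

theorem exists_isCurvatureForm (hα : ContMDiff 𝓘(ℝ, EZ) 𝓘(ℝ, E) ∞ α)
    (hD : ∀ z ξ, R.proj z (D z ξ) = ξ.1) (hh : IsVerticallyHolomorphic R D) :
    ∃ K, IsCurvatureForm R D K := by
  choose K h1 h2 using exists_curvature_at hα hD hh
  exact ⟨K, h1, h2⟩

namespace IsCurvatureForm

variable {a b : ∀ s : S, CT E s}
  {l : LiftMap EZ α (fun s : S => (⊤ : Submodule ℂ (CT E s)))}

/-- `K` is chosen separately at each point; expressing it through a single lift gives control on a
whole neighbourhood, from which its smoothness and behaviour along the fibres follow. -/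
theorem eq_projT (hK : IsCurvatureForm R D K) (hα : ContMDiff 𝓘(ℝ, EZ) 𝓘(ℝ, E) ∞ α)
    (hD : ∀ z ξ, R.proj z (D z ξ) = ξ.1) (hl : IsLiftAt R D l z)
    (ha : SmoothNear a (α z)) (hb : SmoothNear b (α z)) :
    K z (a (α z)) (b (α z)) = R.projT z (curvatureAt l a b z) := by
  have h := hK.mkQ_bracket z a b (l.ofField a) (l.ofField b) ha hb (hl.isSmoothAt.ofField ha)
    (hl.isSmoothAt.ofField hb) (hl.mono fun y hy => hy.2 _) (hl.mono fun y hy => hy.2 _)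
  rw [← hl.self_of_nhds.2, ← sub_eq_iff_eq_add, ← map_sub] at h
  have h1 : (R.bar z).mkQ (curvatureAt l a b z) = (R.bar z).mkQ (K z (a (α z)) (b (α z))) := h
  rw [← R.mkQ_projT (dC_curvatureAt hα hl.isSmoothAt (hl.dC_eq hD) ha hb), R.mkQ_eq_iff] at h1
  exact (sub_eq_zero.1 (R.eq_zero_of_mem (Submodule.sub_mem _ (R.projT_mem _) (hK.mem _ _ _))
    h1)).symm

theorem alternating (hK : IsCurvatureForm R D K) (hα : Continuous α) (hD : IsSplitting R D)
    (z : Z) (ξ : CT E (α z)) : K z ξ ξ = 0 := by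
  obtain ⟨l, hl⟩ := ((isSplitting_iff hα).1 hD).2 z
  obtain ⟨a, ha, rfl⟩ := exists_smoothNear_extension (α z) ξ
  have h := hK.mkQ_bracket z a a (l.ofField a) (l.ofField a) ha ha (hl.isSmoothAt.ofField ha)
    (hl.isSmoothAt.ofField ha) (hl.mono fun y hy => hy.2 _) (hl.mono fun y hy => hy.2 _)
  have h1 : D z ⟨bracket a a (α z), trivial⟩ = 0 :=
    (congrArg (D z) (Subtype.ext bracket_self :
      (⟨bracket a a (α z), trivial⟩ : (⊤ : Submodule ℂ (CT E (α z)))) = 0)).trans (map_zero _)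
  rw [bracket_self, map_zero, h1, add_zero, eq_comm] at h
  exact R.eq_zero_of_mem (hK.mem _ _ _) ((Submodule.Quotient.mk_eq_zero _).1 h)

theorem eventually_eq (hK : IsCurvatureForm R D K) (hα : ContMDiff 𝓘(ℝ, EZ) 𝓘(ℝ, E) ∞ α)
    (hD : ∀ z ξ, R.proj z (D z ξ) = ξ.1) (hl : IsLiftAt R D l z)
    (ha : SmoothNear a (α z)) (hb : SmoothNear b (α z)) :
    ∀ᶠ y in 𝓝 z, K y (a (α y)) (b (α y)) = R.projT y (curvatureAt l a b y) := by
  filter_upwards [hl.eventually, hα.continuous.continuousAt.eventually ha.eventually,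
    hα.continuous.continuousAt.eventually hb.eventually] with y h1 h2 h3
  exact hK.eq_projT hα hD h1 h2 h3

theorem eventually_dC (hα : ContMDiff 𝓘(ℝ, EZ) 𝓘(ℝ, E) ∞ α)
    (hD : ∀ z ξ, R.proj z (D z ξ) = ξ.1) (hl : IsLiftAt R D l z)
    (ha : SmoothNear a (α z)) (hb : SmoothNear b (α z)) :
    ∀ᶠ y in 𝓝 z, dC E EZ α y (curvatureAt l a b y) = 0 := by
  filter_upwards [hl.eventually, hα.continuous.continuousAt.eventually ha.eventually,
    hα.continuous.continuousAt.eventually hb.eventually] with y h1 h2 h3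
  exact dC_curvatureAt hα h1.isSmoothAt (h1.dC_eq hD) h2 h3

theorem smoothNear (hK : IsCurvatureForm R D K) (hα : ContMDiff 𝓘(ℝ, EZ) 𝓘(ℝ, E) ∞ α)
    (hD : IsSplitting R D) (ha : SmoothNear a (α z)) (hb : SmoothNear b (α z)) :
    SmoothNear (fun y => K y (a (α y)) (b (α y))) z := by
  have hs := (isSplitting_iff hα.continuous).1 hD
  obtain ⟨l, hl⟩ := hs.2 z
  exact SmoothNear.congr (R.smoothAt_projT (smoothNear_curvatureAt hl.isSmoothAt ha hb)
    (eventually_dC hα hs.1 hl ha hb)) (hK.eventually_eq hα hs.1 hl ha hb)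

/-- `K(a, b)` differs from the curvature expression of a lift satisfying the lifting condition by a
section of `T̄_rel`, and both of these preserve `T̄_rel`. -/
theorem preservesAt (hK : IsCurvatureForm R D K) (hα : ContMDiff 𝓘(ℝ, EZ) 𝓘(ℝ, E) ∞ α)
    (hD : IsSplitting R D) (hh : IsVerticallyHolomorphic R D) (ha : SmoothNear a (α z))
    (hb : SmoothNear b (α z)) :
    PreservesAt R.bar (fun y => K y (a (α y)) (b (α y))) z := by
  obtain ⟨l, hl, hlh⟩ := (isVerticallyHolomorphic_iff hα.continuous).1 hh z
  have hs := smoothNear_curvatureAt hl.isSmoothAt ha hb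
  have hKs := hK.smoothNear hα hD ha hb
  have hsec : IsSectionAt R.bar
      (curvatureAt l a b - fun y => K y (a (α y)) (b (α y))) z := by
    refine (hs.sub hKs).isSectionAt ?_
    filter_upwards [hK.eventually_eq hα hD.splits hl ha hb, eventually_dC hα hD.splits hl ha hb]
      with y h1 h2
    change curvatureAt l a b y - K y (a (α y)) (b (α y)) ∈ R.bar y
    rw [h1]
    exact R.sub_projT_mem h2
  refine ((preservesAt_curvatureAt hα hl.isSmoothAt hlh ha hb).sub hs.smoothAt
    (R.preservesAt_of_section hsec) hsec.smoothAt).congr (Eventually.of_forall fun y => ?_)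
  exact (sub_sub_cancel _ _).symm

end IsCurvatureForm

/-! ### Transport of vertical two-forms along `β` -/

section Transport

variable {A B : RelComplexStructure E EZ α} {β : BundleAut A B}

/-- `β` maps vertical vector fields which preserve `T̄_A` to fields which preserve `T̄_B`. -/
theorem BundleAut.RespectsLifting.preservesAt [Nontrivial E]
    (hα : ContMDiff 𝓘(ℝ, EZ) 𝓘(ℝ, E) ∞ α) (hβ : β.RespectsLifting (T10 E))
    {l : LiftMap EZ α (T10 E)} (hl : ∀ᶠ y in 𝓝 z, l.IsSmoothAt y)
    (hd : ∀ᶠ y in 𝓝 z, ∀ ξ, dC E EZ α y (l y ξ) = ξ.1)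
    (hh : ∀ᶠ y in 𝓝 z, l.IsVerticallyHolomorphicAt A y) {V : ∀ z : Z, CT EZ z}
    (hV : IsSectionAt A.T V z) (hp : ∀ᶠ y in 𝓝 z, PreservesAt A.bar V y) :
    PreservesAt B.bar (fun y => β.cmap y (V y)) z := by
  have hαc := hα.continuous.continuousAt (x := z)
  -- One nonzero direction of the base is needed to carry `V`.
  let k : Fin (Module.finrank ℂ E) := ⟨0, Module.finrank_pos⟩
  have hfr := isFrameAt_holFrame (E := E) (mem_chart_source E (α z))
  obtain ⟨ψ, hψ⟩ := exists_dual_frame (fun k => hfr.mono fun y hy => hy.1 k)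
    hfr.self_of_nhds.2.1
  -- `V` is encoded as a difference of two lifts, because the hypothesis on `β` applies to lifts
  -- only. The coefficient `ψ k` is evaluated on base fields, hence constant along the fibres, so
  -- `l'` inherits the lifting condition from `l` and `V`.
  let l' : LiftMap EZ α (T10 E) := fun y =>
    l y + (((ψ k (α y)).comp (Submodule.subtype _)).smulRight (V y))
  have hψ' := hαc.eventually (eventually_eventually_nhds.2 hψ)
  have hfn : ∀ᶠ y in 𝓝 z, ∀ a : ∀ s : S, T10 E s, SmoothNear (fun s => (a s).1) (α y) →
      ∀ᶠ s in 𝓝 (α y), FnSmoothAt (E := E) (fun s => ψ k s (a s).1) s := by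
    filter_upwards [hψ'] with y h1 a ha
    filter_upwards [h1, ha] with s h2 h3 using h2.2 k _ h3
  have hl' : ∀ᶠ y in 𝓝 z, l'.IsSmoothAt y := by
    filter_upwards [hl, hfn, hV.eventually] with y h1 h2 h3 a ha
    refine (h1 a ha).add ?_
    filter_upwards [hα.continuous.continuousAt.eventually (h2 a ha), h3] with x h4 h5
    exact h5.1.smul (h4.comp x hα.contMDiffAt)
  have hd' : ∀ᶠ y in 𝓝 z, ∀ ξ, dC E EZ α y (l' y ξ) = ξ.1 := by
    filter_upwards [hd, hV] with y h1 h2 ξ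
    change dC E EZ α y (l y ξ + ψ k (α y) ξ • V y) = _
    rw [map_add, map_smul, h1, A.dC_of_mem_T h2.2, smul_zero, add_zero]
  have hh' : ∀ᶠ y in 𝓝 z, l'.IsVerticallyHolomorphicAt A y := by
    filter_upwards [hh, hl, hfn, hV, hp] with y h1 h2 h3 h4 h5 a ha
    have h6 := (h3 a ha).self_of_nhds
    let f : S → ℂ := fun s => ψ k s (a s).1
    have h7 : FnSmoothAt (E := EZ) (f ∘ α) y := h6.comp y hα.contMDiffAt
    have h8 : PreservesAt A.bar ((f ∘ α) • V) y := PreservesAt.smul h7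
      (fun u hu => cderiv_comp_vertical (g := f) hα.contMDiffAt h6 (A.dC_of_mem_bar hu.mem))
      h5 h4.1
    exact ((h1 a ha).add (h2 a ha).smoothAt h8 (h4.1.smul h7)).congr
      (Eventually.of_forall fun _ => rfl)
  have hB := ((hβ.eventually_iff hα.continuous hl hd).1 hh).self_of_nhds
  have hB' := ((hβ.eventually_iff hα.continuous hl' hd').1 hh').self_of_nhds
  have ha : SmoothNear (fun s => (holFrame E (α z) k s : CT E s)) (α z) :=
    hfr.mono fun y hy => hy.1 k
  refine ((hB' _ ha).sub (β.isSmoothAt_cmap hl'.self_of_nhds _ ha).smoothAt (hB _ ha)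
    (β.isSmoothAt_cmap hl.self_of_nhds _ ha).smoothAt).congr ?_
  filter_upwards [hαc.eventually hψ] with y h1
  -- On the `k`-th frame field the difference `l' - l` is exactly `V`.
  have h2 : ψ k (α y) (holFrame E (α z) k (α y)) = 1 := by
    have := h1.1 k (Pi.single k 1)
    rw [Finset.sum_eq_single k (fun j _ hj => by rw [Pi.single_eq_of_ne hj, zero_smul])
      (by simp), Pi.single_eq_same, one_smul] at this
    exact this
  change β.cmap y (V y) = β.cmap y (l y _ + ψ k (α y) (holFrame E (α z) k (α y) : CT E (α y))
    • V y) - β.cmap y (l y _)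
  rw [h2, one_smul, map_add, add_sub_cancel_left]

variable {D : BaseMap A (fun s : S => (⊤ : Submodule ℂ (CT E s)))} {c : BaseMap A (T10 E)}

theorem isVerticalTwoForm_of_germ {G : BaseTwoForm E EZ α} (hα : Continuous α)
    (h0 : ∀ z ξ, G z ξ ξ = 0) (hm : ∀ z ξ η, G z ξ η ∈ B.T z)
    (hs : ∀ z (a b : ∀ s : S, CT E s), SmoothNear a (α z) → SmoothNear b (α z) →
      SmoothNear (fun y => G y (a (α y)) (b (α y))) z)
    (hp : ∀ z (a b : ∀ s : S, CT E s), SmoothNear a (α z) → SmoothNear b (α z) →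
      PreservesAt B.bar (fun y => G y (a (α y)) (b (α y))) z) : IsVerticalTwoForm B G where
  alternating := h0
  mem := hm
  smooth _ a b hW ha hb := smoothOn_of_smoothAt fun z hz =>
    (hs z a b (ha.eventually hW hz) (hb.eventually hW hz)).smoothAt
  holomorphic _ a b hW ha hb := (bracketPreserves_iff (hW.preimage hα)).2 fun z hz =>
    hp z a b (ha.eventually hW hz) (hb.eventually hW hz)

theorem IsVerticalTwoForm.smoothNear {G : BaseTwoForm E EZ α} (hα : Continuous α)
    (hG : IsVerticalTwoForm B G) {a b : ∀ s : S, CT E s} (ha : SmoothNear a (α z))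
    (hb : SmoothNear b (α z)) : SmoothNear (fun y => G y (a (α y)) (b (α y))) z := by
  obtain ⟨W, h, hW, hz⟩ := eventually_nhds_iff.1 (ha.and hb)
  exact (hG.smooth W a b hW (smoothOn_of_smoothAt fun s hs => (h s hs).1)
    (smoothOn_of_smoothAt fun s hs => (h s hs).2)).eventually (hW.preimage hα) hz

theorem IsVerticalTwoForm.preservesAt {G : BaseTwoForm E EZ α} (hα : Continuous α)
    (hG : IsVerticalTwoForm B G) {a b : ∀ s : S, CT E s} (ha : SmoothNear a (α z))
    (hb : SmoothNear b (α z)) :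
    PreservesAt B.bar (fun y => G y (a (α y)) (b (α y))) z := by
  obtain ⟨W, h, hW, hz⟩ := eventually_nhds_iff.1 (ha.and hb)
  exact (bracketPreserves_iff (hW.preimage hα)).1 (hG.holomorphic W a b hW
    (smoothOn_of_smoothAt fun s hs => (h s hs).1)
    (smoothOn_of_smoothAt fun s hs => (h s hs).2)) z hz

theorem IsCurvatureForm.isCurvatureTensor (hα : ContMDiff 𝓘(ℝ, EZ) 𝓘(ℝ, E) ∞ α)
    (hβ : β.RespectsLifting (T10 E)) (hD : IsSplitting A D) (hh : IsVerticallyHolomorphic A D)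
    (hc : IsSplitting A c) (hch : IsVerticallyHolomorphic A c) (hK : IsCurvatureForm A D K) :
    IsCurvatureTensor β D (fun z => (K z).compr₂ (β.cmap z)) := by
  refine ⟨isVerticalTwoForm_of_germ hα.continuous ?_ ?_ ?_ ?_, ?_⟩
  · intro z ξ
    rw [LinearMap.compr₂_apply, hK.alternating hα.continuous hD, map_zero]
  · intro z ξ η
    exact β.cmap_mem_T (hK.mem z ξ η)
  · intro z a b ha hb
    exact β.smoothNear_cmap (hK.smoothNear hα hD ha hb)
  · intro z a b ha hb
    -- Over a zero-dimensional base no direction can carry the difference of lifts, but then the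
    -- form itself is zero.
    rcases subsingleton_or_nontrivial E with hE | hE
    · have h0 : ∀ y, (K y (a (α y))) (b (α y)) = 0 := fun y => by
        have h1 : a (α y) = 0 := by
          ext
          · exact hE.elim _ _
          · exact hE.elim _ _
        rw [h1, map_zero]
        rfl
      intro u hu
      rw [bracket_congr (V' := u) (W' := 0) (Eventually.of_forall fun _ => rfl)
        (Eventually.of_forall fun y => by
          rw [LinearMap.compr₂_apply, h0, map_zero]; rfl), bracket_zero_right]
      exact Submodule.zero_mem _
    · obtain ⟨l, hl, hlh⟩ := (isVerticallyHolomorphic_iff hα.continuous).1 hch z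
      refine hβ.preservesAt hα (hl.mono fun y hy => hy.1) (hl.dC_eq hc.splits) hlh
        ((hK.smoothNear hα hD ha hb).isSectionAt (Eventually.of_forall fun y => hK.mem _ _ _)) ?_
      filter_upwards [hα.continuous.continuousAt.eventually ha.eventually,
        hα.continuous.continuousAt.eventually hb.eventually] with y h1 h2
      exact hK.preservesAt hα hD hh h1 h2
  · intro W a b U X Y L hW ha hb hU hUW hX hY hL hXa hYb hLab z hz
    rw [LinearMap.compr₂_apply, β.cinv_cmap, map_sub, hLab z hz, eq_sub_iff_add_eq]
    exact (hK.mkQ_bracket z a b X Y (ha.eventually hW (hUW hz)) (hb.eventually hW (hUW hz))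
      (hX.eventually hU hz) (hY.eventually hU hz)
      (by filter_upwards [hU.mem_nhds hz] with y hy using hXa y hy)
      (by filter_upwards [hU.mem_nhds hz] with y hy using hYb y hy)).symm

/-- Uniqueness: `β⁻¹` of the value of `G` and the value of `K` both lie in `T_A` and agree modulo
`T̄_A`, which meets `T_A` only in zero. Arbitrary base vectors are reached by extending them to
smooth local fields. -/
theorem IsCurvatureTensor.eq_compr₂ (hα : Continuous α) (hD : IsSplitting A D)
    (hK : IsCurvatureForm A D K) {G : BaseTwoForm E EZ α} (hG : IsCurvatureTensor β D G) :
    G = fun z => (K z).compr₂ (β.cmap z) := by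
  funext z
  ext1 ξ
  ext1 η
  obtain ⟨l, hl⟩ := ((isSplitting_iff hα).1 hD).2 z
  obtain ⟨a, ha, rfl⟩ := exists_smoothNear_extension (α z) ξ
  obtain ⟨b, hb, rfl⟩ := exists_smoothNear_extension (α z) η
  obtain ⟨W, hW, hWo, hzW⟩ := eventually_nhds_iff.1 (ha.and hb)
  have hWa : SmoothOn a W := smoothOn_of_smoothAt fun s hs => (hW s hs).1
  have hWb : SmoothOn b W := smoothOn_of_smoothAt fun s hs => (hW s hs).2
  have h1 := (hα.continuousAt.eventually (hWo.mem_nhds hzW)).and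
    ((hl.isSmoothAt.ofField ha).and ((hl.isSmoothAt.ofField hb).and
      ((hl.isSmoothAt.ofField (ha.bracket hb)).and hl)))
  obtain ⟨U, hU, hUo, hzU⟩ := eventually_nhds_iff.1 h1
  have h2 := hG.curvature W a b U (l.ofField a) (l.ofField b) (l.ofField (bracket a b)) hWo hWa
    hWb hUo (fun y hy => (hU y hy).1) (smoothOn_of_smoothAt fun y hy => (hU y hy).2.1)
    (smoothOn_of_smoothAt fun y hy => (hU y hy).2.2.1)
    (smoothOn_of_smoothAt fun y hy => (hU y hy).2.2.2.1)
    (fun y hy => (hU y hy).2.2.2.2.2 _) (fun y hy => (hU y hy).2.2.2.2.2 _)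
    (fun y hy => (hU y hy).2.2.2.2.2 _) z hzU
  have h3 := hK.mkQ_bracket z a b _ _ ha hb (hl.isSmoothAt.ofField ha)
    (hl.isSmoothAt.ofField hb) (hl.mono fun y hy => hy.2 _) (hl.mono fun y hy => hy.2 _)
  have h4 : (A.bar z).mkQ (l.ofField (bracket a b) z) = D z ⟨bracket a b (α z), trivial⟩ :=
    hl.self_of_nhds.2 _
  rw [map_sub, h3, h4, add_sub_cancel_right, A.mkQ_eq_iff] at h2
  have h5 := sub_eq_zero.1 (A.eq_zero_of_mem (Submodule.sub_mem _
    (β.cinv_mem_T (hG.isVerticalTwoForm.mem z _ _)) (hK.mem z _ _)) h2)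
  rw [LinearMap.compr₂_apply, ← h5, β.cmap_cinv]

end Transport

/-! ### The decomposition into types -/

section Types

variable {B : RelComplexStructure E EZ α} {G : BaseTwoForm E EZ α}

theorem IsVerticalTwoForm.swap (hG : IsVerticalTwoForm B G) (z : Z) (ξ η : CT E (α z)) :
    G z ξ η = -G z η ξ := by
  have h := hG.alternating z (ξ + η)
  simp only [map_add, LinearMap.add_apply, hG.alternating, zero_add, add_zero] at h
  rw [add_comm] at h
  exact eq_neg_of_add_eq_zero_left h

/-- The projections `p` and `q` to `T_S` and `T̄_S` take smooth fields to smooth fields, so each of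
the pieces obtained by composing with them is again a differentiable vertical form. -/
theorem IsVerticalTwoForm.exists_types (hα : Continuous α) (hG : IsVerticalTwoForm B G) :
    ∃ G02 G11 G20 : BaseTwoForm E EZ α,
      IsVerticalTwoForm B G02 ∧ HasType02 G02 ∧ IsVerticalTwoForm B G11 ∧ HasType11 G11 ∧
      IsVerticalTwoForm B G20 ∧ HasType20 G20 ∧ G = G02 + G11 + G20 := by
  let p : ∀ s : S, CT E s →ₗ[ℂ] CT E s := fun s => (Submodule.subtype _).comp (proj10 s)
  let q : ∀ s : S, CT E s →ₗ[ℂ] CT E s := fun s => (Submodule.subtype _).comp (proj01 s)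
  have hp : ∀ a s, SmoothNear a s → SmoothNear (fun s => p s (a s)) s := fun _ _ ha => ha.proj10
  have hq : ∀ a s, SmoothNear a s → SmoothNear (fun s => q s (a s)) s := fun _ _ ha => ha.proj01
  have hS : ∀ r t : ∀ s : S, CT E s →ₗ[ℂ] CT E s,
      (∀ a s, SmoothNear a s → SmoothNear (fun s => r s (a s)) s) →
      (∀ a s, SmoothNear a s → SmoothNear (fun s => t s (a s)) s) → ∀ z (a b : ∀ s : S, CT E s),
      SmoothNear a (α z) → SmoothNear b (α z) →
      SmoothNear (fun y => G y (r (α y) (a (α y))) (t (α y) (b (α y)))) z :=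
    fun r t hr ht z a b ha hb =>
      hG.smoothNear (a := fun s => r s (a s)) (b := fun s => t s (b s)) hα (hr a _ ha) (ht b _ hb)
  have hH : ∀ r t : ∀ s : S, CT E s →ₗ[ℂ] CT E s,
      (∀ a s, SmoothNear a s → SmoothNear (fun s => r s (a s)) s) →
      (∀ a s, SmoothNear a s → SmoothNear (fun s => t s (a s)) s) → ∀ z (a b : ∀ s : S, CT E s),
      SmoothNear a (α z) → SmoothNear b (α z) →
      PreservesAt B.bar (fun y => G y (r (α y) (a (α y))) (t (α y) (b (α y)))) z :=
    fun r t hr ht z a b ha hb =>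
      hG.preservesAt (a := fun s => r s (a s)) (b := fun s => t s (b s)) hα (hr a _ ha) (ht b _ hb)
  have hp1 : ∀ {s : S} {ξ : CT E s}, ξ ∈ T01 E s → p s ξ = 0 := fun {s ξ} h => by
    change ((proj10 s ξ : T10 E s) : CT E s) = 0
    rw [proj10_of_mem_T01 h]
    rfl
  have hq1 : ∀ {s : S} {ξ : CT E s}, ξ ∈ T10 E s → q s ξ = 0 := fun {s ξ} h => by
    change ((proj01 s ξ : T01 E s) : CT E s) = 0
    rw [proj01_of_mem_T10 h]
    rfl
  refine ⟨fun z => (G z).compl₁₂ (q (α z)) (q (α z)),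
    fun z => (G z).compl₁₂ (p (α z)) (q (α z)) + (G z).compl₁₂ (q (α z)) (p (α z)),
    fun z => (G z).compl₁₂ (p (α z)) (p (α z)), ?_, ?_, ?_, ?_, ?_, ?_, ?_⟩
  · refine isVerticalTwoForm_of_germ hα (fun z ξ => hG.alternating z _)
      (fun z ξ η => hG.mem z _ _) (hS q q hq hq) (hH q q hq hq)
  · intro z ξ hξ η
    simp only [LinearMap.compl₁₂_apply, hq1 hξ, map_zero, LinearMap.zero_apply, and_self]
  · refine isVerticalTwoForm_of_germ hα (fun z ξ => ?_)
      (fun z ξ η => Submodule.add_mem _ (hG.mem z _ _) (hG.mem z _ _))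
      (fun z a b ha hb => (hS p q hp hq z a b ha hb).add (hS q p hq hp z a b ha hb))
      fun z a b ha hb => (hH p q hp hq z a b ha hb).add (hS p q hp hq z a b ha hb).smoothAt
        (hH q p hq hp z a b ha hb) (hS q p hq hp z a b ha hb).smoothAt
    change G z (p _ ξ) (q _ ξ) + G z (q _ ξ) (p _ ξ) = 0
    rw [hG.swap, neg_add_cancel]
  · intro z
    refine ⟨fun ξ hξ η hη => ?_, fun ξ hξ η hη => ?_⟩
    · simp only [LinearMap.add_apply, LinearMap.compl₁₂_apply, hq1 hξ, hq1 hη, map_zero,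
        LinearMap.zero_apply, add_zero]
    · simp only [LinearMap.add_apply, LinearMap.compl₁₂_apply, hp1 hξ, hp1 hη, map_zero,
        LinearMap.zero_apply, add_zero]
  · refine isVerticalTwoForm_of_germ hα (fun z ξ => hG.alternating z _)
      (fun z ξ η => hG.mem z _ _) (hS p p hp hp) (hH p p hp hp)
  · intro z ξ hξ η
    simp only [LinearMap.compl₁₂_apply, hp1 hξ, map_zero, LinearMap.zero_apply, and_self]
  · funext z
    ext1 ξ
    ext1 η
    change G z ξ η = G z (q _ ξ) (q _ η) + (G z (p _ ξ) (q _ η) + G z (q _ ξ) (p _ η))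
      + G z (p _ ξ) (p _ η)
    conv_lhs => rw [← proj10_add_proj01 (α z) ξ, ← proj10_add_proj01 (α z) η]
    change G z (p _ ξ + q _ ξ) (p _ η + q _ η) = _
    simp only [map_add, LinearMap.add_apply]
    abel

end Types

end Bundle

/-! ## Flatness -/

section Bundle

variable {E EZ EF : Type*} [NormedAddCommGroup E] [NormedSpace ℂ E] [FiniteDimensional ℂ E]
  [NormedAddCommGroup EZ] [NormedSpace ℝ EZ] [FiniteDimensional ℝ EZ]
  [NormedAddCommGroup EF] [NormedSpace ℝ EF]
  {S Z : Type*} [TopologicalSpace S] [ChartedSpace E S]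
  [TopologicalSpace Z] [ChartedSpace EZ Z]
  [IsManifold 𝓘(ℂ, E) ω S] [IsManifold 𝓘(ℝ, EZ) ∞ Z] {α : Z → S} {z : Z}
  {R : RelComplexStructure E EZ α} {c : BaseMap R (T10 E)} {D : BaseMap R (T01 E)}
  {m : LiftMap EZ α (T10 E)} {l : LiftMap EZ α (T01 E)}

theorem totalOp_of_T10 (ξ : T10 E (α z)) : totalOp R c D z ⟨ξ.1, trivial⟩ = c z ξ := by
  change c z (proj10 (α z) ξ.1) + D z (proj01 (α z) ξ.1) = _
  rw [proj10_of_mem_T10 ξ.2, proj01_of_mem_T10 ξ.2, map_zero, add_zero]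

theorem totalOp_of_T01 (ξ : T01 E (α z)) : totalOp R c D z ⟨ξ.1, trivial⟩ = D z ξ := by
  change c z (proj10 (α z) ξ.1) + D z (proj01 (α z) ξ.1) = _
  rw [proj10_of_mem_T01 ξ.2, proj01_of_mem_T01 ξ.2, map_zero, zero_add]

theorem totalOp_of_eq_zero {ξ : CT E (α z)} (h : ξ = 0) :
    totalOp R c D z ⟨ξ, trivial⟩ = 0 := by
  subst h
  exact map_zero _

/-- The lift of an almost connection on `(α, T)` with values in `T`, given lifts `m` of the almost
connection and `l` of the `∂̄`-operator. -/
def acsLift (R : RelComplexStructure E EZ α) (m : LiftMap EZ α (T10 E))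
    (l : LiftMap EZ α (T01 E)) : LiftMap EZ α (T10 E) := fun z =>
  let n : T10 E (α z) →ₗ[ℂ] CT EZ z :=
    { toFun := fun ξ => Cx.conj (l z (conj10 ξ))
      map_add' := fun ξ η => by
        rw [← map_add, ← map_add]
        congr 2
        exact Subtype.ext (map_add Cx.conj _ _)
      map_smul' := fun r ξ => by
        have : conj10 (r • ξ) = starRingEnd ℂ r • conj10 ξ :=
          Subtype.ext (LinearMap.map_smulₛₗ Cx.conj _ _)
        rw [this, map_smul, LinearMap.map_smulₛₗ, Complex.conj_conj, RingHom.id_apply] }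
  -- `n` conjugates the lift of the `∂̄`-operator, so it has values in `T` but possibly the wrong
  -- class. Adding the `T_rel`-part of the vertical difference `m - n` corrects the class and stays
  -- in `T`.
  n + (R.projT z).comp (m z - n)

theorem acsLift_apply (ξ : T10 E (α z)) : acsLift R m l z ξ = Cx.conj (l z (conj10 ξ))
    + R.projT z (m z ξ - Cx.conj (l z (conj10 ξ))) := rfl

theorem dC_conj_lift (hl : ∀ ξ, dC E EZ α z (l z ξ) = ξ.1) (ξ : T10 E (α z)) :
    dC E EZ α z (Cx.conj (l z (conj10 ξ))) = ξ.1 := by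
  rw [dC_conj, hl, conj_conj10]

theorem acsLift_spec (hc : ∀ z ξ, R.proj z (c z ξ) = ξ.1) (hD : ∀ z ξ, R.proj z (D z ξ) = ξ.1)
    (hm : IsLiftAt R c m z) (hl : IsLiftAt R D l z) :
    (∀ ξ, acsLift R m l z ξ ∈ acsT R D z) ∧ IsLiftAt R c (acsLift R m l) z := by
  have hv : ∀ᶠ y in 𝓝 z, ∀ ξ, dC E EZ α y (m y ξ - Cx.conj (l y (conj10 ξ))) = 0 := by
    filter_upwards [hm.dC_eq hc, hl.dC_eq hD] with y h1 h2 ξ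
    rw [map_sub, h1, dC_conj_lift h2, sub_self]
  refine ⟨fun ξ => ?_, ?_⟩
  · rw [acsLift_apply]
    exact Submodule.add_mem _ (conj_mem_acsT (mem_barT_of_mkQ (hl.self_of_nhds.2 _)))
      (T_le_acsT (R.projT_mem _))
  · filter_upwards [hm, hl, hv, eventually_eventually_nhds.2 hv] with y h1 h2 h3 h4
    refine ⟨fun a ha => ?_, fun ξ => ?_⟩
    · have hs : SmoothNear (fun y => Cx.conj (l y (conj10 (a (α y))))) y :=
        (h2.1 (fun s => conj10 (a s)) ha.conj).conj
      exact hs.add (R.smoothAt_projT ((h1.1 a ha).sub hs) (h4.mono fun x hx => hx _))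
    · rw [acsLift_apply, map_add, R.mkQ_projT (h3 ξ), ← map_add, add_sub_cancel, h1.2]

theorem IsFrameAt.congr_subbundle {κ : Type*} {P Q : ∀ z : Z, Submodule ℂ (CT EZ z)}
    {e : κ → ∀ z : Z, CT EZ z} (he : IsFrameAt P e z) (h : ∀ᶠ y in 𝓝 z, P y = Q y) :
    IsFrameAt Q e z := by
  filter_upwards [he, h] with y h1 h2
  exact ⟨h1.1, h1.2.1, h1.2.2.trans h2⟩

/-- A lift maps a frame of a bundle on the base to a frame of its image. -/
theorem isFrameAt_range {P : ∀ s : S, Submodule ℂ (CT E s)} {κ : Type*} (hα : Continuous α)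
    {l : LiftMap EZ α P} {e : κ → ∀ s : S, P s}
    (he : IsFrameAt P (fun k s => (e k s).1) (α z)) (hl : l.IsSmoothAt z)
    (hd : ∀ᶠ y in 𝓝 z, ∀ ξ, dC E EZ α y (l y ξ) = ξ.1) [Finite κ] :
    IsFrameAt (fun y => LinearMap.range (l y)) (fun k y => l y (e k (α y))) z := by
  have hs : ∀ᶠ y in 𝓝 z, ∀ k, SmoothAt (fun y => l y (e k (α y))) y :=
    eventually_all.2 fun k => hl (e k) (he.mono fun y hy => hy.1 k)
  filter_upwards [hs, hd, hα.continuousAt.eventually he] with y h1 h2 h3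
  refine ⟨h1, ?_, ?_⟩
  · refine LinearIndependent.of_comp (dC E EZ α y) ?_
    have : (dC E EZ α y) ∘ (fun k => l y (e k (α y))) = fun k => (e k (α y)).1 :=
      funext fun k => h2 _
    rw [this]
    exact h3.2.1
  · have h4 : Submodule.span ℂ (range fun k => e k (α y)) = ⊤ := by
      apply Submodule.map_injective_of_injective (P (α y)).subtype_injective
      rw [Submodule.map_span, Submodule.map_top, Submodule.range_subtype, ← range_comp]
      exact h3.2.2
    rw [LinearMap.range_eq_map, ← h4, Submodule.map_span, ← range_comp]
    rfl

theorem bar_sup_range (hl : ∀ ξ, (R.bar z).mkQ (l z ξ) = D z ξ) :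
    R.bar z ⊔ LinearMap.range (l z) = barT R D z := by
  refine le_antisymm (sup_le bar_le_barT ?_) fun v hv => ?_
  · rintro _ ⟨ξ, rfl⟩
    exact mem_barT_of_mkQ (hl ξ)
  · obtain ⟨ξ, hξ⟩ := hv
    refine Submodule.mem_sup.2 ⟨v - l z ξ, ?_, l z ξ, ⟨ξ, rfl⟩, sub_add_cancel _ _⟩
    exact R.mkQ_eq_iff.1 (hξ.symm.trans (hl ξ).symm)

theorem bar_inf_range {P : ∀ s : S, Submodule ℂ (CT E s)} {l : LiftMap EZ α P}
    (hd : ∀ ξ, dC E EZ α z (l z ξ) = ξ.1) : R.bar z ⊓ LinearMap.range (l z) = ⊥ := by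
  rw [eq_bot_iff]
  rintro _ ⟨h, ξ, rfl⟩
  have h1 := hd ξ
  rw [R.dC_of_mem_bar h] at h1
  rw [show ξ = 0 from Subtype.ext h1.symm, map_zero]
  exact Submodule.zero_mem _

/-- `T` meets `T̄_rel` only in zero, so a vector of `T` is determined by its class modulo `T̄_rel`.
-/
theorem range_acsLift (hD : ∀ z ξ, R.proj z (D z ξ) = ξ.1) {n : LiftMap EZ α (T10 E)}
    (hn : ∀ ξ, n z ξ ∈ acsT R D z) (hnc : ∀ ξ, (R.bar z).mkQ (n z ξ) = c z ξ) :
    LinearMap.range (n z) = acsT R D z ⊓ (LinearMap.range (c z)).comap (R.bar z).mkQ := by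
  refine le_antisymm ?_ ?_
  · rintro _ ⟨ξ, rfl⟩
    exact ⟨hn ξ, ξ, (hnc ξ).symm⟩
  · rintro v ⟨hv, ξ, hξ⟩
    refine ⟨ξ, ?_⟩
    rw [eq_comm, ← sub_eq_zero]
    exact eq_zero_of_mem_acsT_of_mem_bar hD (Submodule.sub_mem _ hv (hn ξ))
      (R.mkQ_eq_iff.1 (hξ.symm.trans (hnc ξ).symm))

variable {K : BaseTwoForm E EZ α}

/-! ### Vanishing curvature yields a holomorphic flat bundle. -/

section Forward

/-- The form in which vanishing curvature is used. A single vanishing bracket at `α z` suffices,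
because the curvature identity evaluates the base bracket only there. -/
theorem IsCurvatureForm.bracket_mem_bar (hK : IsCurvatureForm R (totalOp R c D) 0)
    {a b : ∀ s : S, CT E s} {X Y : ∀ z : Z, CT EZ z} (ha : SmoothNear a (α z))
    (hb : SmoothNear b (α z)) (hX : SmoothNear X z) (hY : SmoothNear Y z)
    (hXa : ∀ᶠ y in 𝓝 z, (R.bar y).mkQ (X y) = totalOp R c D y ⟨a (α y), trivial⟩)
    (hYb : ∀ᶠ y in 𝓝 z, (R.bar y).mkQ (Y y) = totalOp R c D y ⟨b (α y), trivial⟩)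
    (h0 : bracket a b (α z) = 0) : bracket X Y z ∈ R.bar z := by
  have h := hK.mkQ_bracket z a b X Y ha hb hX hY hXa hYb
  rw [totalOp_of_eq_zero h0, add_zero] at h
  exact (Submodule.Quotient.mk_eq_zero _).1 (h.trans (map_zero _))

/-- The frame of `T̄_S` conjugate to the holomorphic coordinate frame. -/
def antiholFrame (s₀ : S) (k : Fin (Module.finrank ℂ E)) (s : S) : T01 E s :=
  conj10 (holFrame E s₀ k s)

theorem isFrameAt_antiholFrame (s : S) :
    IsFrameAt (T01 E) (fun k t => (antiholFrame (E := E) s k t : CT E t)) s :=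
  (isFrameAt_holFrame (mem_chart_source E s)).conj

theorem smoothNear_antiholFrame (s : S) (k : Fin (Module.finrank ℂ E)) :
    SmoothNear (fun t => (antiholFrame (E := E) s k t : CT E t)) s :=
  (isFrameAt_antiholFrame s).mono fun _ h => h.1 k

theorem smoothNear_holFrame (s : S) (k : Fin (Module.finrank ℂ E)) :
    SmoothNear (fun t => (holFrame E s k t : CT E t)) s :=
  (isFrameAt_holFrame (mem_chart_source E s)).mono fun _ h => h.1 k

theorem exists_frame_barT (hα : Continuous α) (hD : ∀ z ξ, R.proj z (D z ξ) = ξ.1)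
    (hl : IsLiftAt R D l z) : ∃ (n : ℕ) (e : Fin n → ∀ z : Z, CT EZ z),
      IsFrameAt R.bar e z ∧ IsFrameAt (barT R D)
        (Sum.elim e fun k y => l y (antiholFrame (α z) k (α y))) z := by
  obtain ⟨n, e, he⟩ := R.smooth_bar.exists_frame z
  refine ⟨n, e, he, ?_⟩
  have h1 := isFrameAt_range hα (isFrameAt_antiholFrame (α z)) hl.isSmoothAt (hl.dC_eq hD)
  refine (he.sumElim h1 ?_).congr_subbundle ?_
  · filter_upwards [hl.dC_eq hD] with y hy using bar_inf_range hy
  · filter_upwards [hl] with y hy using bar_sup_range hy.2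

/-- `T̄` has a frame made of a frame of `T̄_rel` and lifts of antiholomorphic coordinate fields. The
three kinds of brackets are settled by integrability of `T̄_rel`, by the lifting condition, and by
zero curvature. -/
theorem isInvolutive_barT_of_curvature (hα : Continuous α) (hD : IsSplitting R D)
    (hDh : IsVerticallyHolomorphic R D) (hK : IsCurvatureForm R (totalOp R c D) 0) :
    IsInvolutive (barT R D) := by
  refine isInvolutive_of_bracket_mem fun z V W hV hW => ?_
  obtain ⟨l, hl, hlh⟩ := (isVerticallyHolomorphic_iff hα).1 hDh z
  obtain ⟨n, e, he, hf⟩ := exists_frame_barT hα hD.splits hl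
  have hs := fun k => smoothNear_antiholFrame (E := E) (α z) k
  refine hf.bracket_mem_of_frame ?_ hV hW
  rintro (j | j) (k | k)
  · exact bar_le_barT (R.involutive_bar.bracket_mem (he.isSectionAt j) (he.isSectionAt k))
  · exact bar_le_barT (hlh.self_of_nhds _ (hs k) _ (he.isSectionAt j))
  · rw [bracket_swap]
    exact bar_le_barT (Submodule.neg_mem _ (hlh.self_of_nhds _ (hs j) _ (he.isSectionAt k)))
  · refine bar_le_barT (hK.bracket_mem_bar (hs j) (hs k) (hl.isSmoothAt _ (hs j))
      (hl.isSmoothAt _ (hs k)) ?_ ?_ ?_)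
    · exact hl.mono fun y hy => (hy.2 _).trans (totalOp_of_T01 _).symm
    · exact hl.mono fun y hy => (hy.2 _).trans (totalOp_of_T01 _).symm
    · exact bracket_conj_holField_conj_holField (mem_chart_source E (α z)) _ _

/-- Holomorphy: a representative `V` of `∇a` preserves `T̄_rel`, and modulo `T̄_rel` it commutes
with the lifts of antiholomorphic coordinate fields, since these fields commute with a holomorphic
`a`. Flatness: lifts in `T` of the holomorphic coordinate frame have brackets in `T` by
integrability and in `T̄_rel` by zero curvature, hence zero. -/
theorem isHolomorphicFlatBundle_of_curvature (hα : Continuous α) (hD : IsSplitting R D)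
    (hc : IsAlmostConnection R D c) (hDh : IsVerticallyHolomorphic R D)
    (hch : IsVerticallyHolomorphic R c) (hK : IsCurvatureForm R (totalOp R c D) 0) :
    IsHolomorphicFlatBundle R D c := by
  have hi := isInvolutive_barT_of_curvature hα hD hDh hK
  refine ⟨⟨hD, hi⟩, hc, ?_, ?_⟩
  · intro W a hW ha U V hU hUW hV hVc
    refine (bracketPreserves_iff hU).2 fun z hz u hu => ?_
    obtain ⟨l, hl⟩ := ((isSplitting_iff hα).1 hD).2 z
    obtain ⟨m, hm, hmh⟩ := (isVerticallyHolomorphic_iff hα).1 hch z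
    obtain ⟨n, e, he, hf⟩ := exists_frame_barT hα hD.splits hl
    have has := (ha.smoothOn hW).eventually hW (hUW hz)
    have hVs : SmoothNear V z := hV.eventually hU hz
    have hVc' : ∀ᶠ y in 𝓝 z, (R.bar y).mkQ (V y) = c y (a (α y)) := by
      filter_upwards [hU.mem_nhds hz] with y hy using (hVc y hy).2
    have hms : SmoothNear (fun y => m y (a (α y))) z := hm.isSmoothAt a has
    refine hf.bracket_mem le_rfl ?_ hu
    rintro (k | k)
    · have h1 : IsSectionAt R.bar (V - fun y => m y (a (α y))) z := by
        refine (hVs.sub hms).isSectionAt ?_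
        filter_upwards [hVc', hm] with y h2 h3
        exact R.mkQ_eq_iff.1 (h2.trans (h3.2 _).symm)
      have h2 : PreservesAt R.bar V z :=
        ((hmh.self_of_nhds a has).add hms.smoothAt (R.preservesAt_of_section h1)
          h1.smoothAt).congr (Eventually.of_forall fun y => (add_sub_cancel _ _).symm)
      exact bar_le_barT (h2 _ (he.isSectionAt k))
    · have hs := smoothNear_antiholFrame (E := E) (α z) k
      refine bar_le_barT (hK.bracket_mem_bar hs has (hl.isSmoothAt _ hs) hVs ?_ ?_ ?_)
      · exact hl.mono fun y hy => (hy.2 _).trans (totalOp_of_T01 _).symm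
      · exact hVc'.mono fun y hy => hy.trans (totalOp_of_T10 _).symm
      · exact ha.bracket_conj_holField hW (hUW hz) _
  · refine isInvolutive_of_bracket_mem fun z V W hV hW => ?_
    obtain ⟨l, hl⟩ := ((isSplitting_iff hα).1 hD).2 z
    obtain ⟨m, hm⟩ := ((isSplitting_iff hα).1 hc.isSplitting).2 z
    have hn : ∀ᶠ y in 𝓝 z, (∀ ξ, acsLift R m l y ξ ∈ acsT R D y) ∧
        IsLiftAt R c (acsLift R m l) y := by
      filter_upwards [hm.eventually, hl.eventually] with y h1 h2
      exact acsLift_spec hc.isSplitting.splits hD.splits h1 h2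
    have hnl := hn.self_of_nhds.2
    have hf := (isFrameAt_range hα (isFrameAt_holFrame (mem_chart_source E (α z)))
      hnl.isSmoothAt (hnl.dC_eq hc.isSplitting.splits)).congr_subbundle (Q := fun y =>
        acsT R D y ⊓ (LinearMap.range (c y)).comap (R.bar y).mkQ) (by
        filter_upwards [hn] with y hy
        exact range_acsLift hD.splits hy.1 hy.2.self_of_nhds.2)
    refine hf.bracket_mem_of_frame (fun j k => ?_) hV hW
    have hs := fun k => smoothNear_holFrame (E := E) (α z) k
    have hsec : ∀ k, IsSectionAt (acsT R D)
        (fun y => acsLift R m l y (holFrame E (α z) k (α y))) z := fun k =>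
      (hnl.isSmoothAt _ (hs k)).isSectionAt (hn.mono fun y hy => hy.1 _)
    have h1 : bracket (fun y => acsLift R m l y (holFrame E (α z) j (α y)))
        (fun y => acsLift R m l y (holFrame E (α z) k (α y))) z = 0 := by
      refine eq_zero_of_mem_acsT_of_mem_bar hD.splits (hi.conj.bracket_mem (hsec j) (hsec k)) ?_
      refine hK.bracket_mem_bar (hs j) (hs k) (hsec j).smoothNear (hsec k).smoothNear ?_ ?_ ?_
      · exact hnl.mono fun y hy => (hy.2 _).trans (totalOp_of_T10 _).symm
      · exact hnl.mono fun y hy => (hy.2 _).trans (totalOp_of_T10 _).symm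
      · exact bracket_holField_holField (mem_chart_source E (α z)) _ _
    rw [h1]
    exact Submodule.zero_mem _

end Forward

/-! ### A holomorphic flat bundle has zero curvature. -/

section Backward

theorem IsCurvatureForm.eq_zero_of_bracket_mem_bar (hK : IsCurvatureForm R (totalOp R c D) K)
    {a b : ∀ s : S, CT E s} {X Y : ∀ z : Z, CT EZ z} (ha : SmoothNear a (α z))
    (hb : SmoothNear b (α z)) (hX : SmoothNear X z) (hY : SmoothNear Y z)
    (hXa : ∀ᶠ y in 𝓝 z, (R.bar y).mkQ (X y) = totalOp R c D y ⟨a (α y), trivial⟩)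
    (hYb : ∀ᶠ y in 𝓝 z, (R.bar y).mkQ (Y y) = totalOp R c D y ⟨b (α y), trivial⟩)
    (h0 : bracket a b (α z) = 0) (h : bracket X Y z ∈ R.bar z) :
    K z (a (α z)) (b (α z)) = 0 := by
  have h1 := hK.mkQ_bracket z a b X Y ha hb hX hY hXa hYb
  rw [totalOp_of_eq_zero h0, add_zero] at h1
  exact R.eq_zero_of_mem (hK.mem _ _ _) ((Submodule.Quotient.mk_eq_zero _).1
    (h1.symm.trans ((Submodule.Quotient.mk_eq_zero _).2 h)))

/-- On coordinate fields, which commute, the bracket of lifts is vertical and represents the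
curvature. It falls into `T̄_rel` for a different reason in each type: closedness of the image of
`∇` for `(2,0)`, integrability of `T̄` for `(0,2)`, holomorphy of `∇` for `(1,1)`. -/
theorem IsHolomorphicFlatBundle.curvature_eq_zero (hα : ContMDiff 𝓘(ℝ, EZ) 𝓘(ℝ, E) ∞ α)
    (hF : IsHolomorphicFlatBundle R D c) (hK : IsCurvatureForm R (totalOp R c D) K) : K = 0 := by
  have hD := hF.fibration.isSplitting
  have hc := hF.connection.isSplitting
  have hsw : ∀ (z : Z) (ξ η : CT E (α z)), K z ξ η = 0 → K z η ξ = 0 := fun z ξ η h => by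
    have h0 := hK.alternating hα.continuous (isSplitting_totalOp hα.continuous hc hD)
    have h1 := h0 z (ξ + η)
    simpa only [map_add, LinearMap.add_apply, h0, zero_add, add_zero, h] using h1
  funext z
  obtain ⟨l, hl⟩ := ((isSplitting_iff hα.continuous).1 hD).2 z
  obtain ⟨m, hm⟩ := ((isSplitting_iff hα.continuous).1 hc).2 z
  have hn : ∀ᶠ y in 𝓝 z, (∀ ξ, acsLift R m l y ξ ∈ acsT R D y) ∧
      IsLiftAt R c (acsLift R m l) y := by
    filter_upwards [hm.eventually, hl.eventually] with y h1 h2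
    exact acsLift_spec hc.splits hD.splits h1 h2
  have hnl := hn.self_of_nhds.2
  have hsrc := mem_chart_source E (α z)
  have hs : ∀ v : E, SmoothNear (fun s => (holField E (α z) v s : CT E s)) (α z) := fun v => by
    filter_upwards [(chartAt E (α z)).open_source.mem_nhds hsrc] with t ht
    exact smoothAt_holField ht v
  let X : E → ∀ y : Z, CT EZ y := fun v y => acsLift R m l y (holField E (α z) v (α y))
  let Y : E → ∀ y : Z, CT EZ y := fun v y => l y (conj10 (holField E (α z) v (α y)))
  have hXs : ∀ v, SmoothNear (X v) z := fun v => hnl.isSmoothAt _ (hs v)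
  have hYs : ∀ v, SmoothNear (Y v) z := fun v =>
    hl.isSmoothAt (fun s => conj10 (holField E (α z) v s)) (hs v).conj
  have hXt : ∀ v, ∀ᶠ y in 𝓝 z, (R.bar y).mkQ (X v y)
      = totalOp R c D y ⟨(holField E (α z) v (α y)).1, trivial⟩ := fun v =>
    hnl.mono fun y hy => (hy.2 _).trans (totalOp_of_T10 _).symm
  have hYt : ∀ v, ∀ᶠ y in 𝓝 z, (R.bar y).mkQ (Y v y)
      = totalOp R c D y ⟨(conj10 (holField E (α z) v (α y))).1, trivial⟩ := fun v =>
    hl.mono fun y hy => (hy.2 _).trans (totalOp_of_T01 _).symm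
  have hYb : ∀ v, IsSectionAt (barT R D) (Y v) z := fun v =>
    (hYs v).isSectionAt (hl.mono fun y hy => mem_barT_of_mkQ (hy.2 _))
  have h20 : ∀ v w : E,
      K z (holField E (α z) v (α z)).1 (holField E (α z) w (α z)).1 = 0 := fun v w => by
    have h0 := bracket_holField_holField hsrc v w
    refine hK.eq_zero_of_bracket_mem_bar (hs v) (hs w) (hXs v) (hXs w) (hXt v) (hXt w) h0 ?_
    have hsec : ∀ v, IsSectionAt (fun y => acsT R D y ⊓
        (LinearMap.range (c y)).comap (R.bar y).mkQ) (X v) z := fun v =>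
      (hXs v).isSectionAt (hn.mono fun y hy => ⟨hy.1 _, _, (hy.2.self_of_nhds.2 _).symm⟩)
    -- The bracket represents the value of the connection at some `ξ`; it projects to zero on the
    -- base, so `ξ = 0` and its class is trivial.
    obtain ⟨-, ξ, hξ⟩ := hF.flat.bracket_mem (hsec v) (hsec w)
    have h1 : dC E EZ α z (bracket (X v) (X w) z) = 0 :=
      (bracket_related hα.contMDiffAt (hXs v).smoothAt (hXs w).smoothAt (hs v).smoothAt
        (hs w).smoothAt ((hnl.dC_eq hc.splits).mono fun y hy => hy _)
        ((hnl.dC_eq hc.splits).mono fun y hy => hy _)).trans h0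
    rw [dC_of_mkQ hc.splits hξ.symm] at h1
    rw [show ξ = 0 from Subtype.ext h1, map_zero] at hξ
    exact (Submodule.Quotient.mk_eq_zero _).1 hξ.symm
  have h02 : ∀ v w : E, K z (conj10 (holField E (α z) v (α z))).1
      (conj10 (holField E (α z) w (α z))).1 = 0 := fun v w => by
    have h0 := bracket_conj_holField_conj_holField hsrc v w
    refine hK.eq_zero_of_bracket_mem_bar (a := fun s => (conj10 (holField E (α z) v s)).1)
      (b := fun s => (conj10 (holField E (α z) w s)).1) (hs v).conj (hs w).conj (hYs v) (hYs w)
      (hYt v) (hYt w) h0 ?_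
    refine mem_bar_of_mem_barT hD.splits (hF.fibration.integrable.bracket_mem (hYb v) (hYb w)) ?_
    exact (bracket_related hα.contMDiffAt (hYs v).smoothAt (hYs w).smoothAt
      (a := fun s => (conj10 (holField E (α z) v s)).1)
      (b := fun s => (conj10 (holField E (α z) w s)).1) (hs v).conj.smoothAt
      (hs w).conj.smoothAt ((hl.dC_eq hD.splits).mono fun y hy => hy _)
      ((hl.dC_eq hD.splits).mono fun y hy => hy _)).trans h0
  have h11 : ∀ v w : E, K z (conj10 (holField E (α z) v (α z))).1
      (holField E (α z) w (α z)).1 = 0 := fun v w => by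
    have h0 := bracket_conj_holField_holField hsrc v w
    refine hK.eq_zero_of_bracket_mem_bar (a := fun s => (conj10 (holField E (α z) v s)).1)
      (hs v).conj (hs w) (hYs v) (hXs w) (hYt v) (hXt w) h0 ?_
    refine mem_bar_of_mem_barT hD.splits ?_ ((bracket_related hα.contMDiffAt (hYs v).smoothAt
      (hXs w).smoothAt (a := fun s => (conj10 (holField E (α z) v s)).1) (hs v).conj.smoothAt
      (hs w).smoothAt ((hl.dC_eq hD.splits).mono fun y hy => hy _)
      ((hnl.dC_eq hc.splits).mono fun y hy => hy _)).trans h0)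
    obtain ⟨U, hU, hUo, hzU⟩ := eventually_nhds_iff.1 ((hn.and (hXs w)).and
      (hα.continuous.continuousAt.eventually ((chartAt E (α z)).open_source.mem_nhds hsrc)))
    exact (bracketPreserves_iff hUo).1 (hF.holomorphic _ _ (chartAt E (α z)).open_source
      (holomorphicOn_holField (α z) w) U (X w) hUo (fun y hy => (hU y hy).2)
      (smoothOn_of_smoothAt fun y hy => (hU y hy).1.2)
      fun y hy => ⟨(hU y hy).1.1.1 _, (hU y hy).1.1.2.self_of_nhds.2 _⟩) z hzU _ (hYb v)
  -- The coordinate fields exhaust `T_S` at `α z`, so every pair of complex base vectors splits into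
  -- the types already treated.
  have hex : ∀ ξ : T10 E (α z), ∃ v : E, holField E (α z) v (α z) = ξ := fun ξ =>
    ⟨_, holField_mvfderiv hsrc ξ⟩
  ext1 ξ
  ext1 η
  obtain ⟨v, hv⟩ := hex (proj10 (α z) ξ)
  obtain ⟨v', hv'⟩ := hex (conj01 (proj01 (α z) ξ))
  obtain ⟨w, hw⟩ := hex (proj10 (α z) η)
  obtain ⟨w', hw'⟩ := hex (conj01 (proj01 (α z) η))
  change K z ξ η = 0
  rw [← proj10_add_proj01 (α z) ξ, ← proj10_add_proj01 (α z) η, ← conj10_conj01 (proj01 (α z) ξ),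
    ← conj10_conj01 (proj01 (α z) η), ← hv, ← hv', ← hw, ← hw']
  simp only [map_add, LinearMap.add_apply, h20, h02, h11, hsw _ _ _ (h11 _ _), add_zero]

end Backward

end Bundle

end

end NonlinearHodge

/-! ### Assembly of the operators, the curvature and the flatness criterion. -/

theorem proposition5p2
    {E EZ EF : Type*}
    [NormedAddCommGroup E] [NormedSpace ℂ E] [FiniteDimensional ℂ E]
    [NormedAddCommGroup EZ] [NormedSpace ℝ EZ] [FiniteDimensional ℝ EZ]
    [NormedAddCommGroup EF] [NormedSpace ℝ EF] [FiniteDimensional ℝ EF]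
    {S : Type*} [TopologicalSpace S] [T2Space S] [SecondCountableTopology S]
    [ChartedSpace E S] [IsManifold 𝓘(ℂ, E) ω S]
    {Z : Type*} [TopologicalSpace Z] [T2Space Z] [SecondCountableTopology Z]
    [ChartedSpace EZ Z] [IsManifold 𝓘(ℝ, EZ) ∞ Z]
    {F : Type*} [TopologicalSpace F] [ChartedSpace EF F] [IsManifold 𝓘(ℝ, EF) ∞ F]
    (α : Z → S) (hα : IsSmoothFiberBundle E EZ EF F α)
    (A B : RelComplexStructure E EZ α)
    (β : BundleAut A B) (hβ : β.PreservesLocalLifting)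
    (dbar : BaseMap B (T01 E)) (hg : IsHolomorphicFibration B dbar)
    (θ : LiftMap EZ α (T10 E)) (hθ : IsHolomorphicHiggsField B dbar θ)
    (Ω : TwoForm EZ Z) (hΩ : IsAllowable β dbar θ Ω)
    (θ' : LiftMap EZ α (T01 E)) (hθ' : IsComplexConjugation B Ω θ θ') :
    IsSplitting A (simpsonDbar β dbar θ') ∧
    (∃! c, IsChernConnection A (simpsonDbar β dbar θ') Ω c) ∧
    ∀ c, IsChernConnection A (simpsonDbar β dbar θ') Ω c →
      IsAlmostConnection A (simpsonDbar β dbar θ') (simpsonNabla β c θ) ∧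
      IsSplitting A (totalOp A (simpsonNabla β c θ) (simpsonDbar β dbar θ')) ∧
      (IsVerticallyHolomorphic A (simpsonDbar β dbar θ') ∧
        IsVerticallyHolomorphic A (simpsonNabla β c θ)) ∧
      (∃! G, IsCurvatureTensor β
        (totalOp A (simpsonNabla β c θ) (simpsonDbar β dbar θ')) G) ∧
      ∀ G, IsCurvatureTensor β
          (totalOp A (simpsonNabla β c θ) (simpsonDbar β dbar θ')) G →
        (∃ G02 G11 G20 : BaseTwoForm E EZ α,
          IsVerticalTwoForm B G02 ∧ HasType02 G02 ∧
          IsVerticalTwoForm B G11 ∧ HasType11 G11 ∧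
          IsVerticalTwoForm B G20 ∧ HasType20 G20 ∧
          G = G02 + G11 + G20) ∧
        (G = 0 ↔
          IsHolomorphicFlatBundle A (simpsonDbar β dbar θ') (simpsonNabla β c θ)) := by
  have hαc := hα.1.continuous
  have hθs : ∀ y, θ.IsSmoothAt y := fun y =>
    (LiftMap.smoothOn_iff hαc isOpen_univ).1 hθ.smooth y trivial
  have hθs' : ∀ y, θ'.IsSmoothAt y := fun y =>
    (LiftMap.smoothOn_iff hαc isOpen_univ).1 hθ'.smooth y trivial
  have hm' : ∀ z ξ, θ' z ξ ∈ B.T z := fun z ξ => hθ'.mem ξ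
  have hs : IsSplitting A (simpsonDbar β dbar θ') :=
    isSplitting_simpsonDbar hαc hg.isSplitting hθs' hm'
  have hsh : IsVerticallyHolomorphic A (simpsonDbar β dbar θ') :=
    isVerticallyHolomorphic_simpsonDbar hα.1 hβ.1 hg hθs' hm' fun _ =>
      hθ'.isVerticallyHolomorphicAt hα
  obtain ⟨cB, hcB, hcBh⟩ := hΩ.chern
  have hcA := isChernConnection_quotInv (β := β) (θ' := θ') hαc hg.isSplitting hm' hΩ.hermitian
    hΩ.preserved hcB
  have huniq : ∀ c, IsChernConnection A (simpsonDbar β dbar θ') Ω c → c = _ := fun c hc =>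
    IsChernConnection.unique (hΩ.hermitian.of_preserved hΩ.preserved) hs.splits hc hcA
  refine ⟨hs, ⟨_, hcA, huniq⟩, fun c hc => ?_⟩
  have hn := isAlmostConnection_simpsonNabla (β := β) hαc hc.almostConnection hθs hθ.mem
  have hnh : IsVerticallyHolomorphic A (simpsonNabla β c θ) := by
    -- By uniqueness `c` is `β⁻¹` of the Chern connection of `∂̄_g`, whose holomorphy along the
    -- vertical direction is part of allowability.
    rw [huniq c hc]
    exact isVerticallyHolomorphic_simpsonNabla hαc hβ.2 hcB.almostConnection.isSplitting hcBh hθs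
      hθ.mem fun y => hΩ.adapted.isVerticallyHolomorphicAt hα (hθs y)
  have ht := isSplitting_totalOp hαc hn.isSplitting hs
  have hth := isVerticallyHolomorphic_totalOp hαc hnh hsh
  obtain ⟨K, hK⟩ := exists_isCurvatureForm hα.1 ht.splits hth
  have hG := hK.isCurvatureTensor hα.1 hβ.2 ht hth hn.isSplitting hnh
  refine ⟨hn, ht, ⟨hsh, hnh⟩, ⟨_, hG, fun G hG' => hG'.eq_compr₂ hαc ht hK⟩, fun G hG' =>
    ⟨hG'.isVerticalTwoForm.exists_types hαc, ?_⟩⟩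
  rw [hG'.eq_compr₂ hαc ht hK]
  constructor
  · intro h
    have hK0 : K = 0 := by
      funext z
      ext1 ξ
      ext1 η
      have h1 : β.cmap z (K z ξ η) = 0 :=
        congrArg (fun G : BaseTwoForm E EZ α => G z ξ η) h
      rw [← β.cinv_cmap z (K z ξ η), h1, map_zero]
      rfl
    rw [hK0] at hK
    exact isHolomorphicFlatBundle_of_curvature hαc hs hn hsh hnh hK
  · intro h
    rw [h.curvature_eq_zero hα.1 hK]
    funext z
    ext1 ξ
    ext1 η
    exact map_zero (β.cmap z)
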